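/- **Setting.** Let $L^2_{\rm per}$ and $H^s_{\rm per}$ ($s\ge 0$) be the complex $2\pi$-periodic Lebesgue and Sobolev spaces, $\mathbb T=[-\frac12,\frac12]$, and let $\langle f\rangle$ be the mean value of $f$. For $(a,c)$ near $(0,c_0)$ let $K_{a,c}$ be a real operator on the line with $2\pi$-periodic coefficients, with Bloch fibres $$P_{a,c}(\kappa)=e^{-i\kappa z}K_{a,c}\,e^{i\kappa z}=T_{a,c}(\kappa)+\frac{\nu}{\kappa^2}\langle\cdot\rangle ,\qquad \kappa\in\mathbb T ,$$ where $\nu\ge 0$ is a constant and $T_{a,c}(\kappa):H^s_{\rm per}\to L^2_{\rm per}$ is $C^\infty$ in $(a,c,\kappa)$ in operator norm near $\{(0,c_0)\}\times\mathbb T$ and self-adjoint in $L^2_{\rm per}$ with domain $H^s_{\rm per}$. (The term with $\nu$ is the singular part, in the zeroth Fourier mode, of $-\nu(\partial_z+i\kappa)^{-2}$; it is absent for $\nu=0$. If $\nu>0$, then $P_{a,c}(0)$ is the compression of $T_{a,c}(0)$ to the functions with zero mean, and $P_{a,c}'(0)$ is the compression of $\partial_\kappa T_{a,c}(0)$.)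 Reality means $\overline{T_{a,c}(\kappa)w}=T_{a,c}(-\kappa)\overline w$. For $a=0$ the operators have constant coefficients: $P_{0,c}(\kappa)e^{inz}=\lambda^{(0)}_n(\kappa)e^{inz}$, $n\in\mathbb Z$. **Assumption 1.** For $c=c_0$ and all $\kappa\in\mathbb T$, $n\in\mathbb Z$ (except $n=0$, $\kappa=0$ if $\nu>0$): $\lambda_n^{(0)}(\kappa)\ge 0$, and $\lambda_n^{(0)}(\kappa)\ge C_1$ for $n\ne\pm1$ with some $C_1>0$; moreover $\lambda_{\pm1}^{(0)}(\kappa)=\frac12\lambda''(0)\kappa^2+O(\kappa^3)$ as $\kappa\to0$, with $\lambda''(0)>0$. **Assumption 2.** For all small $a\neq 0$ and all $c$ near $c_0$ there are eigenfunctions $W_a$ (independent of $c$; for a wave profile $U$ this is $W_a=-a^{-1}U'$) and $V_{a,c}$ with $P_{a,c}(0)W_a=0$, $P_{a,c}(0)V_{a,c}=\lambda(a,c)V_{a,c}$, $\lambda(a,c)>0$, normalized by $W_a=\sin z+O(a)$, $V_{a,c}=\cos z+O(a)$ in $L^2_{\rm per}$ uniformly in $c$, and $\lambda(a,c)=\lambda_2(c)a^2+O(a^3)$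 uniformly in $c$, where $\lambda_2$ is smooth at $c_0$ and $\lambda_2(c_0)>0$. **Assumption 3.** With a real number $\mu_1\ne0$, in $L^2_{\rm per}$ and uniformly for $c$ near $c_0$, $$P_{a,c}'(0)W_a=-i\mu_1(c-c_0)\cos z+aF_c+O(a^2),\qquad P_{a,c}'(0)V_{a,c}=i\mu_1(c-c_0)\sin z+a\tilde F_c+O(a^2),$$ where $F_c$ is even with $\langle\cos,F_c\rangle=0$, $\tilde F_c$ is odd with $\langle\sin,\tilde F_c\rangle=0$, and both are bounded in $L^2_{\rm per}$ for $c$ near $c_0$. **Proposition.** Under these assumptions, for every $C>0$ there are $a_0,\kappa_0,M>0$ with $Ca_0^2\le\kappa_0$ such that the following holds for all $a$, $c$ with $0<|a|<a_0$ and $|c-c_0|\le C|a|$. For $|\kappa|\le\kappa_0$ the two lowest points of the spectrum of $P_{a,c}(\kappa)$, counted with multiplicity, are eigenvalues $\lambda_{\rm gr}(\kappa)\le\lambda_{\rm ex}(\kappa)$; and for $|\kappa|\le Ca^2$, $$\lambda_{\rm gr}(\kappa)=\Big(\tfrac12\lambda''(0)-\frac{\mu_1^2(c-c_0)^2}{\lambda_2(c_0)a^2}+r_1\Big)\kappa^2+\kappa^3\tilde\lambda_{\rm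 gr},$$ $$\lambda_{\rm ex}(\kappa)=\lambda_2(c_0)a^2+r_0+\Big(\tfrac12\lambda''(0)+\frac{\mu_1^2(c-c_0)^2}{\lambda_2(c_0)a^2}+r_2\Big)\kappa^2+\kappa^3\tilde\lambda_{\rm ex},$$ where $r_0,r_1,r_2$ depend only on $(a,c)$, $|r_0|\le M|a|^3$, $|r_1|,|r_2|\le M|a|$, and $|\tilde\lambda_{\rm gr}|,|\tilde\lambda_{\rm ex}|\le M$. **Corollary.** If in addition $\lambda^{(0)}_{\pm1}(\kappa)>0$ at $c=c_0$ for all $\kappa\in\mathbb T\setminus\{0\}$, then there are functions $c_\pm$ of $a$ with $$c_\pm(a)=c_0\pm\frac{\sqrt{\lambda_2(c_0)\lambda''(0)}}{\sqrt2\,|\mu_1|}\,|a|+O(a^2)\quad\text{as } a\to0,$$ such that for all small $a\ne0$ and all $c\in(c_-(a),c_+(a))$ the operator $K_{a,c}$ is positive up to the translation mode: for every $\kappa\in\mathbb T$ and every nonzero $w$ in the domain of $P_{a,c}(\kappa)$ one has $\langle P_{a,c}(\kappa)w,w\rangle>0$, unless $\kappa=0$ and $w$ is a multiple of $W_a$,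 where $P_{a,c}(0)W_a=0$. -/

import Mathlib

open MeasureTheory Filter Topology Set
open scoped ContDiff

noncomputable section

namespace Bloch

instance factTwoPiPos : Fact (0 < 2 * Real.pi) := ⟨Real.two_pi_pos⟩

/-! ### The spaces `L²_per` and `H^s_per` -/

/-- Complex `2π`-periodic square-integrable functions. The measure is the Lebesgue measure of a
period divided by `2π`. -/
abbrev L2per : Type :=
  Lp ℂ 2 (AddCircle.haarAddCircle : Measure (AddCircle (2 * Real.pi)))

/-- The function `z ↦ exp (i n z)` as an element of `L²_per`. -/
def mode (n : ℤ) : L2per := fourierLp 2 n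

/-- The `n`-th Fourier coefficient. -/
def coeff (n : ℤ) (f : L2per) : ℂ := inner ℂ (mode n) f

/-- `cos z = (exp (iz) + exp (-iz)) / 2` in `L²_per`. -/
def cosF : L2per := (1 / 2 : ℂ) • (mode 1 + mode (-1))

/-- `sin z = (exp (iz) - exp (-iz)) / (2i)` in `L²_per`. -/
def sinF : L2per := (1 / (2 * Complex.I)) • (mode 1 - mode (-1))

def IsEvenF (f : L2per) : Prop :=
  (fun z => f (-z)) =ᵐ[AddCircle.haarAddCircle] fun z => f z

def IsOddF (f : L2per) : Prop :=
  (fun z => f (-z)) =ᵐ[AddCircle.haarAddCircle] fun z => -f z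

/-- The Sobolev weight `(1 + n²)^{s/2}`. -/
def weight (s : ℝ) (n : ℤ) : ℝ := (1 + (n : ℝ) ^ 2) ^ (s / 2)

theorem weight_pos (s : ℝ) (n : ℤ) : 0 < weight s n := by
  unfold weight; positivity

/-- The Sobolev space `H^s_per` as a subspace of `L²_per`: the sequence
`(1 + n²)^{s/2} coeff n f` is square summable. -/
def sobolev (s : ℝ) : Submodule ℂ L2per where
  carrier := {f | Memℓp (fun n : ℤ => (weight s n : ℂ) * coeff n f) 2}
  add_mem' := by
    intro f g hf hg
    have h := Memℓp.add hf hg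
    have e : (fun n : ℤ => (weight s n : ℂ) * coeff n (f + g)) =
        (fun n : ℤ => (weight s n : ℂ) * coeff n f) +
          fun n : ℤ => (weight s n : ℂ) * coeff n g := by
      funext n
      simp [coeff, inner_add_right, mul_add]
    simp only [Set.mem_ofPred_eq]
    rw [e]
    exact h
  zero_mem' := by
    have e : (fun n : ℤ => (weight s n : ℂ) * coeff n (0 : L2per)) = 0 := by
      funext n
      simp [coeff]
    simp only [Set.mem_ofPred_eq]
    rw [e]
    exact zero_memℓp
  smul_mem' := by
    intro c f hf
    have h := Memℓp.const_smul hf c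
    have e : (fun n : ℤ => (weight s n : ℂ) * coeff n (c • f)) =
        c • fun n : ℤ => (weight s n : ℂ) * coeff n f := by
      funext n
      simp [coeff, inner_smul_right]
      ring
    simp only [Set.mem_ofPred_eq]
    rw [e]
    exact h

/-- The Sobolev space `H^s_per` as a type of its own, which will carry the Sobolev norm. -/
def Hper (s : ℝ) : Type := sobolev s

instance (s : ℝ) : AddCommGroup (Hper s) := inferInstanceAs (AddCommGroup (sobolev s))
instance (s : ℝ) : Module ℂ (Hper s) := inferInstanceAs (Module ℂ (sobolev s))

/-- The inclusion `H^s_per ⊆ L²_per`. -/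
def toL2 {s : ℝ} : Hper s →ₗ[ℂ] L2per := (sobolev s).subtype

/-- The sequence of weighted Fourier coefficients. -/
def weighted (s : ℝ) : Hper s →ₗ[ℂ] lp (fun _ : ℤ => ℂ) 2 where
  toFun w := ⟨fun n : ℤ => (weight s n : ℂ) * coeff n (toL2 w), w.2⟩
  map_add' := by
    intro f g
    apply lp.ext
    funext n
    simp [coeff, inner_add_right, mul_add]
    rfl
  map_smul' := by
    intro c f
    apply lp.ext
    funext n
    simp [coeff, inner_smul_right]
    ring

theorem weighted_injective (s : ℝ) : Function.Injective (weighted s) := by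
  intro f g h
  apply Subtype.ext
  have key : ∀ n : ℤ, coeff n (toL2 f) = coeff n (toL2 g) := by
    intro n
    have h1 : (weight s n : ℂ) * coeff n (toL2 f) = (weight s n : ℂ) * coeff n (toL2 g) :=
      congrArg (fun u : lp (fun _ : ℤ => ℂ) 2 => u n) h
    exact mul_left_cancel₀ (by exact_mod_cast (weight_pos s n).ne') h1
  have h2 : (fourierBasis (T := 2 * Real.pi)).repr (toL2 f) =
      (fourierBasis (T := 2 * Real.pi)).repr (toL2 g) := by
    apply lp.ext
    funext n
    have h3 := key n
    simp only [HilbertBasis.repr_apply_apply, coe_fourierBasis]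
    exact h3
  exact (fourierBasis (T := 2 * Real.pi)).repr.injective h2

/-- The Sobolev norm `‖w‖² = ∑ (1 + n²)^s |coeff n w|²`. -/
instance (s : ℝ) : NormedAddCommGroup (Hper s) :=
  NormedAddCommGroup.induced _ _ (weighted s) (weighted_injective s)

instance (s : ℝ) : NormedSpace ℂ (Hper s) := NormedSpace.induced ℂ _ _ (weighted s)

theorem inner_mode (m n : ℤ) : inner ℂ (mode m) (mode n) = if m = n then (1 : ℂ) else 0 :=
  orthonormal_iff_ite.mp (orthonormal_fourier (T := 2 * Real.pi)) m n

theorem mode_mem_sobolev (s : ℝ) (n : ℤ) : mode n ∈ sobolev s := by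
  change Memℓp (fun m : ℤ => (weight s m : ℂ) * coeff m (mode n)) 2
  apply memℓp_gen
  apply summable_of_ne_finset_zero (s := {n})
  intro m hm
  have : m ≠ n := by simpa using hm
  simp [coeff, inner_mode, this]

/-- The function `exp (i n z)` as an element of `H^s_per`. -/
def modeH (s : ℝ) (n : ℤ) : Hper s := ⟨mode n, mode_mem_sobolev s n⟩

/-! ### Bloch operator families

A `2π`-periodic operator `K` on the line is described by its fibres
`P(κ) = exp (-iκz) K exp (iκz)` on `L²_per`, `κ` in the Brillouin zone. To include operators
`K = -ν ∂_z^{-2} + …`, whose fibres `-ν (∂_z + iκ)^{-2}` have the symbol `ν / (n + κ)²`, the fibre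
is written as `P(κ) = T(κ) + (ν / κ²) ⟨·⟩` where `⟨·⟩` is the projection onto the constants: only
the symbol of the mode `n = 0` is singular on the Brillouin zone, the other modes belong to `T`.
When `ν ≠ 0`, the fibre at `κ = 0` acts in the space of functions with zero mean, and the output
is projected back to that space; when `ν = 0`, all fibres act in `L²_per`. -/

/-- The Brillouin zone. -/
def BZ : Set ℝ := Icc (-1 / 2) (1 / 2)

/-- The projection onto the constants, `f ↦` (mean value of `f`). -/
def meanProj : L2per →L[ℂ] L2per := (innerSL ℂ (mode 0)).smulRight (mode 0)

/-- The space in which the fibre at `κ` acts. -/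
def fibre (ν κ : ℝ) : Submodule ℂ L2per :=
  open Classical in if ν ≠ 0 ∧ κ = 0 then (ℂ ∙ mode 0)ᗮ else ⊤

/-- The orthogonal projection onto `fibre ν κ`. -/
def fibreProj (ν κ : ℝ) : L2per →L[ℂ] L2per :=
  open Classical in if ν ≠ 0 ∧ κ = 0 then ContinuousLinearMap.id ℂ L2per - meanProj
    else ContinuousLinearMap.id ℂ L2per

/-- The domain of the fibre at `κ`. -/
def dom (s ν κ : ℝ) : Submodule ℂ (Hper s) := (fibre ν κ).comap toL2

/-- A family of operators `H^s_per → L²_per` depending on `(a, c, κ)`. -/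
abbrev Family (s : ℝ) : Type := ℝ → ℝ → ℝ → (Hper s →L[ℂ] L2per)

variable {s : ℝ}

/-- The Bloch operator `P_{c,γ(a)}(κ)`, to be applied to elements of `dom s ν κ`. -/
def P (ν : ℝ) (T : Family s) (a c κ : ℝ) : Hper s →ₗ[ℂ] L2per :=
  (fibreProj ν κ : L2per →ₗ[ℂ] L2per) ∘ₗ
    ((T a c κ : Hper s →ₗ[ℂ] L2per) +
      ((ν / κ ^ 2 : ℝ) : ℂ) • ((meanProj : L2per →ₗ[ℂ] L2per) ∘ₗ toL2))

/-- The derivative `P'_{c,γ(a)}(0)` in `κ`, to be applied to elements of `dom s ν 0`. -/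
def dP (ν : ℝ) (T : Family s) (a c : ℝ) : Hper s →ₗ[ℂ] L2per :=
  (fibreProj ν 0 : L2per →ₗ[ℂ] L2per) ∘ₗ
    (deriv (fun κ => T a c κ) 0).toLinearMap

/-- An operator `H^s_per → L²_per` as an unbounded operator in `L²_per` with domain `H^s_per`. -/
def toUnbounded (A : Hper s →L[ℂ] L2per) : L2per →ₗ.[ℂ] L2per where
  domain := sobolev s
  toFun := { toFun := fun w => A w, map_add' := A.map_add, map_smul' := A.map_smul }

/-- `P` is a smooth family (in the operator norm from `H^s_per` to `L²_per`) of self-adjoint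
operators with domain `H^s_per`, it is the fibre family of a real operator, and for `a = 0` it has
constant coefficients. -/
structure IsBlochFamily (ν c₀ : ℝ) (T : Family s) : Prop where
  nu_nonneg : 0 ≤ ν
  smooth : ∀ κ ∈ BZ, ContDiffAt ℝ ∞ (fun p : ℝ × ℝ × ℝ => T p.1 p.2.1 p.2.2) (0, c₀, κ)
  selfAdjoint : ∀ᶠ p : ℝ × ℝ in 𝓝 (0, c₀), ∀ κ ∈ BZ, IsSelfAdjoint (toUnbounded (T p.1 p.2 κ))
  real : ∀ᶠ p : ℝ × ℝ in 𝓝 (0, c₀), ∀ κ ∈ BZ, ∀ w w' : Hper s, toL2 w' = star (toL2 w) →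
    T p.1 p.2 (-κ) w' = star (T p.1 p.2 κ w)
  constCoeff : ∀ᶠ c in 𝓝 c₀, ∀ κ ∈ BZ, ∀ n : ℤ, ∃ t : ℂ, T 0 c κ (modeH s n) = t • mode n

/-- The unperturbed band `λ_n^{(0)}(κ)`: the eigenvalue of `P_c^{(0)}(κ)` for the eigenfunction
`exp (i n z)`. -/
def band (ν : ℝ) (T : Family s) (c : ℝ) (n : ℤ) (κ : ℝ) : ℝ :=
  (inner ℂ (mode n) (P ν T 0 c κ (modeH s n))).re

/-- At `c = c₀` the unperturbed bands are nonnegative, the bands `n = ±1` touch zero at `κ = 0`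
with second derivative `d > 0`, and the others are bounded away from zero. -/
structure UnperturbedBands (ν c₀ : ℝ) (T : Family s) (d : ℝ) : Prop where
  d_pos : 0 < d
  nonneg : ∀ κ ∈ BZ, ∀ n : ℤ, mode n ∈ fibre ν κ → 0 ≤ band ν T c₀ n κ
  convex_one : (fun κ => band ν T c₀ 1 κ - 1 / 2 * d * κ ^ 2) =O[𝓝 0] fun κ => κ ^ 3
  convex_neg_one : (fun κ => band ν T c₀ (-1) κ - 1 / 2 * d * κ ^ 2) =O[𝓝 0] fun κ => κ ^ 3
  gap : ∃ C > 0, ∀ κ ∈ BZ, ∀ n : ℤ, n ≠ 1 → n ≠ -1 → mode n ∈ fibre ν κ → C ≤ band ν T c₀ n κ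

/-- For small `a ≠ 0` and `c` near `c₀`, the operator `K = P(0)` has the eigenvalue zero with
eigenfunction `W_a = sin + O(a)` independent of `c`, and the positive eigenvalue
`lam a c = lam2 c * a² + O(a³)` with eigenfunction `V_{a,c} = cos + O(a)`. -/
structure SplitEigenvalues (ν c₀ : ℝ) (T : Family s) (lam2 : ℝ → ℝ) (lam : ℝ → ℝ → ℝ)
    (W : ℝ → Hper s) (V : ℝ → ℝ → Hper s) : Prop where
  lam2_smooth : ContDiffAt ℝ ∞ lam2 c₀
  lam2_pos : 0 < lam2 c₀
  lam_expansion : ∃ M : ℝ, ∀ᶠ p : ℝ × ℝ in 𝓝 (0, c₀), p.1 ≠ 0 →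
    |lam p.1 p.2 - lam2 p.2 * p.1 ^ 2| ≤ M * |p.1| ^ 3
  lam_pos : ∀ᶠ p : ℝ × ℝ in 𝓝 (0, c₀), p.1 ≠ 0 → 0 < lam p.1 p.2
  eigen_W : ∀ᶠ p : ℝ × ℝ in 𝓝 (0, c₀), p.1 ≠ 0 →
    W p.1 ∈ dom s ν 0 ∧ P ν T p.1 p.2 0 (W p.1) = 0
  eigen_V : ∀ᶠ p : ℝ × ℝ in 𝓝 (0, c₀), p.1 ≠ 0 →
    V p.1 p.2 ∈ dom s ν 0 ∧
      P ν T p.1 p.2 0 (V p.1 p.2) = (lam p.1 p.2 : ℂ) • toL2 (V p.1 p.2)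
  W_expansion : ∃ M : ℝ, ∀ᶠ a in 𝓝 (0 : ℝ), a ≠ 0 → ‖toL2 (W a) - sinF‖ ≤ M * |a|
  V_expansion : ∃ M : ℝ, ∀ᶠ p : ℝ × ℝ in 𝓝 (0, c₀), p.1 ≠ 0 →
    ‖toL2 (V p.1 p.2) - cosF‖ ≤ M * |p.1|

/-- The expansions `P'(0) W_a = -i μ (c - c₀) cos + a F_c + O(a²)` and
`P'(0) V_{a,c} = i μ (c - c₀) sin + a F̃_c + O(a²)` in `L²_per`, with `F_c` even and orthogonal to
`cos`, `F̃_c` odd and orthogonal to `sin`, both bounded near `c₀`. -/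
structure NonDegenerate (ν c₀ : ℝ) (T : Family s) (W : ℝ → Hper s) (V : ℝ → ℝ → Hper s)
    (μ : ℝ) : Prop where
  mu_ne_zero : μ ≠ 0
  expansion_W : ∃ (F : ℝ → L2per) (M : ℝ),
    (∀ᶠ c in 𝓝 c₀, IsEvenF (F c) ∧ inner ℂ cosF (F c) = 0 ∧ ‖F c‖ ≤ M) ∧
    ∀ᶠ p : ℝ × ℝ in 𝓝 (0, c₀), p.1 ≠ 0 →
      ‖dP ν T p.1 p.2 (W p.1) -
        (-(Complex.I * μ * (p.2 - c₀)) • cosF + (p.1 : ℂ) • F p.2)‖ ≤ M * p.1 ^ 2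
  expansion_V : ∃ (F : ℝ → L2per) (M : ℝ),
    (∀ᶠ c in 𝓝 c₀, IsOddF (F c) ∧ inner ℂ sinF (F c) = 0 ∧ ‖F c‖ ≤ M) ∧
    ∀ᶠ p : ℝ × ℝ in 𝓝 (0, c₀), p.1 ≠ 0 →
      ‖dP ν T p.1 p.2 (V p.1 p.2) -
        ((Complex.I * μ * (p.2 - c₀)) • sinF + (p.1 : ℂ) • F p.2)‖ ≤ M * p.1 ^ 2

/-- `l₁ ≤ l₂` are the two lowest points of the spectrum of `P(κ)`, counted with multiplicity, and
they are eigenvalues: there are orthonormal eigenfunctions `w₁, w₂`, and on the orthogonal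
complement of `w₁, w₂` the operator is bounded below by `l₂`. -/
def AreLowestTwo (ν : ℝ) (T : Family s) (a c κ l₁ l₂ : ℝ) : Prop :=
  l₁ ≤ l₂ ∧ ∃ w₁ ∈ dom s ν κ, ∃ w₂ ∈ dom s ν κ,
    ‖toL2 w₁‖ = 1 ∧ ‖toL2 w₂‖ = 1 ∧ inner ℂ (toL2 w₁) (toL2 w₂) = 0 ∧
    P ν T a c κ w₁ = (l₁ : ℂ) • toL2 w₁ ∧ P ν T a c κ w₂ = (l₂ : ℂ) • toL2 w₂ ∧
    ∀ w ∈ dom s ν κ, inner ℂ (toL2 w₁) (toL2 w) = 0 → inner ℂ (toL2 w₂) (toL2 w) = 0 →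
      l₂ * ‖toL2 w‖ ^ 2 ≤ (inner ℂ (toL2 w) (P ν T a c κ w)).re

/-- Positivity of `K` up to the translation mode `W`: the quadratic forms of all fibres are
positive, except that the form at `κ = 0` vanishes on the multiples of `W`. -/
def IsPositive (ν : ℝ) (T : Family s) (a c : ℝ) (W : Hper s) : Prop :=
  (∀ κ ∈ BZ, ∀ w ∈ dom s ν κ, w ≠ 0 → ¬ (κ = 0 ∧ w ∈ ℂ ∙ W) →
    0 < (inner ℂ (toL2 w) (P ν T a c κ w)).re) ∧
  W ∈ dom s ν 0 ∧ P ν T a c 0 W = 0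

end Bloch

end

/-! ### Fourier coefficients and self-adjoint Fourier multipliers -/

noncomputable section

namespace Bloch
variable {s : ℝ}

/-! At a = 0, c = c₀, κ = 0 the fibre has the double eigenvalue 0 with eigenfunctions exp(±iz), and
its other modes have eigenvalues bounded below by a positive constant. Nearby, the two lowest
eigenvalues therefore live on a two-dimensional invariant subspace depending smoothly on (a, c, κ),
and they are the eigenvalues of a smooth 2 × 2 matrix B (`exists_smooth_invariant_pair`,
`exists_reduction`). Everything is read off from tr B and det B, which are smooth even where the
eigenvalues cross. The singular term ν/κ² is harmless: multiplying the zeroth Fourier mode by κ²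
turns invariance into a relation for a pencil that is smooth through κ = 0.

Reality makes the two eigenvalues the same at κ and -κ, so tr B and det B are even in κ
(`IsReduction.even`). At κ = 0 the eigenvalues are 0 and λ = λ(a, c), with eigenfunctions W and V.
Hence tr B = λ + τ κ² + O(κ⁴) and det B = δ κ² + η κ⁴ + O(κ⁵). With ε = |a| + |c - c₀|, the
unperturbed bands give τ = d + O(ε) and η → d²/4. The heart of the proof is δ = λ d/2 - μ² (c - c₀)²
+ O(ε³). In half the second derivative of det B, the terms with one undifferentiated entry give
(d/2) tr B(0) = λ d/2, because the entries of B(0) are O(ε²). What remains is det B'(0), computed in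
the basis W, V (`det_pderiv₃_entry`): the diagonal pairings with P'(0) are O(ε²) by parity, the
off-diagonal ones are ±iμ(c - c₀)/2 + O(ε²), and the product of the squared norms is 1/4 + O(ε).
This gives -μ² (c - c₀)².

The lower root is l₁ = det B / l₂, close to (δ/λ) κ², and l₂ = tr B - l₁. The error κ⁴/a² is O(|κ|³)
in the range |κ| ≤ C a² (`roots_expansion`).

For the corollary, both eigenvalues near κ = 0 are positive once tr B and det B are, and δ > 0
suffices for this since η > 0. Up to O(a²), δ > 0 means |c - c₀| < k|a| with μ² k² = λ₂(c₀) d/2.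
Away from κ = 0 the bands at (0, c₀) are positive, and compactness of the Brillouin zone and
stability of lower bounds of the forms conclude. The stability rests on the fact that a symmetric,
relatively bounded perturbation of a positive operator is form bounded with the same constant
(`abs_re_inner_le_of_relBounded`). -/

theorem coeff_eq_repr (n : ℤ) (f : L2per) :
    coeff n f = (fourierBasis (T := 2 * Real.pi)).repr f n := by
  rw [HilbertBasis.repr_apply_apply, coe_fourierBasis]; rfl

theorem ext_coeff {f g : L2per} (h : ∀ n, coeff n f = coeff n g) : f = g := by
  apply (fourierBasis (T := 2 * Real.pi)).repr.injective
  apply lp.ext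
  funext n
  rw [← coeff_eq_repr, ← coeff_eq_repr, h]

theorem memℓp_coeff (f : L2per) : Memℓp (fun n => coeff n f) 2 := by
  have h := lp.memℓp ((fourierBasis (T := 2 * Real.pi)).repr f)
  rwa [← funext fun n => coeff_eq_repr n f] at h

theorem exists_coeff_eq {u : ℤ → ℂ} (hu : Memℓp u 2) : ∃ f : L2per, ∀ n, coeff n f = u n := by
  refine ⟨(fourierBasis (T := 2 * Real.pi)).repr.symm ⟨u, hu⟩, fun n => ?_⟩
  rw [coeff_eq_repr, LinearIsometryEquiv.apply_symm_apply]

theorem norm_eq_norm_repr (f : L2per) :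
    ‖f‖ = ‖(⟨fun n => coeff n f, memℓp_coeff f⟩ : lp (fun _ : ℤ => ℂ) 2)‖ := by
  rw [← (fourierBasis (T := 2 * Real.pi)).repr.norm_map f]
  congr 1
  apply lp.ext
  funext n
  exact (coeff_eq_repr n f).symm

theorem one_le_weight (hs : 0 ≤ s) (n : ℤ) : 1 ≤ weight s n := by
  unfold weight
  apply Real.one_le_rpow <;> nlinarith [sq_nonneg (n : ℝ)]

theorem norm_toL2_le (hs : 0 ≤ s) (w : Hper s) : ‖toL2 w‖ ≤ ‖w‖ := by
  rw [norm_eq_norm_repr]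
  change _ ≤ ‖weighted s w‖
  apply lp.norm_mono (by norm_num)
  intro n
  change ‖coeff n (toL2 w)‖ ≤ ‖(weight s n : ℂ) * coeff n (toL2 w)‖
  rw [norm_mul, Complex.norm_real, Real.norm_of_nonneg (weight_pos s n).le]
  exact le_mul_of_one_le_left (norm_nonneg _) (one_le_weight hs n)

theorem toL2_injective : Function.Injective (toL2 (s := s)) := Subtype.val_injective

/-- The inclusion `H^s_per ⊆ L²_per` as a bounded operator. -/
def incl (hs : 0 ≤ s) : Hper s →L[ℂ] L2per :=
  LinearMap.mkContinuous toL2 1 fun w => by simpa using norm_toL2_le hs w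

@[simp] theorem incl_apply (hs : 0 ≤ s) (w : Hper s) : incl hs w = toL2 w := rfl

theorem weighted_surjective (hs : 0 ≤ s) : Function.Surjective (weighted s) := by
  intro u
  have hw : ∀ n, (weight s n : ℂ) ≠ 0 := fun n => by exact_mod_cast (weight_pos s n).ne'
  have h1 : Memℓp (fun n => (weight s n : ℂ)⁻¹ * u n) 2 := by
    refine (lp.memℓp u).mono' fun n => ?_
    rw [norm_mul, norm_inv, Complex.norm_real, Real.norm_of_nonneg (weight_pos s n).le]
    exact mul_le_of_le_one_left (norm_nonneg _) (inv_le_one_of_one_le₀ (one_le_weight hs n))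
  obtain ⟨f, hf⟩ := exists_coeff_eq h1
  have h2 : ∀ n, (weight s n : ℂ) * coeff n f = u n := fun n => by
    rw [hf, mul_inv_cancel_left₀ (hw n)]
  refine ⟨⟨f, ?_⟩, lp.ext (funext h2)⟩
  change Memℓp (fun n : ℤ => (weight s n : ℂ) * coeff n f) 2
  rw [funext h2]
  exact lp.memℓp u

/-- The weighted coefficients identify `Hper s` isometrically with ℓ². Completeness is needed for
bounded inverses and for the implicit function theorem. -/
theorem completeSpace_Hper (hs : 0 ≤ s) : CompleteSpace (Hper s) := by
  let e : Hper s ≃ₗᵢ[ℂ] lp (fun _ : ℤ => ℂ) 2 :=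
    { LinearEquiv.ofBijective (weighted s) ⟨weighted_injective s, weighted_surjective hs⟩ with
      norm_map' := fun _ => rfl }
  exact e.toIsometryEquiv.completeSpace_iff.mpr inferInstance

theorem selfAdjoint_symm {A : Hper s →L[ℂ] L2per} (hA : IsSelfAdjoint (toUnbounded A))
    (v w : Hper s) : inner ℂ (A v) (toL2 w) = inner ℂ (toL2 v) (A w) := by
  have h := LinearPMap.adjoint_isFormalAdjoint hA.dense_domain
  rw [LinearPMap.isSelfAdjoint_def.mp hA] at h
  exact h v w

/-- Self-adjointness, as opposed to symmetry, enters here: the adjoint has no larger domain than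
`H^s`. This replaces elliptic regularity, as nothing is assumed about the growth of symbols. -/
theorem mem_sobolev_of_adjoint {A : Hper s →L[ℂ] L2per} (hA : IsSelfAdjoint (toUnbounded A))
    {f g : L2per} (h : ∀ v : Hper s, inner ℂ g (toL2 v) = inner ℂ f (A v)) :
    f ∈ sobolev s := by
  have h1 : f ∈ (LinearPMap.adjoint (toUnbounded A)).domain :=
    LinearPMap.mem_adjoint_domain_of_exists f ⟨g, fun v => h v⟩
  rw [LinearPMap.isSelfAdjoint_def.mp hA] at h1
  exact h1

/-- Symmetry moves `A` onto the mode, which gives multiplication by the conjugate of `t`; testing on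
the mode itself shows that `t` is real. -/
theorem coeff_apply_of_diagonal {A : Hper s →L[ℂ] L2per} (hA : IsSelfAdjoint (toUnbounded A))
    {n : ℤ} {t : ℂ} (ht : A (modeH s n) = t • mode n) :
    starRingEnd ℂ t = t ∧ ∀ v, coeff n (A v) = t * coeff n (toL2 v) := by
  have key : ∀ v, coeff n (A v) = starRingEnd ℂ t * coeff n (toL2 v) := by
    intro v
    have h := selfAdjoint_symm hA (modeH s n) v
    rw [ht, inner_smul_left] at h
    exact h.symm
  have h1 := key (modeH s n)
  have h2 : coeff n (toL2 (modeH s n)) = 1 := by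
    change inner ℂ (mode n) (mode n) = (1 : ℂ)
    rw [inner_mode, if_pos rfl]
  have h3 : coeff n (t • mode n) = t := by
    change inner ℂ (mode n) (t • mode n) = t
    rw [inner_smul_right, inner_mode, if_pos rfl, mul_one]
  rw [ht, h2, h3, mul_one] at h1
  exact ⟨h1.symm, fun v => by rw [key v, ← h1]⟩

/-- A Fourier multiplier with domain `H^s_per` that is bounded away from zero and differs from a
self-adjoint one by a bounded symbol is bijective. -/
theorem bijective_of_diagonal {A B : Hper s →L[ℂ] L2per} (hA : IsSelfAdjoint (toUnbounded A))
    {t α : ℤ → ℂ} (ht : ∀ n, A (modeH s n) = t n • mode n)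
    (hB : ∀ n v, coeff n (B v) = α n * coeff n (toL2 v))
    {δ K : ℝ} (hδ : 0 < δ) (hα : ∀ n, δ ≤ ‖α n‖) (hK : ∀ n, ‖t n - α n‖ ≤ K) :
    Function.Bijective B := by
  have hα0 : ∀ n, α n ≠ 0 := fun n => norm_pos_iff.mp (hδ.trans_le (hα n))
  constructor
  · intro v w h
    apply toL2_injective
    refine ext_coeff fun n => mul_left_cancel₀ (hα0 n) ?_
    rw [← hB, ← hB, h]
  · intro f
    have h1 : Memℓp (fun n => (α n)⁻¹ * coeff n f) 2 := by
      refine ((memℓp_coeff f).const_mul ((δ⁻¹ : ℝ) : ℂ)).mono' fun n => ?_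
      rw [norm_mul, norm_mul, norm_inv, Complex.norm_real,
        Real.norm_of_nonneg (inv_pos.mpr hδ).le]
      exact mul_le_mul_of_nonneg_right (inv_anti₀ hδ (hα n)) (norm_nonneg _)
    obtain ⟨w, hw⟩ := exists_coeff_eq h1
    -- So far the candidate `w` is only in `L²`. Since `t - α` is bounded, `t n * coeff n w` is
    -- square summable as well; it defines the vector `g` that puts `w` into the domain of the
    -- adjoint of `A`, which is `H^s`.
    have h2 : Memℓp (fun n => t n * coeff n w) 2 := by
      have e : (fun n => t n * coeff n w) =
          (fun n => coeff n f) + fun n => (t n - α n) * coeff n w := by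
        funext n
        have : coeff n f = α n * coeff n w := by rw [hw, mul_inv_cancel_left₀ (hα0 n)]
        simp only [Pi.add_apply, this]
        ring
      rw [e]
      refine (memℓp_coeff f).add (((memℓp_coeff w).const_mul (K : ℂ)).mono' fun n => ?_)
      rw [norm_mul, norm_mul, Complex.norm_real]
      exact mul_le_mul_of_nonneg_right ((hK n).trans (le_abs_self K)) (norm_nonneg _)
    obtain ⟨g, hg⟩ := exists_coeff_eq h2
    have hmem : w ∈ sobolev s := by
      refine mem_sobolev_of_adjoint hA (g := g) fun v => ?_
      rw [← (fourierBasis (T := 2 * Real.pi)).tsum_inner_mul_inner,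
        ← (fourierBasis (T := 2 * Real.pi)).tsum_inner_mul_inner]
      refine tsum_congr fun n => ?_
      have e1 := coeff_apply_of_diagonal hA (ht n)
      rw [coe_fourierBasis]
      change inner ℂ g (mode n) * coeff n (toL2 v) = inner ℂ w (mode n) * coeff n (A v)
      rw [e1.2, ← inner_conj_symm g, ← inner_conj_symm w]
      change starRingEnd ℂ (coeff n g) * _ = starRingEnd ℂ (coeff n w) * _
      rw [hg, map_mul, e1.1]
      ring
    obtain ⟨w', hw'⟩ : ∃ w' : Hper s, toL2 w' = w := ⟨⟨w, hmem⟩, rfl⟩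
    refine ⟨w', ext_coeff fun n => ?_⟩
    rw [hB, hw', hw, mul_inv_cancel_left₀ (hα0 n)]

end Bloch

/-! ### Form bounds from operator bounds -/

section Generic
variable {D H : Type*} [NormedAddCommGroup D] [NormedSpace ℂ D]
  [NormedAddCommGroup H] [InnerProductSpace ℂ H]

/-- A nonnegative log-convex sequence that grows at most like `q ^ n` has `a 1 ≤ q * a 0`. -/
theorem le_mul_of_logConvex_of_growth {a : ℕ → ℝ} (ha : ∀ n, 0 ≤ a n)
    (hlog : ∀ n, a (n + 1) ^ 2 ≤ a n * a (n + 2)) {q K : ℝ} (hq : 0 ≤ q)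
    (hgrow : ∀ n, a n ≤ K * q ^ n) : a 1 ≤ q * a 0 := by
  by_contra! hlt
  have h1 : 0 < a 1 := lt_of_le_of_lt (mul_nonneg hq (ha 0)) hlt
  have h0 : 0 < a 0 := by
    rcases (ha 0).lt_or_eq with h | h
    · exact h
    · have := hlog 0
      rw [← h] at this
      nlinarith
  obtain ⟨r, hr⟩ : ∃ r, r = a 1 / a 0 := ⟨_, rfl⟩
  have hr1 : a 1 = r * a 0 := by rw [hr]; field_simp
  have hqr : q < r := by rw [hr, lt_div_iff₀ h0]; exact hlt
  have hrpos : 0 < r := lt_of_le_of_lt hq hqr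
  -- Log-convexity makes the ratios of successive terms nondecreasing, so all of them are at least
  -- `r > q` and the sequence outgrows `K * q ^ n`.
  have hstep : ∀ n, 0 < a n ∧ r * a n ≤ a (n + 1) := by
    intro n
    induction n with
    | zero => exact ⟨h0, hr1.ge⟩
    | succ n ih =>
      have hpos : 0 < a (n + 1) := lt_of_lt_of_le (mul_pos hrpos ih.1) ih.2
      refine ⟨hpos, ?_⟩
      have h2 := hlog n
      have h3 : a n * (r * a (n + 1)) ≤ a n * a (n + 2) := by nlinarith
      exact le_of_mul_le_mul_left h3 ih.1
  have hgeom : ∀ n, a 0 * r ^ n ≤ a n := by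
    intro n
    induction n with
    | zero => simp
    | succ n ih =>
      calc a 0 * r ^ (n + 1) = r * (a 0 * r ^ n) := by ring
        _ ≤ r * a n := mul_le_mul_of_nonneg_left ih hrpos.le
        _ ≤ a (n + 1) := (hstep n).2
  have hq0 : 0 < q := by
    rcases hq.lt_or_eq with h | h
    · exact h
    · have := hgrow 1
      rw [← h] at this
      simp at this
      linarith
  obtain ⟨n, hn⟩ := pow_unbounded_of_one_lt (K / a 0) ((one_lt_div hq0).mpr hqr)
  have h4 := (hgeom n).trans (hgrow n)
  rw [div_pow, div_lt_div_iff₀ h0 (pow_pos hq0 n)] at hn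
  linarith

/-- An operator that is symmetric and bounded relative to a positive symmetric operator `A` is
bounded relative to `A` in the sense of quadratic forms, with the same bound. -/
theorem abs_re_inner_le_of_relBounded (ι B : D →L[ℂ] H) (A : D ≃L[ℂ] H)
    (hA : ∀ v w, inner ℂ (A v) (ι w) = inner ℂ (ι v) (A w))
    (hB : ∀ v w, inner ℂ (B v) (ι w) = inner ℂ (ι v) (B w))
    (hpos : ∀ v, 0 ≤ (inner ℂ (ι v) (A v)).re) {ε : ℝ} (hε : 0 ≤ ε)
    (hBA : ∀ v, ‖B v‖ ≤ ε * ‖A v‖) (v : D) :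
    |(inner ℂ (ι v) (B v)).re| ≤ ε * (inner ℂ (ι v) (A v)).re := by
  set q : D → ℝ := fun v => (inner ℂ (ι v) (A v)).re with hq
  have hre : ∀ u v, (inner ℂ (ι u) (A v)).re = (inner ℂ (ι v) (A u)).re := by
    intro u v
    rw [← hA, ← inner_conj_symm, Complex.conj_re]
  have cs : ∀ u v, (inner ℂ (ι u) (A v)).re ^ 2 ≤ q u * q v := by
    intro u v
    have h : ∀ t : ℝ, 0 ≤ q v * (t * t) + (2 * (inner ℂ (ι u) (A v)).re) * t + q u := by
      intro t
      have h1 := hpos (u + (t : ℂ) • v)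
      simp only [map_add, map_smul, inner_add_left, inner_add_right, inner_smul_left,
        inner_smul_right, Complex.add_re, Complex.conj_ofReal, Complex.re_ofReal_mul] at h1
      rw [hre v u] at h1
      simp only [hq]
      linarith
    have h2 := discrim_le_zero h
    unfold discrim at h2
    nlinarith
  -- `G = A⁻¹B` is symmetric for the form of `A`, so Cauchy–Schwarz for this form makes `q (Gⁿ v)`
  -- log-convex in n. The operator bound enters only through the growth rate `ε ^ 2`; the constant
  -- in front, which involves the norms of `ι` and `A⁻¹`, plays no role.
  set G : D → D := fun v => A.symm (B v) with hG
  have hAG : ∀ v, A (G v) = B v := fun v => A.apply_symm_apply _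
  have sym : ∀ u v, (inner ℂ (ι (G u)) (A v)).re = (inner ℂ (ι u) (A (G v))).re := by
    intro u v
    rw [← hA, hAG, hAG, hB]
  have key := le_mul_of_logConvex_of_growth (a := fun n => q (G^[n] v)) (q := ε ^ 2)
    (K := ‖ι‖ * ‖(A.symm : H →L[ℂ] D)‖ * ‖A v‖ ^ 2) (fun n => hpos _) ?_ (sq_nonneg _) ?_
  · simp only [Function.iterate_one, Function.iterate_zero, id] at key
    -- Since `B v = A (G v)`, Cauchy–Schwarz and `q (G v) ≤ ε² q v` bound the square of the form of
    -- `B` by `(ε q v)²`.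
    have h3 := cs v (G v)
    rw [hAG] at h3
    apply abs_le_of_sq_le_sq
    · nlinarith [hpos v, mul_le_mul_of_nonneg_left key (hpos v)]
    · exact mul_nonneg hε (hpos v)
  · intro n
    have h4 := cs (G^[n] v) (G^[n + 2] v)
    rw [Function.iterate_succ_apply' G (n + 1), ← sym, ← Function.iterate_succ_apply' G n] at h4
    simpa only [Function.iterate_succ_apply' G (n + 1)] using h4
  · have hn : ∀ n, ‖A (G^[n] v)‖ ≤ ε ^ n * ‖A v‖ := by
      intro n
      induction n with
      | zero => simp
      | succ n ih =>
        rw [Function.iterate_succ_apply', hAG]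
        calc _ ≤ ε * ‖A (G^[n] v)‖ := hBA _
          _ ≤ ε * (ε ^ n * ‖A v‖) := mul_le_mul_of_nonneg_left ih hε
          _ = _ := by ring
    intro n
    set u := G^[n] v
    have h5 : ‖u‖ ≤ ‖(A.symm : H →L[ℂ] D)‖ * ‖A u‖ := by
      simpa using (A.symm : H →L[ℂ] D).le_opNorm (A u)
    calc q u ≤ ‖inner ℂ (ι u) (A u)‖ := Complex.re_le_norm _
      _ ≤ ‖ι u‖ * ‖A u‖ := norm_inner_le_norm _ _
      _ ≤ (‖ι‖ * (‖(A.symm : H →L[ℂ] D)‖ * ‖A u‖)) * ‖A u‖ := by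
          gcongr
          exact (ι.le_opNorm u).trans (by gcongr)
      _ = ‖ι‖ * ‖(A.symm : H →L[ℂ] D)‖ * ‖A u‖ ^ 2 := by ring
      _ ≤ ‖ι‖ * ‖(A.symm : H →L[ℂ] D)‖ * (ε ^ n * ‖A v‖) ^ 2 := by gcongr; exact hn n
      _ = _ := by ring

end Generic

/-! ### Two-dimensional invariant subspaces and the two lowest eigenvalues -/

section TwoDim
variable {D H : Type*} [AddCommGroup D] [Module ℂ D]
  [NormedAddCommGroup H] [InnerProductSpace ℂ H]

/-- A symmetric operator with a two-dimensional invariant subspace has two orthonormal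
eigenvectors there; the trace and the determinant of its matrix give the eigenvalues. -/
theorem exists_eigenpair_of_invariant (ι P : D →ₗ[ℂ] H) {y₁ y₂ : D} {b₁₁ b₁₂ b₂₁ b₂₂ : ℂ}
    (hli : LinearIndependent ℂ ![ι y₁, ι y₂])
    (h₁ : P y₁ = b₁₁ • ι y₁ + b₂₁ • ι y₂) (h₂ : P y₂ = b₁₂ • ι y₁ + b₂₂ • ι y₂)
    (hsym : ∀ v ∈ Submodule.span ℂ {y₁, y₂}, ∀ w ∈ Submodule.span ℂ {y₁, y₂},
      inner ℂ (P v) (ι w) = inner ℂ (ι v) (P w)) :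
    ∃ l₁ l₂ : ℝ, l₁ ≤ l₂ ∧ (l₁ + l₂ : ℂ) = b₁₁ + b₂₂ ∧
      (l₁ * l₂ : ℂ) = b₁₁ * b₂₂ - b₁₂ * b₂₁ ∧
      ∃ w₁ ∈ Submodule.span ℂ {y₁, y₂}, ∃ w₂ ∈ Submodule.span ℂ {y₁, y₂},
        ‖ι w₁‖ = 1 ∧ ‖ι w₂‖ = 1 ∧ inner ℂ (ι w₁) (ι w₂) = 0 ∧
        P w₁ = (l₁ : ℂ) • ι w₁ ∧ P w₂ = (l₂ : ℂ) • ι w₂ ∧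
        ∀ v : H, inner ℂ (ι w₁) v = 0 → inner ℂ (ι w₂) v = 0 →
          inner ℂ (ι y₁) v = 0 ∧ inner ℂ (ι y₂) v = 0 := by
  obtain ⟨G, bas, hbas⟩ : ∃ (G : Submodule ℂ H) (bas : Module.Basis (Fin 2) ℂ G),
      ∀ i, (bas i : H) = ![ι y₁, ι y₂] i :=
    ⟨_, Module.Basis.span hli, fun i => congrArg Subtype.val (Module.Basis.span_apply hli i)⟩
  have hb0 : (bas 0 : H) = ι y₁ := hbas 0
  have hb1 : (bas 1 : H) = ι y₂ := hbas 1
  set f : G →ₗ[ℂ] G := Matrix.toLin bas bas !![b₁₁, b₁₂; b₂₁, b₂₂] with hf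
  -- `ι` is not assumed injective; `J` is a section of it over the span, so that `P ∘ J` is the
  -- endomorphism `f` of a genuine inner product space.
  set J : G →ₗ[ℂ] D := bas.constr ℂ ![y₁, y₂] with hJ
  have hJ0 : J (bas 0) = y₁ := by simp [hJ]
  have hJ1 : J (bas 1) = y₂ := by simp [hJ]
  have hιJ : ∀ g : G, ι (J g) = g := by
    have : ι ∘ₗ J = G.subtype := by
      apply bas.ext
      intro i
      fin_cases i
      · simp [hJ0, hb0]
      · simp [hJ1, hb1]
    exact fun g => LinearMap.congr_fun this g
  have hPJ : ∀ g : G, P (J g) = f g := by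
    have : P ∘ₗ J = G.subtype ∘ₗ f := by
      apply bas.ext
      intro i
      fin_cases i
      · simp [hJ0, hf, Matrix.toLin_self, Fin.sum_univ_two, h₁, hb0, hb1]
      · simp [hJ1, hf, Matrix.toLin_self, Fin.sum_univ_two, h₂, hb0, hb1]
    exact fun g => LinearMap.congr_fun this g
  have hJmem : ∀ g : G, J g ∈ Submodule.span ℂ {y₁, y₂} := by
    intro g
    have : J g = J (∑ i, bas.repr g i • bas i) := by rw [bas.sum_repr]
    rw [this, Fin.sum_univ_two, map_add, map_smul, map_smul, hJ0, hJ1]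
    exact Submodule.add_mem _ (Submodule.smul_mem _ _ (Submodule.subset_span (by simp)))
      (Submodule.smul_mem _ _ (Submodule.subset_span (by simp)))
  have hfs : f.IsSymmetric := by
    intro u v
    have h := hsym (J u) (hJmem u) (J v) (hJmem v)
    rw [hPJ, hPJ, hιJ, hιJ] at h
    exact h
  have hdim : Module.finrank ℂ G = 2 := by
    rw [Module.finrank_eq_card_basis bas, Fintype.card_fin]
  have : FiniteDimensional ℂ G := bas.finiteDimensional_of_finite
  set e := hfs.eigenvectorBasis hdim with he
  set l := hfs.eigenvalues hdim with hl
  -- The eigenvalues are listed in decreasing order, so index 1 is the lower one.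
  have hanti : l 1 ≤ l 0 := hfs.eigenvalues_antitone hdim (by decide : (0 : Fin 2) ≤ 1)
  have htrf : LinearMap.trace ℂ G f = b₁₁ + b₂₂ := by
    rw [LinearMap.trace_eq_matrix_trace ℂ bas, hf, LinearMap.toMatrix_toLin,
      Matrix.trace_fin_two_of]
  have hdetf : LinearMap.det f = b₁₁ * b₂₂ - b₁₂ * b₂₁ := by
    rw [hf, LinearMap.det_toLin, Matrix.det_fin_two_of]
  have htr : (b₁₁ + b₂₂ : ℂ) = ((l 0 + l 1 : ℝ) : ℂ) := by
    rw [← htrf, hfs.trace_eq_sum_eigenvalues hdim, Fin.sum_univ_two]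
    rfl
  have hdet : (b₁₁ * b₂₂ - b₁₂ * b₂₁ : ℂ) = (l 0 : ℂ) * (l 1 : ℂ) := by
    rw [← hdetf, hfs.det_eq_prod_eigenvalues hdim, Fin.prod_univ_two]
    rfl
  have hev : ∀ i, P (J (e i)) = (l i : ℂ) • ι (J (e i)) := by
    intro i
    rw [hPJ, hιJ, he, hfs.apply_eigenvectorBasis hdim i]
    rfl
  have hort := e.orthonormal
  refine ⟨l 1, l 0, hanti, ?_, ?_, J (e 1), hJmem _, J (e 0), hJmem _, ?_, ?_, ?_, hev 1, hev 0, ?_⟩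
  · rw [htr, add_comm]; push_cast; rfl
  · rw [hdet, mul_comm]
  · rw [hιJ]; exact hort.1 1
  · rw [hιJ]; exact hort.1 0
  · rw [hιJ, hιJ]; exact hort.2 (by decide)
  · intro v hv1 hv0
    rw [hιJ] at hv1 hv0
    have hall : ∀ g : G, inner ℂ (g : H) v = 0 := by
      intro g
      have : (g : H) = ((∑ i, e.repr g i • e i : G) : H) := by rw [e.sum_repr]
      rw [this, Fin.sum_univ_two]
      simp [hv1, hv0]
    exact ⟨hb0 ▸ hall (bas 0), hb1 ▸ hall (bas 1)⟩

/-- If `w₁, w₂` are orthonormal eigenvectors with eigenvalues `l₁, l₂` and the form is bounded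
below by `l₂` on their complement, then it is bounded below by `l₂` up to the part along `w₁`. -/
theorem rayleigh_lower_bound (ι P : D →ₗ[ℂ] H) (S : Submodule ℂ D)
    (hsym : ∀ v ∈ S, ∀ w ∈ S, inner ℂ (P v) (ι w) = inner ℂ (ι v) (P w))
    {l₁ l₂ : ℝ} {w₁ w₂ : D} (hw₁ : w₁ ∈ S) (hw₂ : w₂ ∈ S)
    (hn₁ : ‖ι w₁‖ = 1) (hn₂ : ‖ι w₂‖ = 1) (ho : inner ℂ (ι w₁) (ι w₂) = 0)
    (he₁ : P w₁ = (l₁ : ℂ) • ι w₁) (he₂ : P w₂ = (l₂ : ℂ) • ι w₂)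
    (hlow : ∀ w ∈ S, inner ℂ (ι w₁) (ι w) = 0 → inner ℂ (ι w₂) (ι w) = 0 →
      l₂ * ‖ι w‖ ^ 2 ≤ (inner ℂ (ι w) (P w)).re) {w : D} (hw : w ∈ S) :
    l₂ * ‖ι w‖ ^ 2 ≤
      (inner ℂ (ι w) (P w)).re + (l₂ - l₁) * ‖inner ℂ (ι w₁) (ι w)‖ ^ 2 := by
  set α := inner ℂ (ι w₁) (ι w) with hα
  set β := inner ℂ (ι w₂) (ι w) with hβ
  set r := w - α • w₁ - β • w₂ with hr
  have hrS : r ∈ S := S.sub_mem (S.sub_mem hw (S.smul_mem _ hw₁)) (S.smul_mem _ hw₂)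
  have ho' : inner ℂ (ι w₂) (ι w₁) = 0 := by rw [← inner_conj_symm, ho, map_zero]
  have h11 : inner ℂ (ι w₁) (ι w₁) = (1 : ℂ) := by
    rw [inner_self_eq_norm_sq_to_K, hn₁]; simp
  have h22 : inner ℂ (ι w₂) (ι w₂) = (1 : ℂ) := by
    rw [inner_self_eq_norm_sq_to_K, hn₂]; simp
  have r1 : inner ℂ (ι w₁) (ι r) = 0 := by
    rw [hr, map_sub, map_sub, map_smul, map_smul, inner_sub_right, inner_sub_right,
      inner_smul_right, inner_smul_right, h11, ho, ← hα]
    ring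
  have r2 : inner ℂ (ι w₂) (ι r) = 0 := by
    rw [hr, map_sub, map_sub, map_smul, map_smul, inner_sub_right, inner_sub_right,
      inner_smul_right, inner_smul_right, h22, ho', ← hβ]
    ring
  have r1' : inner ℂ (ι r) (ι w₁) = 0 := by rw [← inner_conj_symm, r1, map_zero]
  have r2' : inner ℂ (ι r) (ι w₂) = 0 := by rw [← inner_conj_symm, r2, map_zero]
  have p1 : inner ℂ (ι w₁) (P r) = 0 := by
    rw [← hsym w₁ hw₁ r hrS, he₁, inner_smul_left, r1, mul_zero]
  have p2 : inner ℂ (ι w₂) (P r) = 0 := by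
    rw [← hsym w₂ hw₂ r hrS, he₂, inner_smul_left, r2, mul_zero]
  have hwr : w = α • w₁ + β • w₂ + r := by rw [hr]; abel
  have hlr := hlow r hrS r1 r2
  have e1 : inner ℂ (ι w) (ι w) =
      starRingEnd ℂ α * α + starRingEnd ℂ β * β + inner ℂ (ι r) (ι r) := by
    rw [hwr]
    simp only [map_add, map_smul, inner_add_left, inner_add_right, inner_smul_left,
      inner_smul_right, h11, h22, ho, ho', r1, r2, r1', r2']
    ring
  have e2 : inner ℂ (ι w) (P w) =
      l₁ * (starRingEnd ℂ α * α) + l₂ * (starRingEnd ℂ β * β) + inner ℂ (ι r) (P r) := by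
    rw [hwr]
    simp only [map_add, map_smul, inner_add_left, inner_add_right, inner_smul_left,
      inner_smul_right, h11, h22, ho, ho', r1', r2', he₁, he₂, p1, p2]
    ring
  have sq : ∀ z : ℂ, starRingEnd ℂ z * z = ((‖z‖ ^ 2 : ℝ) : ℂ) := fun z => by
    rw [Complex.conj_mul']; push_cast; rfl
  rw [sq, sq, inner_self_eq_norm_sq_to_K, inner_self_eq_norm_sq_to_K] at e1
  have e1' : ‖ι w‖ ^ 2 = ‖α‖ ^ 2 + ‖β‖ ^ 2 + ‖ι r‖ ^ 2 := by
    apply Complex.ofReal_injective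
    push_cast at e1 ⊢
    exact e1
  rw [sq, sq] at e2
  have e2' : (inner ℂ (ι w) (P w)).re =
      l₁ * ‖α‖ ^ 2 + l₂ * ‖β‖ ^ 2 + (inner ℂ (ι r) (P r)).re := by
    rw [e2, Complex.add_re, Complex.add_re, Complex.re_ofReal_mul, Complex.re_ofReal_mul,
      Complex.ofReal_re, Complex.ofReal_re]
  rw [e1', e2']
  nlinarith

end TwoDim

/-! ### Smooth continuation of an invariant pair -/

section Implicit
variable {D H E : Type*} [NormedAddCommGroup D] [NormedSpace ℂ D]
  [NormedAddCommGroup H] [InnerProductSpace ℂ H] [NormedAddCommGroup E] [NormedSpace ℝ E]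

theorem ContDiffAt.complex_clm_apply {F : Type*} [NormedAddCommGroup F] [NormedSpace ℂ F]
    {n : WithTop ℕ∞} {T : E → D →L[ℂ] F} {x : E → D} {p : E}
    (hT : ContDiffAt ℝ n T p) (hx : ContDiffAt ℝ n x p) :
    ContDiffAt ℝ n (fun q => T q (x q)) p := by
  have h : ContDiffAt ℝ n (fun q => (T q).restrictScalars ℝ) p :=
    (ContinuousLinearMap.restrictScalarsIsometry ℂ D F ℝ
      ℝ).toContinuousLinearMap.contDiff.contDiffAt.comp p hT
  exact h.clm_apply hx

/-- The orthogonal projection onto the span of two orthonormal vectors. -/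
def pairProj (u₁ u₂ : H) : H →L[ℂ] H :=
  (innerSL ℂ u₁).smulRight u₁ + (innerSL ℂ u₂).smulRight u₂

theorem pairProj_apply (u₁ u₂ f : H) :
    pairProj u₁ u₂ f = inner ℂ u₁ f • u₁ + inner ℂ u₂ f • u₂ := by
  simp [pairProj]

/-- The range and the kernel of the orthogonal projection meet only in zero, so one equation in `H`
encodes a normalization of `g` and the vanishing of the complementary part of `f`. -/
theorem eq_zero_of_sub_pairProj_add {u₁ u₂ f g : H} (h₁ : inner ℂ u₁ u₁ = (1 : ℂ))
    (h₂ : inner ℂ u₂ u₂ = (1 : ℂ)) (h₁₂ : inner ℂ u₁ u₂ = (0 : ℂ))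
    (h : f - pairProj u₁ u₂ f + pairProj u₁ u₂ g = 0) :
    inner ℂ u₁ g = 0 ∧ inner ℂ u₂ g = 0 ∧ f = pairProj u₁ u₂ f := by
  have h₂₁ : inner ℂ u₂ u₁ = (0 : ℂ) := by rw [← inner_conj_symm, h₁₂, map_zero]
  have e₁ := congrArg (fun x => inner ℂ u₁ x) h
  have e₂ := congrArg (fun x => inner ℂ u₂ x) h
  simp only [pairProj_apply, inner_add_right, inner_sub_right, inner_smul_right, h₁, h₂, h₁₂, h₂₁,
    inner_zero_right] at e₁ e₂
  have e₁' : inner ℂ u₁ g = 0 := by linear_combination e₁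
  have e₂' : inner ℂ u₂ g = 0 := by linear_combination e₂
  refine ⟨e₁', e₂', ?_⟩
  have h0 : pairProj u₁ u₂ g = 0 := by rw [pairProj_apply, e₁', e₂']; simp
  rw [h0, add_zero, sub_eq_zero] at h
  exact h

variable [CompleteSpace D] [CompleteSpace H] [CompleteSpace E]

/-- Two vectors that span the kernel of `R p₀` continue to a smooth family of two-dimensional
invariant subspaces of the pencil `R p`, `S p`. -/
theorem exists_smooth_invariant_pair (ι : D →L[ℂ] H) {R T : E → D →L[ℂ] H} {S : E → H →L[ℂ] H}
    {p₀ : E} (hR : ContDiffAt ℝ ∞ R p₀) (hT : ContDiffAt ℝ ∞ T p₀) (hS : ContDiffAt ℝ ∞ S p₀)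
    {e₁ e₂ : D} (h₁ : inner ℂ (ι e₁) (ι e₁) = (1 : ℂ)) (h₂ : inner ℂ (ι e₂) (ι e₂) = (1 : ℂ))
    (h₁₂ : inner ℂ (ι e₁) (ι e₂) = (0 : ℂ))
    (hT₁ : T p₀ e₁ = 0) (hT₂ : T p₀ e₂ = 0) (hR₁ : R p₀ e₁ = 0) (hR₂ : R p₀ e₂ = 0)
    (hS₁ : S p₀ (ι e₁) = ι e₁) (hS₂ : S p₀ (ι e₂) = ι e₂)
    (hbij : Function.Bijective
      (R p₀ - (pairProj (ι e₁) (ι e₂)).comp (R p₀) + (pairProj (ι e₁) (ι e₂)).comp ι))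
    (hRT : ∀ᶠ p in 𝓝 p₀, ∀ v, inner ℂ (ι e₁) (R p v) = inner ℂ (ι e₁) (T p v) ∧
      inner ℂ (ι e₂) (R p v) = inner ℂ (ι e₂) (T p v))
    (hSQ : ∀ᶠ p in 𝓝 p₀, ∀ f, inner ℂ (ι e₁) (S p f) = inner ℂ (ι e₁) f ∧
      inner ℂ (ι e₂) (S p f) = inner ℂ (ι e₂) f) :
    ∃ y₁ y₂ : E → D, ContDiffAt ℝ ∞ y₁ p₀ ∧ ContDiffAt ℝ ∞ y₂ p₀ ∧ y₁ p₀ = e₁ ∧ y₂ p₀ = e₂ ∧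
      ∀ᶠ p in 𝓝 p₀,
        (inner ℂ (ι e₁) (ι (y₁ p)) = (1 : ℂ) ∧ inner ℂ (ι e₂) (ι (y₁ p)) = (0 : ℂ)) ∧
        (inner ℂ (ι e₁) (ι (y₂ p)) = (0 : ℂ) ∧ inner ℂ (ι e₂) (ι (y₂ p)) = (1 : ℂ)) ∧
        R p (y₁ p) = inner ℂ (ι e₁) (T p (y₁ p)) • S p (ι (y₁ p)) +
          inner ℂ (ι e₂) (T p (y₁ p)) • S p (ι (y₂ p)) ∧
        R p (y₂ p) = inner ℂ (ι e₁) (T p (y₂ p)) • S p (ι (y₁ p)) +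
          inner ℂ (ι e₂) (T p (y₂ p)) • S p (ι (y₂ p)) := by
  have h₂₁ : inner ℂ (ι e₂) (ι e₁) = (0 : ℂ) := by rw [← inner_conj_symm, h₁₂, map_zero]
  set Q := pairProj (ι e₁) (ι e₂) with hQ
  set L₀ : D →L[ℂ] H := R p₀ - Q.comp (R p₀) + Q.comp ι with hL₀
  have hQ₁ : Q (ι e₁) = ι e₁ := by rw [hQ, pairProj_apply, h₁, h₂₁]; simp
  have hQ₂ : Q (ι e₂) = ι e₂ := by rw [hQ, pairProj_apply, h₁₂, h₂]; simp
  -- The defect of invariance. The matrix entries are not additional unknowns: they are the pairings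
  -- of `T p w` with `e₁` and `e₂`.
  let z : E → D → D → D → H := fun p w v₁ v₂ => R p w -
    (inner ℂ (ι e₁) (T p w) • S p (ι v₁) + inner ℂ (ι e₂) (T p w) • S p (ι v₂))
  -- The part of this equation off the span of `e₁, e₂` asks for invariance, the part on the span
  -- asks that the correction be orthogonal to `e₁, e₂`. With both, the number of equations matches
  -- the number of unknowns.
  let g₁ : E × (D × D) → H := fun u => z u.1 (e₁ + u.2.1) (e₁ + u.2.1) (e₂ + u.2.2) -
    Q (z u.1 (e₁ + u.2.1) (e₁ + u.2.1) (e₂ + u.2.2)) + Q (ι u.2.1)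
  let g₂ : E × (D × D) → H := fun u => z u.1 (e₂ + u.2.2) (e₁ + u.2.1) (e₂ + u.2.2) -
    Q (z u.1 (e₂ + u.2.2) (e₁ + u.2.1) (e₂ + u.2.2)) + Q (ι u.2.2)
  have hRu : ContDiffAt ℝ ∞ (fun u : E × (D × D) => R u.1) (p₀, 0) := hR.comp _ contDiffAt_fst
  have hTu : ContDiffAt ℝ ∞ (fun u : E × (D × D) => T u.1) (p₀, 0) := hT.comp _ contDiffAt_fst
  have hSu : ContDiffAt ℝ ∞ (fun u : E × (D × D) => S u.1) (p₀, 0) := hS.comp _ contDiffAt_fst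
  have hx₁ : ContDiffAt ℝ ∞ (fun u : E × (D × D) => u.2.1) (p₀, 0) := contDiffAt_snd.fst
  have hx₂ : ContDiffAt ℝ ∞ (fun u : E × (D × D) => u.2.2) (p₀, 0) := contDiffAt_snd.snd
  have hv₁ : ContDiffAt ℝ ∞ (fun u : E × (D × D) => e₁ + u.2.1) (p₀, 0) :=
    contDiffAt_const.add hx₁
  have hv₂ : ContDiffAt ℝ ∞ (fun u : E × (D × D) => e₂ + u.2.2) (p₀, 0) :=
    contDiffAt_const.add hx₂
  have hz : ∀ w : E × (D × D) → D, ContDiffAt ℝ ∞ w (p₀, 0) →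
      ContDiffAt ℝ ∞ (fun u => z u.1 (w u) (e₁ + u.2.1) (e₂ + u.2.2)) (p₀, 0) := by
    intro w hw
    exact (hRu.complex_clm_apply hw).sub
      (((contDiffAt_const.inner ℂ (hTu.complex_clm_apply hw)).smul
        (hSu.complex_clm_apply ((contDiffAt_const (c := ι)).complex_clm_apply hv₁))).add
      ((contDiffAt_const.inner ℂ (hTu.complex_clm_apply hw)).smul
        (hSu.complex_clm_apply ((contDiffAt_const (c := ι)).complex_clm_apply hv₂))))
  have hg₁ : ContDiffAt ℝ ∞ g₁ (p₀, 0) :=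
    ((hz _ hv₁).sub ((contDiffAt_const (c := Q)).complex_clm_apply (hz _ hv₁))).add
      ((contDiffAt_const (c := Q)).complex_clm_apply
        ((contDiffAt_const (c := ι)).complex_clm_apply hx₁))
  have hg₂ : ContDiffAt ℝ ∞ g₂ (p₀, 0) :=
    ((hz _ hv₂).sub ((contDiffAt_const (c := Q)).complex_clm_apply (hz _ hv₂))).add
      ((contDiffAt_const (c := Q)).complex_clm_apply
        ((contDiffAt_const (c := ι)).complex_clm_apply hx₂))
  have hg : ContDiffAt ℝ ∞ (fun u => (g₁ u, g₂ u)) (p₀, (0 : D × D)) := hg₁.prodMk hg₂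
  let e : D ≃L[ℂ] H := ContinuousLinearEquiv.ofBijective L₀
    (LinearMap.ker_eq_bot.mpr hbij.1) (LinearMap.range_eq_top.mpr hbij.2)
  let eR : D ≃L[ℝ] H :=
    { e.toLinearEquiv.restrictScalars ℝ with
      continuous_toFun := e.continuous
      continuous_invFun := e.symm.continuous }
  have he : ∀ v, e v = L₀ v := fun v => rfl
  have quad : ∀ (c : D × D →L[ℝ] ℂ) (f : D × D →L[ℝ] H),
      HasFDerivAt (fun x : D × D => c x • f x) (0 : D × D →L[ℝ] H) 0 := by
    intro c f
    have h := (c.hasFDerivAt (x := (0 : D × D))).smul (f.hasFDerivAt (x := (0 : D × D)))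
    exact h.congr_fderiv (by ext x <;> simp)
  let φ : D → D →L[ℝ] ℂ := fun v => ((innerSL ℂ (ι v)).comp (T p₀)).restrictScalars ℝ
  let ψ : D →L[ℝ] H := ((S p₀).comp ι - Q.comp ((S p₀).comp ι)).restrictScalars ℝ
  have hψ₁ : ψ e₁ = 0 := by
    change S p₀ (ι e₁) - Q (S p₀ (ι e₁)) = 0
    rw [hS₁, hQ₁, sub_self]
  have hψ₂ : ψ e₂ = 0 := by
    change S p₀ (ι e₂) - Q (S p₀ (ι e₂)) = 0
    rw [hS₂, hQ₂, sub_self]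
  have hzQ : ∀ w v₁ v₂, z p₀ w v₁ v₂ - Q (z p₀ w v₁ v₂) =
      (R p₀ w - Q (R p₀ w)) - (φ e₁ w • ψ v₁ + φ e₂ w • ψ v₂) := by
    intro w v₁ v₂
    change (R p₀ w - (inner ℂ (ι e₁) (T p₀ w) • S p₀ (ι v₁) +
      inner ℂ (ι e₂) (T p₀ w) • S p₀ (ι v₂))) - Q _ = (R p₀ w - Q (R p₀ w)) -
      (inner ℂ (ι e₁) (T p₀ w) • (S p₀ (ι v₁) - Q (S p₀ (ι v₁))) +
      inner ℂ (ι e₂) (T p₀ w) • (S p₀ (ι v₂) - Q (S p₀ (ι v₂))))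
    rw [show Q (z p₀ w v₁ v₂) = Q (R p₀ w) - (inner ℂ (ι e₁) (T p₀ w) • Q (S p₀ (ι v₁)) +
      inner ℂ (ι e₂) (T p₀ w) • Q (S p₀ (ι v₂))) from by
        simp only [z, map_sub, map_add, map_smul]]
    simp only [smul_sub]
    abel
  have hlin : HasFDerivAt (fun x : D × D => (g₁ (p₀, x), g₂ (p₀, x)))
      ((eR.prodCongr eR : (D × D) ≃L[ℝ] H × H) : D × D →L[ℝ] H × H) 0 := by
    -- At the base point `T` kills `e₁, e₂`, and so does `ψ`. The entries times the vectors are thus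
    -- products of two linear terms in `x`, and the linearization is the invertible `L₀` in each
    -- component.
    have e1 : (fun x : D × D => (g₁ (p₀, x), g₂ (p₀, x))) = fun x =>
        (eR.prodCongr eR : (D × D) ≃L[ℝ] H × H) x -
        ((((φ e₁).comp (.fst ℝ D D)) x • (ψ.comp (.fst ℝ D D)) x +
          ((φ e₂).comp (.fst ℝ D D)) x • (ψ.comp (.snd ℝ D D)) x),
         (((φ e₁).comp (.snd ℝ D D)) x • (ψ.comp (.fst ℝ D D)) x +
          ((φ e₂).comp (.snd ℝ D D)) x • (ψ.comp (.snd ℝ D D)) x)) := by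
      have φ₁ : ∀ v, φ v e₁ = 0 := fun v => by
        change inner ℂ (ι v) (T p₀ e₁) = 0
        rw [hT₁, inner_zero_right]
      have φ₂ : ∀ v, φ v e₂ = 0 := fun v => by
        change inner ℂ (ι v) (T p₀ e₂) = 0
        rw [hT₂, inner_zero_right]
      funext x
      refine Prod.ext ?_ ?_
      · change z p₀ _ _ _ - Q (z p₀ _ _ _) + Q (ι x.1) = L₀ x.1 -
          (φ e₁ x.1 • ψ x.1 + φ e₂ x.1 • ψ x.2)
        rw [hzQ]
        simp only [map_add, hR₁, hψ₁, hψ₂, φ₁, zero_add, hL₀]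
        change _ = R p₀ x.1 - Q (R p₀ x.1) + Q (ι x.1) - _
        abel
      · change z p₀ _ _ _ - Q (z p₀ _ _ _) + Q (ι x.2) = L₀ x.2 -
          (φ e₁ x.2 • ψ x.1 + φ e₂ x.2 • ψ x.2)
        rw [hzQ]
        simp only [map_add, hR₂, hψ₁, hψ₂, φ₂, zero_add, hL₀]
        change _ = R p₀ x.2 - Q (R p₀ x.2) + Q (ι x.2) - _
        abel
    rw [e1]
    have h := ((eR.prodCongr eR : (D × D) ≃L[ℝ] H × H) : D × D →L[ℝ] H × H).hasFDerivAt
      (x := (0 : D × D)) |>.sub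
      (((quad ((φ e₁).comp (.fst ℝ D D)) (ψ.comp (.fst ℝ D D))).add
        (quad ((φ e₂).comp (.fst ℝ D D)) (ψ.comp (.snd ℝ D D)))).prodMk
       ((quad ((φ e₁).comp (.snd ℝ D D)) (ψ.comp (.fst ℝ D D))).add
        (quad ((φ e₂).comp (.snd ℝ D D)) (ψ.comp (.snd ℝ D D)))))
    exact h.congr_fderiv (by ext x <;> simp)
  have hinr : fderiv ℝ (fun u => (g₁ u, g₂ u)) (p₀, (0 : D × D)) ∘L .inr ℝ E (D × D) =
      ((eR.prodCongr eR : (D × D) ≃L[ℝ] H × H) : D × D →L[ℝ] H × H) := by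
    have h1 := (hg.differentiableAt (by simp)).hasFDerivAt
    have h2 : HasFDerivAt (fun x : D × D => (p₀, x)) (.inr ℝ E (D × D)) 0 :=
      hasFDerivAt_prodMk_right p₀ 0
    exact (HasFDerivAt.comp (0 : D × D) h1 h2).unique hlin
  have hinv : (fderiv ℝ (fun u => (g₁ u, g₂ u)) (p₀, (0 : D × D)) ∘L
      .inr ℝ E (D × D)).IsInvertible := ⟨_, hinr.symm⟩
  have hn : (∞ : WithTop ℕ∞) ≠ 0 := by simp
  set x := hg.implicitFunction hn hinv with hx
  have hx0 : x p₀ = 0 := hg.implicitFunction_apply_self hn hinv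
  have hxs : ContDiffAt ℝ ∞ x p₀ := hg.contDiffAt_implicitFunction hn hinv
  have hxe := hg.eventually_apply_implicitFunction hn hinv
  have hg0 : (g₁ (p₀, (0 : D × D)), g₂ (p₀, (0 : D × D))) = 0 := by
    have zz : ∀ w v₁ v₂, R p₀ w = 0 → T p₀ w = 0 → z p₀ w v₁ v₂ = 0 := by
      intro w v₁ v₂ hw hw'
      simp only [z, hw, hw', inner_zero_right, zero_smul, add_zero, sub_zero]
    refine Prod.ext ?_ ?_
    · change z p₀ (e₁ + 0) _ _ - Q (z p₀ (e₁ + 0) _ _) + Q (ι 0) = 0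
      rw [add_zero, zz _ _ _ hR₁ hT₁]
      simp
    · change z p₀ (e₂ + 0) _ _ - Q (z p₀ (e₂ + 0) _ _) + Q (ι 0) = 0
      rw [add_zero, zz _ _ _ hR₂ hT₂]
      simp
  refine ⟨fun p => e₁ + (x p).1, fun p => e₂ + (x p).2, contDiffAt_const.add hxs.fst,
    contDiffAt_const.add hxs.snd, by simp [hx0], by simp [hx0], ?_⟩
  filter_upwards [hxe, hRT, hSQ] with p hp hRTp hSQp
  rw [hg0] at hp
  have hp₁ := congrArg Prod.fst hp
  have hp₂ := congrArg Prod.snd hp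
  obtain ⟨a₁, a₂, a₃⟩ := eq_zero_of_sub_pairProj_add h₁ h₂ h₁₂ hp₁
  obtain ⟨c₁, c₂, c₃⟩ := eq_zero_of_sub_pairProj_add h₁ h₂ h₁₂ hp₂
  change inner ℂ (ι e₁) (ι (x p).1) = 0 at a₁
  change inner ℂ (ι e₂) (ι (x p).1) = 0 at a₂
  change inner ℂ (ι e₁) (ι (x p).2) = 0 at c₁
  change inner ℂ (ι e₂) (ι (x p).2) = 0 at c₂
  have i₁₁ : inner ℂ (ι e₁) (ι (e₁ + (x p).1)) = (1 : ℂ) := by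
    rw [map_add, inner_add_right, a₁, h₁, add_zero]
  have i₂₁ : inner ℂ (ι e₂) (ι (e₁ + (x p).1)) = (0 : ℂ) := by
    rw [map_add, inner_add_right, a₂, h₂₁, add_zero]
  have i₁₂ : inner ℂ (ι e₁) (ι (e₂ + (x p).2)) = (0 : ℂ) := by
    rw [map_add, inner_add_right, c₁, h₁₂, add_zero]
  have i₂₂ : inner ℂ (ι e₂) (ι (e₂ + (x p).2)) = (1 : ℂ) := by
    rw [map_add, inner_add_right, c₂, h₂, add_zero]
  -- The part of the defect on the span vanishes automatically: `R` and `T` have the same pairings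
  -- with `eᵢ`, and the pairing of `eᵢ` with `S yⱼ` is 1 for i = j and 0 otherwise.
  have key : ∀ w, Q (z p w (e₁ + (x p).1) (e₂ + (x p).2)) = 0 := by
    intro w
    rw [hQ, pairProj_apply]
    simp only [z, inner_sub_right, inner_add_right, inner_smul_right, (hRTp w).1, (hRTp w).2,
      (hSQp _).1, (hSQp _).2, i₁₁, i₁₂, i₂₁, i₂₂]
    simp
  refine ⟨⟨i₁₁, i₂₁⟩, ⟨i₁₂, i₂₂⟩, ?_, ?_⟩
  · exact sub_eq_zero.mp (a₃.trans (key _))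
  · exact sub_eq_zero.mp (c₃.trans (key _))

end Implicit

/-! ### Taylor expansion in the third variable, uniform in the parameters -/

section Calculus
variable {F : Type*} [NormedAddCommGroup F] [NormedSpace ℝ F]

/-- The partial derivative with respect to the third variable. -/
def pderiv₃ (f : ℝ × ℝ × ℝ → F) (p : ℝ × ℝ × ℝ) : F := fderiv ℝ f p (0, 0, 1)

theorem ContDiffAt.pderiv₃ {f : ℝ × ℝ × ℝ → F} {p : ℝ × ℝ × ℝ} (hf : ContDiffAt ℝ ∞ f p) :
    ContDiffAt ℝ ∞ (pderiv₃ f) p :=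
  (hf.fderiv_right (m := ∞) (by simp)).clm_apply contDiffAt_const

theorem ContDiffAt.iterate_pderiv₃ {f : ℝ × ℝ × ℝ → F} {p : ℝ × ℝ × ℝ}
    (hf : ContDiffAt ℝ ∞ f p) (n : ℕ) : ContDiffAt ℝ ∞ (_root_.pderiv₃^[n] f) p := by
  induction n generalizing f with
  | zero => exact hf
  | succ n ih => exact ih hf.pderiv₃

theorem ContDiffAt.eventually_differentiableAt {f : ℝ × ℝ × ℝ → F} {p : ℝ × ℝ × ℝ}
    (hf : ContDiffAt ℝ ∞ f p) : ∀ᶠ q in 𝓝 p, DifferentiableAt ℝ f q := by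
  have h : ContDiffAt ℝ 1 f p := hf.of_le (by exact_mod_cast le_top)
  exact (h.eventually (by simp)).mono fun q hq => hq.differentiableAt (by simp)

theorem DifferentiableAt.hasDerivAt_third {f : ℝ × ℝ × ℝ → F} {p : ℝ × ℝ × ℝ}
    (h : DifferentiableAt ℝ f p) :
    HasDerivAt (fun κ => f (p.1, p.2.1, κ)) (_root_.pderiv₃ f p) p.2.2 := by
  have h1 : HasDerivAt (fun κ : ℝ => (p.1, p.2.1, κ)) ((0 : ℝ), (0 : ℝ), (1 : ℝ)) p.2.2 :=
    (hasDerivAt_const _ _).prodMk ((hasDerivAt_const _ _).prodMk (hasDerivAt_id _))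
  exact h.hasFDerivAt.comp_hasDerivAt p.2.2 h1

theorem eventually_nhds_triple_iff {c₀ : ℝ} {Q : ℝ × ℝ × ℝ → Prop} :
    (∀ᶠ p in 𝓝 ((0 : ℝ), c₀, (0 : ℝ)), Q p) ↔
      ∃ r > 0, ∀ a c κ : ℝ, |a| < r → |c - c₀| < r → |κ| < r → Q (a, c, κ) := by
  rw [Metric.eventually_nhds_iff]
  constructor
  · rintro ⟨r, hr, h⟩
    refine ⟨r, hr, fun a c κ ha hc hκ => h ?_⟩
    rw [Prod.dist_eq, Prod.dist_eq, Real.dist_eq, Real.dist_eq, Real.dist_eq, sub_zero, sub_zero]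
    exact max_lt ha (max_lt hc hκ)
  · rintro ⟨r, hr, h⟩
    refine ⟨r, hr, fun {p} hp => ?_⟩
    rw [Prod.dist_eq, Prod.dist_eq, Real.dist_eq, Real.dist_eq, Real.dist_eq, sub_zero,
      sub_zero] at hp
    exact h p.1 p.2.1 p.2.2 (lt_of_le_of_lt (le_max_left _ _) hp)
      (lt_of_le_of_lt ((le_max_left _ _).trans (le_max_right _ _)) hp)
      (lt_of_le_of_lt ((le_max_right _ _).trans (le_max_right _ _)) hp)

theorem eventually_nhds_pair_iff {c₀ : ℝ} {Q : ℝ × ℝ → Prop} :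
    (∀ᶠ p in 𝓝 ((0 : ℝ), c₀), Q p) ↔
      ∃ r > 0, ∀ a c : ℝ, |a| < r → |c - c₀| < r → Q (a, c) := by
  rw [Metric.eventually_nhds_iff]
  constructor
  · rintro ⟨r, hr, h⟩
    refine ⟨r, hr, fun a c ha hc => h ?_⟩
    rw [Prod.dist_eq, Real.dist_eq, Real.dist_eq, sub_zero]
    exact max_lt ha hc
  · rintro ⟨r, hr, h⟩
    refine ⟨r, hr, fun {p} hp => ?_⟩
    rw [Prod.dist_eq, Real.dist_eq, Real.dist_eq, sub_zero] at hp
    exact h p.1 p.2 (lt_of_le_of_lt (le_max_left _ _) hp) (lt_of_le_of_lt (le_max_right _ _) hp)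

/-- The mean value inequality on `[-|x|, |x|]`. The factor `1 / (n + 1)` is given away, so one
constant serves all steps of the induction for Taylor's formula. -/
theorem norm_le_of_deriv_le_pow {h h' : ℝ → F} {r M : ℝ} {n : ℕ} (h0 : h 0 = 0)
    (hd : ∀ x, |x| < r → HasDerivAt h (h' x) x) (hb : ∀ x, |x| < r → ‖h' x‖ ≤ M * |x| ^ n)
    (hM : 0 ≤ M) {x : ℝ} (hx : |x| < r) : ‖h x‖ ≤ M * |x| ^ (n + 1) := by
  have hle : ∀ y ∈ Icc (-|x|) |x|, |y| ≤ |x| := fun y hy => abs_le.mpr hy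
  have := (convex_Icc (-|x|) |x|).norm_image_sub_le_of_norm_hasDerivWithin_le
    (f := h) (f' := h') (C := M * |x| ^ n) (x := 0) (y := x)
    (fun y hy => (hd y ((hle y hy).trans_lt hx)).hasDerivWithinAt)
    (fun y hy => (hb y ((hle y hy).trans_lt hx)).trans 
      (mul_le_mul_of_nonneg_left (pow_le_pow_left₀ (abs_nonneg y) (hle y hy) n) hM))
    ⟨by simp, by simp⟩ ⟨neg_abs_le x, le_abs_self x⟩
  rw [h0, sub_zero, sub_zero, Real.norm_eq_abs] at this
  rw [pow_succ, ← mul_assoc]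
  exact this

/-- Taylor's formula in the third variable, uniformly in the first two. -/
theorem exists_taylor_third {c₀ : ℝ} (n : ℕ) {f : ℝ × ℝ × ℝ → F}
    (hf : ContDiffAt ℝ ∞ f (0, c₀, 0)) :
    ∃ M > 0, ∃ r > 0, ∀ a c κ : ℝ, |a| < r → |c - c₀| < r → |κ| < r →
      ‖f (a, c, κ) - ∑ j ∈ Finset.range n,
        (κ ^ j / j.factorial) • pderiv₃^[j] f (a, c, 0)‖ ≤ M * |κ| ^ n := by
  induction n generalizing f with
  | zero =>
    have h : ∀ᶠ p in 𝓝 ((0 : ℝ), c₀, (0 : ℝ)), ‖f p‖ < ‖f (0, c₀, 0)‖ + 1 :=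
      hf.continuousAt.norm.eventually_lt_const (by linarith)
    obtain ⟨r, hr, h⟩ := eventually_nhds_triple_iff.mp h
    refine ⟨‖f (0, c₀, 0)‖ + 1, by positivity, r, hr, fun a c κ ha hc hκ => ?_⟩
    simpa using (h a c κ ha hc hκ).le
  | succ n ih =>
    obtain ⟨M, hM, r, hr, h⟩ := ih hf.pderiv₃
    obtain ⟨r', hr', h'⟩ := eventually_nhds_triple_iff.mp hf.eventually_differentiableAt
    refine ⟨M, hM, min r r', lt_min hr hr', fun a c κ ha hc hκ => ?_⟩
    -- The derivative of the remainder of order `n + 1` of `f` is the remainder of order `n` of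
    -- `pderiv₃ f`.
    refine norm_le_of_deriv_le_pow (h := fun κ => f (a, c, κ) - ∑ j ∈ Finset.range (n + 1),
        (κ ^ j / j.factorial) • pderiv₃^[j] f (a, c, 0))
      (h' := fun κ => pderiv₃ f (a, c, κ) - ∑ j ∈ Finset.range n,
        (κ ^ j / j.factorial) • pderiv₃^[j] (pderiv₃ f) (a, c, 0)) (r := min r r')
      ?_ (fun x hx => ?_) (fun x hx => ?_) hM.le hκ
    · rw [Finset.sum_range_succ']
      simp
    · have h1 := (h' a c x (ha.trans_le (min_le_right _ _)) (hc.trans_le (min_le_right _ _))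
        (hx.trans_le (min_le_right _ _))).hasDerivAt_third
      refine h1.sub ?_
      simp only [Finset.sum_range_succ' _ n]
      have h2 : HasDerivAt (fun κ : ℝ => ∑ j ∈ Finset.range n,
          (κ ^ (j + 1) / (j + 1).factorial) • pderiv₃^[j + 1] f (a, c, 0))
          (∑ j ∈ Finset.range n, (x ^ j / j.factorial) • pderiv₃^[j] (pderiv₃ f) (a, c, 0)) x := by
        refine HasDerivAt.fun_sum fun j _ => ?_
        rw [Function.iterate_succ_apply]
        refine HasDerivAt.smul_const ?_ _
        have h3 := ((hasDerivAt_pow (j + 1) x).div_const ((j + 1).factorial : ℝ))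
        refine h3.congr_deriv ?_
        rw [Nat.factorial_succ]
        push_cast
        have : (j.factorial : ℝ) ≠ 0 := by positivity
        field_simp
      simpa using h2.add_const (f (a, c, 0))
    · exact h a c x (ha.trans_le (min_le_left _ _)) (hc.trans_le (min_le_left _ _))
        (hx.trans_le (min_le_left _ _))

theorem exists_lipschitz_first_two {c₀ : ℝ} {f : ℝ × ℝ × ℝ → F}
    (hf : ContDiffAt ℝ ∞ f (0, c₀, 0)) :
    ∃ M > 0, ∃ r > 0, ∀ a c : ℝ, |a| < r → |c - c₀| < r →
      ‖f (a, c, 0) - f (0, c₀, 0)‖ ≤ M * (|a| + |c - c₀|) := by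
  have h : ContDiffAt ℝ 1 f (0, c₀, 0) := hf.of_le (by exact_mod_cast le_top)
  obtain ⟨K, t, ht, hK⟩ := h.exists_lipschitzOnWith
  obtain ⟨r, hr, h⟩ := eventually_nhds_triple_iff.mp (eventually_mem_set.mpr ht)
  refine ⟨K + 1, by positivity, r, hr, fun a c ha hc => ?_⟩
  have h1 := hK.dist_le_mul (a, c, 0) (h a c 0 ha hc (by simpa using hr)) (0, c₀, 0)
    (mem_of_mem_nhds ht)
  rw [dist_eq_norm, Prod.dist_eq, Prod.dist_eq, Real.dist_eq, Real.dist_eq, Real.dist_eq] at h1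
  refine h1.trans ?_
  have h2 : max |a - 0| (max |c - c₀| |(0 : ℝ) - 0|) ≤ |a| + |c - c₀| := by
    simp only [sub_zero, abs_zero]
    exact max_le (by linarith [abs_nonneg (c - c₀)])
      (max_le (by linarith [abs_nonneg a]) (by positivity))
  nlinarith [K.coe_nonneg, abs_nonneg a, abs_nonneg (c - c₀)]

/-- If `f` is multiplied by `ε` under reflection of the third variable, then its derivative is
multiplied by `-ε`. -/
theorem pderiv₃_reflect {c₀ ε : ℝ} {f : ℝ × ℝ × ℝ → F} (hf : ContDiffAt ℝ ∞ f (0, c₀, 0))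
    (h : ∀ᶠ p : ℝ × ℝ × ℝ in 𝓝 (0, c₀, 0), f (p.1, p.2.1, -p.2.2) = ε • f p) :
    ∀ᶠ p : ℝ × ℝ × ℝ in 𝓝 (0, c₀, 0),
      pderiv₃ f (p.1, p.2.1, -p.2.2) = (-ε) • pderiv₃ f p := by
  let ρ : ℝ × ℝ × ℝ →L[ℝ] ℝ × ℝ × ℝ :=
    (ContinuousLinearMap.id ℝ ℝ).prodMap ((ContinuousLinearMap.id ℝ ℝ).prodMap
      (-ContinuousLinearMap.id ℝ ℝ))
  have hρ : ∀ p, ρ p = (p.1, p.2.1, -p.2.2) := fun p => rfl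
  have ht : Tendsto ρ (𝓝 (0, c₀, 0)) (𝓝 (0, c₀, 0)) := by
    have := ρ.continuous.tendsto ((0 : ℝ), c₀, (0 : ℝ))
    rwa [hρ, neg_zero] at this
  filter_upwards [h.eventually_nhds, hf.eventually_differentiableAt,
    ht.eventually hf.eventually_differentiableAt] with p hp hd hd'
  have e1 : fderiv ℝ (f ∘ ρ) p = fderiv ℝ (fun q => ε • f q) p := Filter.EventuallyEq.fderiv_eq hp
  rw [fderiv_comp p hd' ρ.differentiableAt, ρ.fderiv, fderiv_fun_const_smul hd] at e1
  have e2 := congrArg (fun L : ℝ × ℝ × ℝ →L[ℝ] F => L (0, 0, 1)) e1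
  simp only [ContinuousLinearMap.comp_apply, _root_.smul_apply, hρ] at e2
  have e3 : ((0 : ℝ), (0 : ℝ), (-1 : ℝ)) = -(0, 0, 1) := by simp
  rw [e3, map_neg] at e2
  change fderiv ℝ f (p.1, p.2.1, -p.2.2) (0, 0, 1) = (-ε) • fderiv ℝ f p (0, 0, 1)
  rw [neg_smul, ← e2, neg_neg]

/-- Each derivative in κ switches the parity, and an odd function vanishes at κ = 0. -/
theorem odd_pderiv₃_eq_zero_of_even {c₀ : ℝ} {f : ℝ × ℝ × ℝ → F}
    (hf : ContDiffAt ℝ ∞ f (0, c₀, 0))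
    (h : ∀ᶠ p : ℝ × ℝ × ℝ in 𝓝 (0, c₀, 0), f (p.1, p.2.1, -p.2.2) = f p) :
    ∀ᶠ p : ℝ × ℝ × ℝ in 𝓝 (0, c₀, 0), pderiv₃^[1] f (p.1, p.2.1, 0) = 0 ∧
      pderiv₃^[3] f (p.1, p.2.1, 0) = 0 := by
  have h0 : ∀ᶠ p : ℝ × ℝ × ℝ in 𝓝 (0, c₀, 0), f (p.1, p.2.1, -p.2.2) = (1 : ℝ) • f p := by
    simpa using h
  have h1 := pderiv₃_reflect hf h0
  have h2 := pderiv₃_reflect hf.pderiv₃ h1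
  have h3 := pderiv₃_reflect hf.pderiv₃.pderiv₃ h2
  have key : ∀ g : ℝ × ℝ × ℝ → F, (∀ᶠ p : ℝ × ℝ × ℝ in 𝓝 (0, c₀, 0),
      g (p.1, p.2.1, -p.2.2) = (-1 : ℝ) • g p) →
      ∀ᶠ p : ℝ × ℝ × ℝ in 𝓝 (0, c₀, 0), g (p.1, p.2.1, 0) = 0 := by
    intro g hg
    have ht : Tendsto (fun p : ℝ × ℝ × ℝ => (p.1, p.2.1, (0 : ℝ))) (𝓝 (0, c₀, 0))
        (𝓝 (0, c₀, 0)) := by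
      have : Continuous (fun p : ℝ × ℝ × ℝ => (p.1, p.2.1, (0 : ℝ))) := by fun_prop
      exact this.tendsto (0, c₀, 0)
    filter_upwards [ht.eventually hg] with p hp
    simp only [neg_zero, neg_smul, one_smul] at hp
    have : (2 : ℝ) • g (p.1, p.2.1, 0) = 0 := by
      rw [two_smul]; nth_rewrite 1 [hp]; simp
    exact (smul_eq_zero.mp this).resolve_left two_ne_zero
  filter_upwards [key _ h1, key _ (by simpa using h3)] with p hp1 hp3
  exact ⟨hp1, hp3⟩

end Calculus

namespace Bloch
variable {s : ℝ}

/-! ### The algebra of the fibres -/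

theorem coeff_add (n : ℤ) (f g : L2per) : coeff n (f + g) = coeff n f + coeff n g :=
  inner_add_right _ _ _

theorem coeff_sub (n : ℤ) (f g : L2per) : coeff n (f - g) = coeff n f - coeff n g :=
  inner_sub_right _ _ _

theorem coeff_smul (n : ℤ) (r : ℂ) (f : L2per) : coeff n (r • f) = r * coeff n f :=
  inner_smul_right _ _ _

theorem coeff_zero (n : ℤ) : coeff n (0 : L2per) = 0 := inner_zero_right _

theorem coeff_mode (n m : ℤ) : coeff n (mode m) = if n = m then 1 else 0 := inner_mode n m

theorem inner_mode_right (f : L2per) (n : ℤ) : inner ℂ f (mode n) = starRingEnd ℂ (coeff n f) :=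
  (inner_conj_symm _ _).symm

theorem meanProj_apply (f : L2per) : meanProj f = coeff 0 f • mode 0 := rfl

theorem coeff_meanProj (n : ℤ) (f : L2per) :
    coeff n (meanProj f) = if n = 0 then coeff 0 f else 0 := by
  rw [meanProj_apply, coeff_smul, coeff_mode]
  split_ifs <;> simp

theorem inner_meanProj (f g : L2per) : inner ℂ (meanProj f) g = inner ℂ f (meanProj g) := by
  rw [meanProj_apply, meanProj_apply, inner_smul_left, inner_smul_right, inner_mode_right]
  exact mul_comm _ _

theorem re_inner_meanProj (f : L2per) : (inner ℂ f (meanProj f)).re = ‖coeff 0 f‖ ^ 2 := by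
  rw [meanProj_apply, inner_smul_right, inner_mode_right, Complex.mul_conj']
  norm_cast

theorem mem_fibre {ν κ : ℝ} {f : L2per} : f ∈ fibre ν κ ↔ (ν ≠ 0 → κ = 0 → coeff 0 f = 0) := by
  unfold fibre
  split_ifs with h
  · rw [Submodule.mem_orthogonal_singleton_iff_inner_right]
    exact ⟨fun hf _ _ => hf, fun hf => hf h.1 h.2⟩
  · simp only [Submodule.mem_top, true_iff]
    exact fun h1 h2 => absurd ⟨h1, h2⟩ h

theorem mem_dom {ν κ : ℝ} {w : Hper s} :
    w ∈ dom s ν κ ↔ (ν ≠ 0 → κ = 0 → coeff 0 (toL2 w) = 0) := mem_fibre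

theorem fibreProj_of_mem {ν κ : ℝ} {f : L2per} (hf : f ∈ fibre ν κ) : fibreProj ν κ f = f := by
  unfold fibreProj
  split_ifs with h
  · change f - meanProj f = f
    rw [meanProj_apply, mem_fibre.mp hf h.1 h.2, zero_smul, sub_zero]
  · rfl

theorem fibreProj_mem (ν κ : ℝ) (f : L2per) : fibreProj ν κ f ∈ fibre ν κ := by
  rw [mem_fibre]
  intro h1 h2
  unfold fibreProj
  rw [if_pos ⟨h1, h2⟩]
  change coeff 0 (f - meanProj f) = 0
  rw [coeff_sub, coeff_meanProj, if_pos rfl, sub_self]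

theorem inner_fibreProj (ν κ : ℝ) (f g : L2per) :
    inner ℂ (fibreProj ν κ f) g = inner ℂ f (fibreProj ν κ g) := by
  unfold fibreProj
  split_ifs with h
  · change inner ℂ (f - meanProj f) g = inner ℂ f (g - meanProj g)
    rw [inner_sub_left, inner_sub_right, inner_meanProj]
  · rfl

theorem P_apply (ν : ℝ) (T : Family s) (a c κ : ℝ) (w : Hper s) :
    P ν T a c κ w =
      fibreProj ν κ (T a c κ w + ((ν / κ ^ 2 : ℝ) : ℂ) • meanProj (toL2 w)) := rfl

theorem P_mem_fibre (ν : ℝ) (T : Family s) (a c κ : ℝ) (w : Hper s) :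
    P ν T a c κ w ∈ fibre ν κ := fibreProj_mem _ _ _

theorem inner_P {ν : ℝ} {T : Family s} {a c κ : ℝ} {f : L2per} (hf : f ∈ fibre ν κ) (w : Hper s) :
    inner ℂ f (P ν T a c κ w) =
      inner ℂ f (T a c κ w) + ((ν / κ ^ 2 : ℝ) : ℂ) * inner ℂ f (meanProj (toL2 w)) := by
  rw [P_apply, ← inner_fibreProj, fibreProj_of_mem hf, inner_add_right, inner_smul_right]

theorem P_symm {ν : ℝ} {T : Family s} {a c κ : ℝ} (hT : IsSelfAdjoint (toUnbounded (T a c κ)))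
    {v w : Hper s} (hv : v ∈ dom s ν κ) (hw : w ∈ dom s ν κ) :
    inner ℂ (P ν T a c κ v) (toL2 w) = inner ℂ (toL2 v) (P ν T a c κ w) := by
  rw [inner_P hv, P_apply, inner_fibreProj, fibreProj_of_mem hw, inner_add_left, inner_smul_left,
    Complex.conj_ofReal, selfAdjoint_symm hT, inner_meanProj]

theorem re_inner_P {ν : ℝ} {T : Family s} {a c κ : ℝ} {w : Hper s} (hw : w ∈ dom s ν κ) :
    (inner ℂ (toL2 w) (P ν T a c κ w)).re =
      (inner ℂ (toL2 w) (T a c κ w)).re + ν / κ ^ 2 * ‖coeff 0 (toL2 w)‖ ^ 2 := by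
  rw [inner_P hw, Complex.add_re, Complex.re_ofReal_mul, re_inner_meanProj]

/-- A vector of the fibre at 0 has zero mean when ν ≠ 0, so it does not see the singular term. Such
pairings can be differentiated through κ = 0. -/
theorem inner_P_of_mem_zero {ν : ℝ} {T : Family s} {a c κ : ℝ} {v : L2per} (hv : v ∈ fibre ν 0)
    (w : Hper s) : inner ℂ v (P ν T a c κ w) = inner ℂ v (T a c κ w) := by
  have hv' : v ∈ fibre ν κ := mem_fibre.mpr fun h1 _ => mem_fibre.mp hv h1 rfl
  rw [inner_P hv', meanProj_apply, inner_smul_right, inner_mode_right]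
  by_cases h : ν = 0
  · simp [h]
  · rw [mem_fibre.mp hv h rfl]; simp

/-- The factor that removes the singularity of the zeroth Fourier mode at `κ = 0`. -/
def modeScale (ν κ : ℝ) : ℝ := open Classical in if ν = 0 then 1 else κ ^ 2

/-- Multiplication of the zeroth Fourier mode by `modeScale ν κ`. -/
def fibreScale (ν κ : ℝ) : L2per →L[ℂ] L2per :=
  ContinuousLinearMap.id ℂ L2per - (1 - modeScale ν κ) • meanProj

theorem fibreScale_apply (ν κ : ℝ) (f : L2per) :
    fibreScale ν κ f = f - ((1 - modeScale ν κ : ℝ) : ℂ) • meanProj f := rfl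

theorem coeff_fibreScale (ν κ : ℝ) (n : ℤ) (f : L2per) :
    coeff n (fibreScale ν κ f) = if n = 0 then (modeScale ν κ : ℂ) * coeff 0 f else coeff n f := by
  rw [fibreScale_apply, coeff_sub, coeff_smul, coeff_meanProj]
  split_ifs with h
  · subst h; push_cast; ring
  · simp

/-- The regularized family `fibreScale · P`. -/
def regularized (hs : 0 ≤ s) (ν : ℝ) (T : Family s) (p : ℝ × ℝ × ℝ) : Hper s →L[ℂ] L2per :=
  (fibreScale ν p.2.2).comp (T p.1 p.2.1 p.2.2) + (ν : ℂ) • meanProj.comp (incl hs)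

theorem regularized_apply (hs : 0 ≤ s) (ν : ℝ) (T : Family s) (p : ℝ × ℝ × ℝ) (w : Hper s) :
    regularized hs ν T p w =
      fibreScale ν p.2.2 (T p.1 p.2.1 p.2.2 w) + (ν : ℂ) • meanProj (toL2 w) := rfl

/-- The factor `κ ^ 2` turns `ν / κ ^ 2` into the constant ν. At κ = 0 with ν ≠ 0 the zeroth mode
vanishes on both sides, because elements of the domain have zero mean. -/
theorem regularized_eq_scale_P (hs : 0 ≤ s) {ν : ℝ} {T : Family s} {a c κ : ℝ} {w : Hper s}
    (hw : w ∈ dom s ν κ) :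
    regularized hs ν T (a, c, κ) w = fibreScale ν κ (P ν T a c κ w) := by
  rw [regularized_apply]
  refine ext_coeff fun n => ?_
  rw [coeff_add, coeff_smul, coeff_meanProj, coeff_fibreScale, coeff_fibreScale, P_apply]
  have hw' := mem_dom.mp hw
  by_cases hν : ν = 0
  · have hF : fibreProj ν κ = ContinuousLinearMap.id ℂ L2per := if_neg fun h => h.1 hν
    have hM : modeScale ν κ = 1 := if_pos hν
    rw [hF, hM, hν]
    by_cases h : n = 0
    · simp [h]
    · simp [h]
  · have hM : modeScale ν κ = κ ^ 2 := if_neg hν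
    by_cases hκ : κ = 0
    · have hF : fibreProj ν κ = ContinuousLinearMap.id ℂ L2per - meanProj := if_pos ⟨hν, hκ⟩
      rw [hF, hM, hw' hν hκ]
      change _ = if n = 0 then _ * coeff 0 (_ - meanProj _) else coeff n (_ - meanProj _)
      simp only [coeff_sub, coeff_add, coeff_smul, coeff_meanProj, hw' hν hκ, hκ]
      by_cases h : n = 0
      · simp [h]
      · simp [h]
    · have hF : fibreProj ν κ = ContinuousLinearMap.id ℂ L2per := if_neg fun h => hκ h.2
      rw [hF, hM]
      simp only [ContinuousLinearMap.id_apply, coeff_add, coeff_smul, coeff_meanProj]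
      have : (κ : ℂ) ≠ 0 := by exact_mod_cast hκ
      by_cases h : n = 0
      · simp only [h, if_true]
        push_cast
        field_simp
      · simp [h]

/-- The scaling is degenerate only on the zeroth mode at κ = 0 with ν ≠ 0, which is precisely the
mode missing from the fibre there. -/
theorem eq_zero_of_fibreScale_eq_zero {ν κ : ℝ} {f : L2per} (hf : f ∈ fibre ν κ)
    (h : fibreScale ν κ f = 0) : f = 0 := by
  refine ext_coeff fun n => ?_
  have h1 : coeff n (fibreScale ν κ f) = 0 := by rw [h, coeff_zero]
  rw [coeff_fibreScale] at h1
  rw [coeff_zero]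
  split_ifs at h1 with hn
  · subst hn
    by_cases h2 : ν ≠ 0 ∧ κ = 0
    · exact mem_fibre.mp hf h2.1 h2.2
    · rcases mul_eq_zero.mp h1 with h3 | h3
      · exfalso
        rw [Complex.ofReal_eq_zero] at h3
        unfold modeScale at h3
        split_ifs at h3 with h4
        · exact one_ne_zero h3
        · exact h2 ⟨h4, by simpa using h3⟩
      · exact h3
  · exact h1

/-- A relation in the regularized family is a relation in the fibres. -/
theorem dom_and_P_of_regularized (hs : 0 ≤ s) {ν : ℝ} {T : Family s} {a c κ : ℝ}
    {y y₁ y₂ : Hper s} {b₁ b₂ : ℂ}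
    (hy₁ : ν ≠ 0 → κ = 0 → coeff 0 (toL2 y₁) = 0) (hy₂ : ν ≠ 0 → κ = 0 → coeff 0 (toL2 y₂) = 0)
    (hy : y ∈ dom s ν κ)
    (h : regularized hs ν T (a, c, κ) y =
      b₁ • fibreScale ν κ (toL2 y₁) + b₂ • fibreScale ν κ (toL2 y₂)) :
    P ν T a c κ y = b₁ • toL2 y₁ + b₂ • toL2 y₂ := by
  rw [regularized_eq_scale_P hs hy, ← (fibreScale ν κ).map_smul, ← (fibreScale ν κ).map_smul,
    ← (fibreScale ν κ).map_add, ← sub_eq_zero, ← (fibreScale ν κ).map_sub] at h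
  refine sub_eq_zero.mp (eq_zero_of_fibreScale_eq_zero ?_ h)
  exact Submodule.sub_mem _ (P_mem_fibre _ _ _ _ _ _)
    (Submodule.add_mem _ (Submodule.smul_mem _ _ (mem_fibre.mpr hy₁))
      (Submodule.smul_mem _ _ (mem_fibre.mpr hy₂)))

/-- For ν ≠ 0 and κ = 0 the zeroth mode of the relation reads ν times the mean of `y` equals 0. The
constraint of the domain is therefore a consequence of the regularized equation and need not be
imposed. -/
theorem mem_dom_of_regularized (hs : 0 ≤ s) {ν : ℝ} {T : Family s} {a c κ : ℝ}
    {y : Hper s} {g₁ g₂ : L2per} {b₁ b₂ : ℂ}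
    (h : regularized hs ν T (a, c, κ) y = b₁ • fibreScale ν κ g₁ + b₂ • fibreScale ν κ g₂) :
    y ∈ dom s ν κ := by
  rw [mem_dom]
  intro hν hκ
  have h1 := congrArg (coeff 0) h
  rw [regularized_apply, coeff_add, coeff_add, coeff_smul, coeff_smul, coeff_smul,
    coeff_fibreScale, coeff_fibreScale, coeff_fibreScale, coeff_meanProj] at h1
  have h2 : modeScale ν κ = 0 := by
    unfold modeScale
    rw [if_neg hν, hκ]; simp
  simp only [h2, if_true, Complex.ofReal_zero, zero_mul, mul_zero, zero_add, add_zero] at h1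
  exact (mul_eq_zero.mp h1).resolve_left (by exact_mod_cast hν)

theorem contDiff_fibreScale (ν : ℝ) : ContDiff ℝ ∞ (fibreScale ν) := by
  have h : ContDiff ℝ ∞ (modeScale ν) := by
    unfold modeScale
    split_ifs
    · exact contDiff_const
    · exact contDiff_id.pow 2
  exact contDiff_const.sub ((contDiff_const.sub h).smul contDiff_const)

theorem contDiffAt_regularized (hs : 0 ≤ s) (ν : ℝ) {T : Family s} {p : ℝ × ℝ × ℝ}
    (hT : ContDiffAt ℝ ∞ (fun p : ℝ × ℝ × ℝ => T p.1 p.2.1 p.2.2) p) :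
    ContDiffAt ℝ ∞ (regularized hs ν T) p := by
  have h1 : ContDiffAt ℝ ∞ (fun p : ℝ × ℝ × ℝ => meanProj.comp (T p.1 p.2.1 p.2.2)) p := by
    let L : (Hper s →L[ℂ] L2per) →L[ℝ] (Hper s →L[ℂ] L2per) :=
      (ContinuousLinearMap.compL ℂ (Hper s) L2per L2per meanProj).restrictScalars ℝ
    exact L.contDiff.contDiffAt.comp p hT
  have h : ContDiff ℝ ∞ (modeScale ν) := by
    unfold modeScale
    split_ifs
    · exact contDiff_const
    · exact contDiff_id.pow 2
  have h2 : ContDiffAt ℝ ∞ (fun p : ℝ × ℝ × ℝ => modeScale ν p.2.2) p :=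
    h.contDiffAt.comp p contDiffAt_snd.snd
  have e : regularized hs ν T = fun p => (T p.1 p.2.1 p.2.2 -
      (1 - modeScale ν p.2.2) • meanProj.comp (T p.1 p.2.1 p.2.2)) +
      (ν : ℂ) • meanProj.comp (incl hs) := rfl
  rw [e]
  exact (hT.sub ((contDiffAt_const.sub h2).smul h1)).add contDiffAt_const

/-- The band function is the diagonal symbol. -/
theorem band_eq {ν : ℝ} {T : Family s} {c κ : ℝ} {n : ℤ} (hn : mode n ∈ fibre ν κ) {t : ℂ}
    (ht : T 0 c κ (modeH s n) = t • mode n) :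
    band ν T c n κ = t.re + if n = 0 then ν / κ ^ 2 else 0 := by
  unfold band
  rw [inner_P hn, ht, inner_smul_right, inner_mode, if_pos rfl, mul_one]
  change (t + _ * coeff n (meanProj (mode n))).re = _
  rw [coeff_meanProj, coeff_mode]
  by_cases h : n = 0
  · simp only [h, if_true, mul_one, Complex.add_re, Complex.ofReal_re]
  · simp only [h, if_false, mul_zero, add_zero]

end Bloch

namespace Bloch
variable {s : ℝ}

/-! ### Lower bounds for the quadratic forms -/

theorem coeff_pairProj (n : ℤ) (f : L2per) :
    coeff n (pairProj (mode 1) (mode (-1)) f) = if n = 1 ∨ n = -1 then coeff n f else 0 := by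
  rw [pairProj_apply]
  change coeff n (coeff 1 f • mode 1 + coeff (-1) f • mode (-1)) = _
  rw [coeff_add, coeff_smul, coeff_smul, coeff_mode, coeff_mode]
  by_cases h1 : n = 1
  · subst h1; simp
  · by_cases h2 : n = -1
    · subst h2; simp
    · simp [h1, h2]

theorem re_inner_pairProj (f : L2per) :
    (inner ℂ f (pairProj (mode 1) (mode (-1)) f)).re = ‖coeff 1 f‖ ^ 2 + ‖coeff (-1) f‖ ^ 2 := by
  rw [pairProj_apply]
  change (inner ℂ f (coeff 1 f • mode 1 + coeff (-1) f • mode (-1))).re = _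
  rw [inner_add_right, inner_smul_right, inner_smul_right, inner_mode_right, inner_mode_right,
    Complex.mul_conj', Complex.mul_conj']
  norm_cast

theorem inner_pairProj (f g : L2per) : inner ℂ (pairProj (mode 1) (mode (-1)) f) g =
    inner ℂ f (pairProj (mode 1) (mode (-1)) g) := by
  rw [pairProj_apply, pairProj_apply]
  change inner ℂ (coeff 1 f • mode 1 + coeff (-1) f • mode (-1)) g =
    inner ℂ f (coeff 1 g • mode 1 + coeff (-1) g • mode (-1))
  rw [inner_add_left, inner_add_right, inner_smul_left, inner_smul_left, inner_smul_right,
    inner_smul_right, inner_mode_right, inner_mode_right]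
  change _ * coeff 1 g + _ * coeff (-1) g = _
  ring

theorem re_inner_ge_of_diagonal {f g : L2per} {α : ℤ → ℂ} {δ : ℝ}
    (hg : ∀ n, coeff n g = α n * coeff n f) (hα : ∀ n, δ ≤ (α n).re) :
    δ * ‖f‖ ^ 2 ≤ (inner ℂ f g).re := by
  have h1 := ((fourierBasis (T := 2 * Real.pi)).hasSum_inner_mul_inner f g).mapL
    Complex.reCLM
  have h2 := (((fourierBasis (T := 2 * Real.pi)).hasSum_inner_mul_inner f f).mapL
    Complex.reCLM).mul_left δ
  have e : (inner ℂ f f : ℂ).re = ‖f‖ ^ 2 := by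
    rw [inner_self_eq_norm_sq_to_K]
    norm_cast
  rw [← e]
  refine hasSum_le (fun n => ?_) h2 h1
  rw [coe_fourierBasis]
  change δ * (inner ℂ f (mode n) * coeff n f).re ≤ (inner ℂ f (mode n) * coeff n g).re
  rw [hg, inner_mode_right]
  have e2 : starRingEnd ℂ (coeff n f) * (α n * coeff n f) = α n * ((‖coeff n f‖ ^ 2 : ℝ) : ℂ) := by
    push_cast
    rw [← Complex.conj_mul']
    ring
  rw [e2, Complex.conj_mul', Complex.re_mul_ofReal]
  norm_cast
  exact mul_le_mul_of_nonneg_right (hα n) (by positivity)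

theorem eventually_selfAdjoint {ν c₀ : ℝ} {T : Family s} (hP : IsBlochFamily ν c₀ T) (κ₀ : ℝ) :
    ∀ᶠ p : ℝ × ℝ × ℝ in 𝓝 (0, c₀, κ₀), p.2.2 ∈ BZ →
      IsSelfAdjoint (toUnbounded (T p.1 p.2.1 p.2.2)) := by
  have h : Tendsto (fun p : ℝ × ℝ × ℝ => (p.1, p.2.1)) (𝓝 (0, c₀, κ₀)) (𝓝 (0, c₀)) := by
    have : Continuous (fun p : ℝ × ℝ × ℝ => (p.1, p.2.1)) := by fun_prop
    exact this.tendsto (0, c₀, κ₀)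
  filter_upwards [h.eventually hP.selfAdjoint] with p hp hκ
  exact hp _ hκ

/-- Stability of a lower bound for the form of `T`, corrected in the modes `0` and `±1`. -/
theorem eventually_form_lower_bound (hs : 0 ≤ s) {ν c₀ : ℝ} {T : Family s}
    (hP : IsBlochFamily ν c₀ T) {κ₀ : ℝ} (hκ₀ : κ₀ ∈ BZ) {θ N δ : ℝ} (hδ : 0 < δ) {t : ℤ → ℂ}
    (ht : ∀ n, T 0 c₀ κ₀ (modeH s n) = t n • mode n)
    (hlow : ∀ n : ℤ, δ ≤ (t n).re + (if n = 1 ∨ n = -1 then θ else 0) + if n = 0 then N else 0) :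
    ∀ᶠ p : ℝ × ℝ × ℝ in 𝓝 (0, c₀, κ₀), p.2.2 ∈ BZ → ∀ w : Hper s,
      δ / 2 * ‖toL2 w‖ ^ 2 ≤ (inner ℂ (toL2 w) (T p.1 p.2.1 p.2.2 w)).re +
        θ * (‖coeff 1 (toL2 w)‖ ^ 2 + ‖coeff (-1) (toL2 w)‖ ^ 2) +
        N * ‖coeff 0 (toL2 w)‖ ^ 2 := by
  have := completeSpace_Hper hs
  have hT₀ : IsSelfAdjoint (toUnbounded (T 0 c₀ κ₀)) := hP.selfAdjoint.self_of_nhds κ₀ hκ₀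
  have hdiag := fun n => coeff_apply_of_diagonal hT₀ (ht n)
  set Θ : L2per →L[ℂ] L2per :=
    (θ : ℂ) • pairProj (mode 1) (mode (-1)) + (N : ℂ) • meanProj with hΘ
  have hΘa : ∀ f, Θ f = (θ : ℂ) • pairProj (mode 1) (mode (-1)) f + (N : ℂ) • meanProj f :=
    fun f => rfl
  have hΘsym : ∀ f g, inner ℂ (Θ f) g = inner ℂ f (Θ g) := fun f g => by
    rw [hΘa, hΘa, inner_add_left, inner_add_right, inner_smul_left, inner_smul_left,
      inner_smul_right, inner_smul_right, inner_pairProj, inner_meanProj, Complex.conj_ofReal,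
      Complex.conj_ofReal]
  have hΘre : ∀ f, (inner ℂ f (Θ f)).re =
      θ * (‖coeff 1 f‖ ^ 2 + ‖coeff (-1) f‖ ^ 2) + N * ‖coeff 0 f‖ ^ 2 := fun f => by
    rw [hΘa, inner_add_right, inner_smul_right, inner_smul_right, Complex.add_re,
      Complex.re_ofReal_mul, Complex.re_ofReal_mul, re_inner_pairProj, re_inner_meanProj]
  -- The correction `Θ` raises the symbol to real part at least `δ`, so `A₀` is invertible and its
  -- form dominates `δ ‖·‖²`.
  let A₀ : Hper s →L[ℂ] L2per := T 0 c₀ κ₀ + Θ.comp (incl hs)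
  let α : ℤ → ℂ := fun n =>
    t n + ((if n = 1 ∨ n = -1 then (θ : ℂ) else 0) + if n = 0 then (N : ℂ) else 0)
  have hA₀ : ∀ n v, coeff n (A₀ v) = α n * coeff n (toL2 v) := by
    intro n v
    change coeff n (T 0 c₀ κ₀ v + Θ (toL2 v)) = _
    rw [hΘa, coeff_add, coeff_add, coeff_smul, coeff_smul, coeff_pairProj, coeff_meanProj,
      (hdiag n).2]
    by_cases h0 : n = 0
    · subst h0; simp [α]; ring
    · by_cases h1 : n = 1 ∨ n = -1
      · simp [α, h0, h1]; ring
      · simp [α, h0, h1]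
  have hαre : ∀ n, δ ≤ (α n).re := by
    intro n
    refine (hlow n).trans (le_of_eq ?_)
    simp only [α, Complex.add_re, ← add_assoc]
    congr 1
    · congr 1
      split_ifs <;> simp
    · split_ifs <;> simp
  have hbij : Function.Bijective A₀ := by
    refine bijective_of_diagonal hT₀ ht hA₀ hδ
      (fun n => (hαre n).trans (Complex.re_le_norm _)) (K := |θ| + |N|) (fun n => ?_)
    simp only [α, sub_add_cancel_left, norm_neg]
    refine (norm_add_le _ _).trans (add_le_add ?_ ?_)
    · split_ifs <;> simp
    · split_ifs <;> simp
  let A : Hper s ≃L[ℂ] L2per := ContinuousLinearEquiv.ofBijective A₀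
    (LinearMap.ker_eq_bot.mpr hbij.1) (LinearMap.range_eq_top.mpr hbij.2)
  have hA : ∀ v, A v = A₀ v := fun v => rfl
  have hAsym : ∀ v w, inner ℂ (A v) (incl hs w) = inner ℂ (incl hs v) (A w) := by
    intro v w
    rw [hA, hA]
    change inner ℂ (T 0 c₀ κ₀ v + Θ (toL2 v)) (toL2 w) =
      inner ℂ (toL2 v) (T 0 c₀ κ₀ w + Θ (toL2 w))
    rw [inner_add_left, inner_add_right, selfAdjoint_symm hT₀, hΘsym]
  have hApos : ∀ w, δ * ‖toL2 w‖ ^ 2 ≤ (inner ℂ (toL2 w) (A w)).re := fun w =>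
    re_inner_ge_of_diagonal (fun n => hA₀ n w) hαre
  set C := ‖(A.symm : L2per →L[ℂ] Hper s)‖ with hC
  -- With this threshold the perturbation has bound 1/2 relative to `A`, so half of the form of `A`
  -- survives; this is the `δ / 2` of the conclusion. The `+ 1` only keeps the denominator positive.
  have hsmall : ∀ᶠ p : ℝ × ℝ × ℝ in 𝓝 (0, c₀, κ₀),
      ‖T p.1 p.2.1 p.2.2 - T 0 c₀ κ₀‖ < 1 / (2 * (C + 1)) := by
    have hc : Tendsto (fun p : ℝ × ℝ × ℝ => ‖T p.1 p.2.1 p.2.2 - T 0 c₀ κ₀‖) (𝓝 (0, c₀, κ₀))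
        (𝓝 ‖T 0 c₀ κ₀ - T 0 c₀ κ₀‖) :=
      ((hP.smooth κ₀ hκ₀).continuousAt.sub continuousAt_const).norm
    rw [sub_self, norm_zero] at hc
    exact hc.eventually_lt_const (by positivity)
  filter_upwards [hsmall, eventually_selfAdjoint hP κ₀] with p hp hsa hκ w
  set B : Hper s →L[ℂ] L2per := T p.1 p.2.1 p.2.2 - T 0 c₀ κ₀ with hB
  have hBa : ∀ v, B v = T p.1 p.2.1 p.2.2 v - T 0 c₀ κ₀ v := fun v => rfl
  have hBsym : ∀ v w, inner ℂ (B v) (incl hs w) = inner ℂ (incl hs v) (B w) := by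
    intro v w
    rw [hBa, hBa, inner_sub_left, inner_sub_right, incl_apply, incl_apply,
      selfAdjoint_symm (hsa hκ), selfAdjoint_symm hT₀]
  have hBA : ∀ v, ‖B v‖ ≤ 1 / 2 * ‖A v‖ := by
    intro v
    have h1 : ‖v‖ ≤ C * ‖A v‖ := by
      simpa using (A.symm : L2per →L[ℂ] Hper s).le_opNorm (A v)
    calc ‖B v‖ ≤ ‖B‖ * ‖v‖ := B.le_opNorm v
      _ ≤ 1 / (2 * (C + 1)) * (C * ‖A v‖) := by gcongr
      _ ≤ 1 / 2 * ‖A v‖ := by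
        rw [← mul_assoc]
        refine mul_le_mul_of_nonneg_right ?_ (norm_nonneg _)
        have hC0 : 0 ≤ C := norm_nonneg _
        rw [div_mul_eq_mul_div, div_le_div_iff₀ (by positivity) (by positivity)]
        nlinarith
  have key := abs_re_inner_le_of_relBounded (incl hs) B A hAsym hBsym
    (fun v => le_trans (by positivity) (hApos v)) (by norm_num) hBA w
  have h2 := (abs_le.mp key).1
  have h3 := hApos w
  rw [incl_apply] at h2
  have h4 : (inner ℂ (toL2 w) (T p.1 p.2.1 p.2.2 w)).re = (inner ℂ (toL2 w) (A w)).re +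
      (inner ℂ (toL2 w) (B w)).re - (inner ℂ (toL2 w) (Θ (toL2 w))).re := by
    rw [← Complex.add_re, ← Complex.sub_re, ← inner_add_right, ← inner_sub_right, hA, hBa]
    congr 2
    change _ = T 0 c₀ κ₀ w + Θ (toL2 w) + (T p.1 p.2.1 p.2.2 w - T 0 c₀ κ₀ w) - Θ (toL2 w)
    abel
  rw [hΘre] at h4
  linarith

end Bloch

namespace Bloch
variable {s : ℝ}

/-! ### The two-dimensional invariant subspace near `κ = 0` -/

/-- The vectors `y₁, y₂` span an invariant subspace of the fibre at `p = (a, c, κ)`, normalized by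
their Fourier coefficients `±1`, and the fibre is bounded below by `m` on the complement. -/
structure IsReduced (ν : ℝ) (T : Family s) (m : ℝ) (p : ℝ × ℝ × ℝ) (y₁ y₂ : Hper s) : Prop where
  mem_BZ : p.2.2 ∈ BZ
  selfAdjoint : IsSelfAdjoint (toUnbounded (T p.1 p.2.1 p.2.2))
  coeff₁₁ : coeff 1 (toL2 y₁) = 1
  coeff₂₁ : coeff (-1) (toL2 y₁) = 0
  coeff₁₂ : coeff 1 (toL2 y₂) = 0
  coeff₂₂ : coeff (-1) (toL2 y₂) = 1
  mem₁ : y₁ ∈ dom s ν p.2.2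
  mem₂ : y₂ ∈ dom s ν p.2.2
  eq₁ : P ν T p.1 p.2.1 p.2.2 y₁ = coeff 1 (T p.1 p.2.1 p.2.2 y₁) • toL2 y₁ +
    coeff (-1) (T p.1 p.2.1 p.2.2 y₁) • toL2 y₂
  eq₂ : P ν T p.1 p.2.1 p.2.2 y₂ = coeff 1 (T p.1 p.2.1 p.2.2 y₂) • toL2 y₁ +
    coeff (-1) (T p.1 p.2.1 p.2.2 y₂) • toL2 y₂
  coercive : ∀ w ∈ dom s ν p.2.2, inner ℂ (toL2 y₁) (toL2 w) = 0 →
    inner ℂ (toL2 y₂) (toL2 w) = 0 →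
      m * ‖toL2 w‖ ^ 2 ≤ (inner ℂ (toL2 w) (P ν T p.1 p.2.1 p.2.2 w)).re
  small_trace : ‖coeff 1 (T p.1 p.2.1 p.2.2 y₁) + coeff (-1) (T p.1 p.2.1 p.2.2 y₂)‖ < m / 4
  small_det : ‖coeff 1 (T p.1 p.2.1 p.2.2 y₁) * coeff (-1) (T p.1 p.2.1 p.2.2 y₂) -
    coeff 1 (T p.1 p.2.1 p.2.2 y₂) * coeff (-1) (T p.1 p.2.1 p.2.2 y₁)‖ < m ^ 2 / 16

theorem zero_mem_BZ : (0 : ℝ) ∈ BZ := by constructor <;> norm_num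

theorem BZ_mem_nhds_zero : BZ ∈ 𝓝 (0 : ℝ) := Icc_mem_nhds (by norm_num) (by norm_num)

theorem exists_symbol {ν c₀ : ℝ} {T : Family s} (hP : IsBlochFamily ν c₀ T) {κ : ℝ}
    (hκ : κ ∈ BZ) : ∃ t : ℤ → ℂ, ∀ n, T 0 c₀ κ (modeH s n) = t n • mode n :=
  Classical.axiom_of_choice (hP.constCoeff.self_of_nhds κ hκ)

theorem mode_mem_fibre {ν κ : ℝ} {n : ℤ} (h : ν = 0 ∨ κ ≠ 0 ∨ n ≠ 0) : mode n ∈ fibre ν κ := by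
  rw [mem_fibre]
  intro hν hκ
  have hn : n ≠ 0 := (h.resolve_left hν).resolve_left (not_not.mpr hκ)
  rw [coeff_mode, if_neg hn.symm]

/-- The asymptotic estimate holds at κ = 0 itself, where its right-hand side is 0. -/
theorem band_one_zero {ν c₀ d : ℝ} {T : Family s} (h₁ : UnperturbedBands ν c₀ T d) :
    band ν T c₀ 1 0 = 0 ∧ band ν T c₀ (-1) 0 = 0 := by
  have key : ∀ f : ℝ → ℝ, ((fun κ => f κ - 1 / 2 * d * κ ^ 2) =O[𝓝 0] fun κ : ℝ => κ ^ 3) →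
      f 0 = 0 := by
    intro f hf
    obtain ⟨C, hC⟩ := hf.bound
    have h := hC.self_of_nhds
    simpa using h
  exact ⟨key _ h₁.convex_one, key _ h₁.convex_neg_one⟩

theorem symbol_zero {ν c₀ d : ℝ} {T : Family s} (hP : IsBlochFamily ν c₀ T)
    (h₁ : UnperturbedBands ν c₀ T d) {t : ℤ → ℂ}
    (ht : ∀ n, T 0 c₀ 0 (modeH s n) = t n • mode n) : t 1 = 0 ∧ t (-1) = 0 := by
  have hT₀ : IsSelfAdjoint (toUnbounded (T 0 c₀ 0)) :=
    hP.selfAdjoint.self_of_nhds 0 zero_mem_BZ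
  have key : ∀ n : ℤ, n ≠ 0 → band ν T c₀ n 0 = 0 → t n = 0 := by
    intro n hn hb
    rw [band_eq (mode_mem_fibre (Or.inr (Or.inr hn))) (ht n), if_neg hn, add_zero] at hb
    have h1 := Complex.conj_eq_iff_real.mp (coeff_apply_of_diagonal hT₀ (ht n)).1
    obtain ⟨r, hr⟩ := h1
    rw [hr, Complex.ofReal_re] at hb
    rw [hr, hb, Complex.ofReal_zero]
  exact ⟨key 1 (by norm_num) (band_one_zero h₁).1, key (-1) (by norm_num) (band_one_zero h₁).2⟩

/-- The abstract continuation applied to the pencil of `regularized` and `fibreScale`. Both are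
smooth through κ = 0 and alter only the zeroth mode, so their pairings with exp(±iz) are the
original ones. -/
theorem exists_smooth_pair (hs : 0 ≤ s) {ν c₀ d : ℝ} {T : Family s} (hP : IsBlochFamily ν c₀ T)
    (h₁ : UnperturbedBands ν c₀ T d) :
    ∃ y₁ y₂ : ℝ × ℝ × ℝ → Hper s, ContDiffAt ℝ ∞ y₁ (0, c₀, 0) ∧ ContDiffAt ℝ ∞ y₂ (0, c₀, 0) ∧
      y₁ (0, c₀, 0) = modeH s 1 ∧ y₂ (0, c₀, 0) = modeH s (-1) ∧
      ∀ᶠ p : ℝ × ℝ × ℝ in 𝓝 (0, c₀, 0),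
        (coeff 1 (toL2 (y₁ p)) = 1 ∧ coeff (-1) (toL2 (y₁ p)) = 0) ∧
        (coeff 1 (toL2 (y₂ p)) = 0 ∧ coeff (-1) (toL2 (y₂ p)) = 1) ∧
        regularized hs ν T p (y₁ p) =
          coeff 1 (T p.1 p.2.1 p.2.2 (y₁ p)) • fibreScale ν p.2.2 (toL2 (y₁ p)) +
          coeff (-1) (T p.1 p.2.1 p.2.2 (y₁ p)) • fibreScale ν p.2.2 (toL2 (y₂ p)) ∧
        regularized hs ν T p (y₂ p) =
          coeff 1 (T p.1 p.2.1 p.2.2 (y₂ p)) • fibreScale ν p.2.2 (toL2 (y₁ p)) +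
          coeff (-1) (T p.1 p.2.1 p.2.2 (y₂ p)) • fibreScale ν p.2.2 (toL2 (y₂ p)) := by
  have := completeSpace_Hper hs
  obtain ⟨t, ht⟩ := exists_symbol hP zero_mem_BZ
  have hT₀ : IsSelfAdjoint (toUnbounded (T 0 c₀ 0)) :=
    hP.selfAdjoint.self_of_nhds 0 zero_mem_BZ
  have hdiag := fun n => coeff_apply_of_diagonal hT₀ (ht n)
  obtain ⟨t1, t2⟩ := symbol_zero hP h₁ ht
  obtain ⟨C, hC, hgap⟩ := h₁.gap
  have hsm := hP.smooth 0 zero_mem_BZ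
  have hT₁ : T 0 c₀ 0 (modeH s 1) = 0 := by rw [ht, t1, zero_smul]
  have hT₂ : T 0 c₀ 0 (modeH s (-1)) = 0 := by rw [ht, t2, zero_smul]
  have hmean : ∀ n : ℤ, n ≠ 0 → meanProj (mode n) = 0 := fun n hn => by
    rw [meanProj_apply, coeff_mode, if_neg hn.symm, zero_smul]
  have hS : ∀ n : ℤ, n ≠ 0 → fibreScale ν 0 (mode n) = mode n := fun n hn => by
    rw [fibreScale_apply, hmean n hn, smul_zero, sub_zero]
  have hR : ∀ n : ℤ, n ≠ 0 → T 0 c₀ 0 (modeH s n) = 0 →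
      regularized hs ν T (0, c₀, 0) (modeH s n) = 0 := fun n hn hz => by
    rw [regularized_apply]
    change fibreScale ν 0 (T 0 c₀ 0 (modeH s n)) + (ν : ℂ) • meanProj (mode n) = 0
    rw [hz, hmean n hn, map_zero, smul_zero, add_zero]
  have hinn : ∀ n : ℤ, n ≠ 0 → ∀ κ f, inner ℂ (mode n) (fibreScale ν κ f) = inner ℂ (mode n) f :=
    fun n hn κ f => (coeff_fibreScale ν κ n f).trans (if_neg hn)
  refine exists_smooth_invariant_pair (incl hs) (R := regularized hs ν T)
    (T := fun p => T p.1 p.2.1 p.2.2) (S := fun p => fibreScale ν p.2.2)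
    (contDiffAt_regularized hs ν hsm) hsm
    ((contDiff_fibreScale ν).contDiffAt.comp _ contDiffAt_snd.snd)
    (e₁ := modeH s 1) (e₂ := modeH s (-1)) ((inner_mode 1 1).trans (if_pos rfl))
    ((inner_mode (-1) (-1)).trans (if_pos rfl))
    ((inner_mode 1 (-1)).trans (if_neg (by norm_num))) hT₁ hT₂
    (hR 1 (by norm_num) hT₁) (hR (-1) (by norm_num) hT₂) (hS 1 (by norm_num))
    (hS (-1) (by norm_num)) ?_ ?_ ?_
  -- The symbol of the linearized operator: the normalization contributes 1 in the modes ±1. In the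
  -- zeroth mode it equals `t 0` for ν = 0, bounded below by the gap, and ν otherwise, because
  -- `modeScale ν 0 = 0` then.
  · let α : ℤ → ℂ := fun n => if n = 1 ∨ n = -1 then 1 else
      if n = 0 then modeScale ν 0 * t 0 + ν else t n
    have hα : ∀ n, min 1 (min C (if ν = 0 then 1 else ν)) ≤ ‖α n‖ := by
      intro n
      by_cases h1 : n = 1 ∨ n = -1
      · simp [α, h1]
      · push Not at h1
        by_cases h0 : n = 0
        · by_cases hν : ν = 0
          · have hb := hgap 0 zero_mem_BZ 0 (by norm_num) (by norm_num)
              (mode_mem_fibre (Or.inl hν))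
            rw [band_eq (mode_mem_fibre (Or.inl hν)) (ht 0)] at hb
            have e : α n = t 0 := by
              simp [α, h0, hν, modeScale]
            rw [e]
            refine (min_le_right _ _).trans ((min_le_left _ _).trans ?_)
            refine hb.trans ?_
            simpa [hν] using Complex.re_le_norm (t 0)
          · have e : α n = ν := by simp [α, h0, modeScale, hν]
            rw [e, Complex.norm_real, Real.norm_eq_abs]
            refine (min_le_right _ _).trans ((min_le_right _ _).trans ?_)
            rw [if_neg hν]
            exact le_abs_self ν
        · have hb := hgap 0 zero_mem_BZ n h1.1 h1.2 (mode_mem_fibre (Or.inr (Or.inr h0)))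
          rw [band_eq (mode_mem_fibre (Or.inr (Or.inr h0))) (ht n), if_neg h0, add_zero] at hb
          have e : α n = t n := by simp [α, h0, h1.1, h1.2]
          rw [e]
          exact (min_le_right _ _).trans ((min_le_left _ _).trans
            (hb.trans (Complex.re_le_norm _)))
    refine bijective_of_diagonal hT₀ ht (α := α) (fun n v => ?_) (lt_min one_pos (lt_min hC ?_)) hα
      (K := 1 + ‖t 0 - (modeScale ν 0 * t 0 + ν)‖) (fun n => ?_)
    · change coeff n (regularized hs ν T (0, c₀, 0) v -
        pairProj (mode 1) (mode (-1)) (regularized hs ν T (0, c₀, 0) v) +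
        pairProj (mode 1) (mode (-1)) (toL2 v)) = _
      rw [coeff_add, coeff_sub, coeff_pairProj, coeff_pairProj]
      by_cases h1 : n = 1 ∨ n = -1
      · simp [α, h1]
      · rw [regularized_apply, coeff_add, coeff_fibreScale, coeff_smul, coeff_meanProj]
        simp only [α, h1, if_false, sub_zero, add_zero]
        by_cases h0 : n = 0
        · simp only [h0, if_true, (hdiag 0).2]
          ring
        · simp only [h0, if_false, (hdiag n).2, mul_zero, add_zero]
    · split_ifs with hν
      · exact one_pos
      · exact lt_of_le_of_ne hP.nu_nonneg (Ne.symm hν)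
    · by_cases h1 : n = 1 ∨ n = -1
      · have e : t n = 0 := by
          rcases h1 with h1 | h1
          · rw [h1, t1]
          · rw [h1, t2]
        simp [α, h1, e]
      · by_cases h0 : n = 0
        · simp only [α, h0]
          norm_num
        · simp only [α, h1, h0, if_false, sub_self, norm_zero]
          positivity
  · refine Eventually.of_forall fun p v => ?_
    have key : ∀ n : ℤ, n ≠ 0 → inner ℂ (mode n) (regularized hs ν T p v) =
        inner ℂ (mode n) (T p.1 p.2.1 p.2.2 v) := by
      intro n hn
      change coeff n _ = coeff n _
      rw [regularized_apply, coeff_add, coeff_smul, coeff_meanProj, coeff_fibreScale, if_neg hn,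
        if_neg hn, mul_zero, add_zero]
    exact ⟨key 1 (by norm_num), key (-1) (by norm_num)⟩
  · exact Eventually.of_forall fun p f =>
      ⟨hinn 1 (by norm_num) _ f, hinn (-1) (by norm_num) _ f⟩

/-- Coercivity of the fibres near `κ = 0` up to the modes `±1`. -/
theorem eventually_P_lower_bound (hs : 0 ≤ s) {ν c₀ d : ℝ} {T : Family s}
    (hP : IsBlochFamily ν c₀ T) (h₁ : UnperturbedBands ν c₀ T d) :
    ∃ C > 0, ∀ᶠ p : ℝ × ℝ × ℝ in 𝓝 (0, c₀, 0), ∀ w ∈ dom s ν p.2.2,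
      C / 2 * ‖toL2 w‖ ^ 2 ≤ (inner ℂ (toL2 w) (P ν T p.1 p.2.1 p.2.2 w)).re +
        C * (‖coeff 1 (toL2 w)‖ ^ 2 + ‖coeff (-1) (toL2 w)‖ ^ 2) := by
  obtain ⟨t, ht⟩ := exists_symbol hP zero_mem_BZ
  obtain ⟨t1, t2⟩ := symbol_zero hP h₁ ht
  obtain ⟨C, hC, hgap⟩ := h₁.gap
  -- For ν ≠ 0 the gap says nothing about the zeroth mode of `T` at κ = 0. `N` raises it to `C`; the
  -- price is paid by `ν / κ ^ 2`, which exceeds `N` for small κ ≠ 0, while at κ = 0 the mode is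
  -- absent from the domain.
  set N : ℝ := if ν = 0 then 0 else C - (t 0).re with hN
  have hlow : ∀ n : ℤ,
      C ≤ (t n).re + (if n = 1 ∨ n = -1 then C else 0) + if n = 0 then N else 0 := by
    intro n
    by_cases h1 : n = 1 ∨ n = -1
    · have e : t n = 0 := by
        rcases h1 with h1 | h1
        · rw [h1, t1]
        · rw [h1, t2]
      have h0 : n ≠ 0 := by omega
      simp [h1, h0, e]
    · have h1' := h1
      push Not at h1'
      by_cases h0 : n = 0
      · by_cases hν : ν = 0
        · have hb := hgap 0 zero_mem_BZ n h1'.1 h1'.2 (mode_mem_fibre (Or.inl hν))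
          rw [band_eq (mode_mem_fibre (Or.inl hν)) (ht n)] at hb
          simpa [h0, hν, hN] using hb
        · simp [h0, hN, hν]
      · have hb := hgap 0 zero_mem_BZ n h1'.1 h1'.2 (mode_mem_fibre (Or.inr (Or.inr h0)))
        rw [band_eq (mode_mem_fibre (Or.inr (Or.inr h0))) (ht n), if_neg h0, add_zero] at hb
        simpa [h0, h1] using hb
  refine ⟨C, hC, ?_⟩
  have hcont : Tendsto (fun p : ℝ × ℝ × ℝ => p.2.2) (𝓝 (0, c₀, 0)) (𝓝 0) := by
    have : Continuous (fun p : ℝ × ℝ × ℝ => p.2.2) := by fun_prop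
    exact this.tendsto (0, c₀, 0)
  have hlarge : ∀ᶠ κ : ℝ in 𝓝 0, κ ≠ 0 → ν ≠ 0 → N ≤ ν / κ ^ 2 := by
    by_cases hν : ν = 0
    · exact Eventually.of_forall fun κ _ h => absurd hν h
    · have hpos : 0 < ν := lt_of_le_of_ne hP.nu_nonneg (Ne.symm hν)
      have h2 : Tendsto (fun κ : ℝ => |N| * κ ^ 2) (𝓝 0) (𝓝 0) := by
        have : Continuous (fun κ : ℝ => |N| * κ ^ 2) := by fun_prop
        simpa using this.tendsto 0
      filter_upwards [h2.eventually_lt_const hpos] with κ hκ hκ0 _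
      rw [le_div_iff₀ (by positivity)]
      exact (mul_le_mul_of_nonneg_right (le_abs_self N) (by positivity)).trans hκ.le
  filter_upwards [eventually_form_lower_bound hs hP zero_mem_BZ hC ht hlow,
    hcont.eventually hlarge, hcont.eventually BZ_mem_nhds_zero] with p hp hlp hBZ w hw
  have h3 := hp hBZ w
  have h4 : N * ‖coeff 0 (toL2 w)‖ ^ 2 ≤ ν / p.2.2 ^ 2 * ‖coeff 0 (toL2 w)‖ ^ 2 := by
    by_cases hν : ν = 0
    · simp [hN, hν]
    · by_cases hκ : p.2.2 = 0
      · rw [mem_dom.mp hw hν hκ]; simp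
      · exact mul_le_mul_of_nonneg_right (hlp hκ hν) (by positivity)
  rw [re_inner_P hw]
  linarith

theorem exists_reduction (hs : 0 ≤ s) {ν c₀ d : ℝ} {T : Family s} (hP : IsBlochFamily ν c₀ T)
    (h₁ : UnperturbedBands ν c₀ T d) :
    ∃ m > 0, ∃ y₁ y₂ : ℝ × ℝ × ℝ → Hper s,
      ContDiffAt ℝ ∞ y₁ (0, c₀, 0) ∧ ContDiffAt ℝ ∞ y₂ (0, c₀, 0) ∧
      y₁ (0, c₀, 0) = modeH s 1 ∧ y₂ (0, c₀, 0) = modeH s (-1) ∧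
      ∀ᶠ p : ℝ × ℝ × ℝ in 𝓝 (0, c₀, 0), IsReduced ν T m p (y₁ p) (y₂ p) := by
  obtain ⟨y₁, y₂, hy₁, hy₂, hy₁0, hy₂0, hev⟩ := exists_smooth_pair hs hP h₁
  obtain ⟨C, hC, hlow⟩ := eventually_P_lower_bound hs hP h₁
  obtain ⟨t, ht⟩ := exists_symbol hP zero_mem_BZ
  obtain ⟨t1, t2⟩ := symbol_zero hP h₁ ht
  have hsm := hP.smooth 0 zero_mem_BZ
  have hcont : Tendsto (fun p : ℝ × ℝ × ℝ => p.2.2) (𝓝 (0, c₀, 0)) (𝓝 0) := by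
    have : Continuous (fun p : ℝ × ℝ × ℝ => p.2.2) := by fun_prop
    exact this.tendsto (0, c₀, 0)
  have hnear : ∀ (y : ℝ × ℝ × ℝ → Hper s) (n : ℤ), ContDiffAt ℝ ∞ y (0, c₀, 0) →
      y (0, c₀, 0) = modeH s n → ∀ᶠ p in 𝓝 (0, c₀, 0), ‖mode n - toL2 (y p)‖ < 1 / 4 := by
    intro y n hy hy0
    have h : ContinuousAt (fun p => ‖mode n - incl hs (y p)‖) (0, c₀, 0) :=
      (continuousAt_const.sub ((incl hs).continuous.continuousAt.comp hy.continuousAt)).norm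
    have h' : ‖mode n - incl hs (y (0, c₀, 0))‖ < 1 / 4 := by
      rw [hy0]
      change ‖mode n - mode n‖ < 1 / 4
      simp
    exact h.eventually_lt_const h'
  have hb : ∀ (y : ℝ × ℝ × ℝ → Hper s) (n : ℤ), ContDiffAt ℝ ∞ y (0, c₀, 0) →
      ContinuousAt (fun p : ℝ × ℝ × ℝ => coeff n (T p.1 p.2.1 p.2.2 (y p))) (0, c₀, 0) := by
    intro y n hy
    exact (contDiffAt_const.inner ℂ (hsm.complex_clm_apply hy)).continuousAt
  have hb1 : T 0 c₀ 0 (y₁ (0, c₀, 0)) = 0 := by rw [hy₁0, ht, t1, zero_smul]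
  have hb2 : T 0 c₀ 0 (y₂ (0, c₀, 0)) = 0 := by rw [hy₂0, ht, t2, zero_smul]
  have htr := ((hb y₁ 1 hy₁).add (hb y₂ (-1) hy₂)).norm.eventually_lt_const
    (u := C / 4 / 4) (by
      change ‖coeff 1 (T 0 c₀ 0 (y₁ (0, c₀, 0))) + coeff (-1) (T 0 c₀ 0 (y₂ (0, c₀, 0)))‖ < _
      rw [hb1, hb2, coeff_zero, coeff_zero, add_zero, norm_zero]
      positivity)
  have hdet := (((hb y₁ 1 hy₁).mul (hb y₂ (-1) hy₂)).sub
    ((hb y₂ 1 hy₂).mul (hb y₁ (-1) hy₁))).norm.eventually_lt_const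
    (u := (C / 4) ^ 2 / 16) (by
      change ‖coeff 1 (T 0 c₀ 0 (y₁ (0, c₀, 0))) * coeff (-1) (T 0 c₀ 0 (y₂ (0, c₀, 0))) -
        coeff 1 (T 0 c₀ 0 (y₂ (0, c₀, 0))) * coeff (-1) (T 0 c₀ 0 (y₁ (0, c₀, 0)))‖ < _
      rw [hb1, hb2, coeff_zero, coeff_zero, mul_zero, sub_zero, norm_zero]
      positivity)
  -- If `w` is orthogonal to both `yᵢ`, each within 1/4 of its mode, the coefficients ±1 of `w` have
  -- squares at most `‖w‖² / 16`. The lower bound `C / 2` then loses at most `C / 8`, so `C / 4` is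
  -- safe.
  refine ⟨C / 4, by positivity, y₁, y₂, hy₁, hy₂, hy₁0, hy₂0, ?_⟩
  filter_upwards [hev, hlow, hnear y₁ 1 hy₁ hy₁0, hnear y₂ (-1) hy₂ hy₂0, htr, hdet,
    hcont.eventually BZ_mem_nhds_zero, eventually_selfAdjoint hP 0]
    with p hp hlowp hn₁ hn₂ htrp hdetp hBZ hsa
  have hm₁ : y₁ p ∈ dom s ν p.2.2 := mem_dom_of_regularized hs hp.2.2.1
  have hm₂ : y₂ p ∈ dom s ν p.2.2 := mem_dom_of_regularized hs hp.2.2.2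
  refine ⟨hBZ, hsa hBZ, hp.1.1, hp.1.2, hp.2.1.1, hp.2.1.2, hm₁, hm₂, ?_, ?_, ?_, htrp, hdetp⟩
  · exact dom_and_P_of_regularized hs (mem_dom.mp hm₁) (mem_dom.mp hm₂) hm₁ hp.2.2.1
  · exact dom_and_P_of_regularized hs (mem_dom.mp hm₁) (mem_dom.mp hm₂) hm₂ hp.2.2.2
  · intro w hw o₁ o₂
    have hsmall : ∀ (n : ℤ) (y : Hper s), ‖mode n - toL2 y‖ < 1 / 4 →
        inner ℂ (toL2 y) (toL2 w) = 0 → ‖coeff n (toL2 w)‖ ^ 2 ≤ 1 / 16 * ‖toL2 w‖ ^ 2 := by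
      intro n y hn ho
      have e : coeff n (toL2 w) = inner ℂ (mode n - toL2 y) (toL2 w) := by
        rw [inner_sub_left, ho, sub_zero]; rfl
      have h5 : ‖coeff n (toL2 w)‖ ≤ 1 / 4 * ‖toL2 w‖ := by
        rw [e]
        exact (norm_inner_le_norm _ _).trans (by gcongr)
      calc _ ≤ (1 / 4 * ‖toL2 w‖) ^ 2 := by gcongr
        _ = _ := by ring
    have h6 := hsmall 1 _ hn₁ o₁
    have h7 := hsmall (-1) _ hn₂ o₂
    have h8 := hlowp w hw
    nlinarith [sq_nonneg ‖toL2 w‖]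

end Bloch

namespace Bloch
variable {s : ℝ}

/-! ### The two lowest eigenvalues -/

namespace IsReduced
variable {ν m : ℝ} {T : Family s} {p : ℝ × ℝ × ℝ} {y₁ y₂ : Hper s}

theorem linearIndependent (h : IsReduced ν T m p y₁ y₂) :
    LinearIndependent ℂ ![toL2 y₁, toL2 y₂] := by
  rw [LinearIndependent.pair_iff]
  intro r q hrq
  have e1 := congrArg (coeff 1) hrq
  have e2 := congrArg (coeff (-1)) hrq
  rw [coeff_add, coeff_smul, coeff_smul, coeff_zero] at e1 e2
  rw [h.coeff₁₁, h.coeff₁₂] at e1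
  rw [h.coeff₂₁, h.coeff₂₂] at e2
  exact ⟨by simpa using e1, by simpa using e2⟩

theorem span_le_dom (h : IsReduced ν T m p y₁ y₂) :
    Submodule.span ℂ {y₁, y₂} ≤ dom s ν p.2.2 := by
  rw [Submodule.span_le]
  rintro y (rfl | rfl)
  · exact h.mem₁
  · exact h.mem₂

theorem eq_of_mem_span (h : IsReduced ν T m p y₁ y₂) {w : Hper s}
    (hw : w ∈ Submodule.span ℂ {y₁, y₂}) :
    w = coeff 1 (toL2 w) • y₁ + coeff (-1) (toL2 w) • y₂ := by
  obtain ⟨r, q, rfl⟩ := Submodule.mem_span_pair.mp hw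
  rw [map_add, map_smul, map_smul, coeff_add, coeff_add, coeff_smul, coeff_smul, coeff_smul,
    coeff_smul, h.coeff₁₁, h.coeff₁₂, h.coeff₂₁, h.coeff₂₂]
  simp

theorem exists_eigenpair (h : IsReduced ν T m p y₁ y₂) (hm : 0 < m) :
    ∃ l₁ l₂ : ℝ, l₁ ≤ l₂ ∧
      (l₁ + l₂ : ℂ) = coeff 1 (T p.1 p.2.1 p.2.2 y₁) + coeff (-1) (T p.1 p.2.1 p.2.2 y₂) ∧
      (l₁ * l₂ : ℂ) = coeff 1 (T p.1 p.2.1 p.2.2 y₁) * coeff (-1) (T p.1 p.2.1 p.2.2 y₂) -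
        coeff 1 (T p.1 p.2.1 p.2.2 y₂) * coeff (-1) (T p.1 p.2.1 p.2.2 y₁) ∧
      l₂ ≤ m / 2 ∧
      ∃ w₁ ∈ Submodule.span ℂ {y₁, y₂}, ∃ w₂ ∈ Submodule.span ℂ {y₁, y₂},
        ‖toL2 w₁‖ = 1 ∧ ‖toL2 w₂‖ = 1 ∧ inner ℂ (toL2 w₁) (toL2 w₂) = 0 ∧
        P ν T p.1 p.2.1 p.2.2 w₁ = (l₁ : ℂ) • toL2 w₁ ∧
        P ν T p.1 p.2.1 p.2.2 w₂ = (l₂ : ℂ) • toL2 w₂ ∧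
        ∀ w ∈ dom s ν p.2.2, inner ℂ (toL2 w₁) (toL2 w) = 0 → inner ℂ (toL2 w₂) (toL2 w) = 0 →
          m * ‖toL2 w‖ ^ 2 ≤ (inner ℂ (toL2 w) (P ν T p.1 p.2.1 p.2.2 w)).re := by
  obtain ⟨l₁, l₂, hle, htr, hdet, w₁, hw₁, w₂, hw₂, n₁, n₂, ho, e₁, e₂, hperp⟩ :=
    exists_eigenpair_of_invariant toL2 (P ν T p.1 p.2.1 p.2.2) h.linearIndependent h.eq₁ h.eq₂
      fun v hv w hw => P_symm h.selfAdjoint (h.span_le_dom hv) (h.span_le_dom hw)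
  refine ⟨l₁, l₂, hle, htr, hdet, ?_, w₁, hw₁, w₂, hw₂, n₁, n₂, ho, e₁, e₂, fun w hw o₁ o₂ => ?_⟩
  -- If `l₂` exceeded `m / 2`, the small trace would force `l₁ < -m / 4`, and the product would be
  -- too large for the small determinant.
  · have h1 := h.small_trace
    have h2 := h.small_det
    rw [← htr] at h1
    rw [← hdet] at h2
    norm_cast at h1 h2
    rw [Real.norm_eq_abs, abs_lt] at h1 h2
    nlinarith
  · obtain ⟨o₁', o₂'⟩ := hperp _ o₁ o₂
    exact h.coercive w hw o₁' o₂'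

theorem areLowestTwo (h : IsReduced ν T m p y₁ y₂) (hm : 0 < m) : ∃ l₁ l₂ : ℝ,
    AreLowestTwo ν T p.1 p.2.1 p.2.2 l₁ l₂ ∧
      (l₁ + l₂ : ℂ) = coeff 1 (T p.1 p.2.1 p.2.2 y₁) + coeff (-1) (T p.1 p.2.1 p.2.2 y₂) ∧
      (l₁ * l₂ : ℂ) = coeff 1 (T p.1 p.2.1 p.2.2 y₁) * coeff (-1) (T p.1 p.2.1 p.2.2 y₂) -
        coeff 1 (T p.1 p.2.1 p.2.2 y₂) * coeff (-1) (T p.1 p.2.1 p.2.2 y₁) := by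
  obtain ⟨l₁, l₂, hle, htr, hdet, hl, w₁, hw₁, w₂, hw₂, n₁, n₂, ho, e₁, e₂, hlow⟩ :=
    h.exists_eigenpair hm
  refine ⟨l₁, l₂, ⟨hle, w₁, h.span_le_dom hw₁, w₂, h.span_le_dom hw₂, n₁, n₂, ho, e₁, e₂,
    fun w hw o₁ o₂ => ?_⟩, htr, hdet⟩
  refine le_trans ?_ (hlow w hw o₁ o₂)
  gcongr
  linarith

/-- The component of `w` orthogonal to the invariant subspace has Rayleigh quotient `E`, unless it
is zero, whereas the form there is at least `m > E`. -/
theorem eq_of_eigenvector (h : IsReduced ν T m p y₁ y₂) (hm : 0 < m) {w : Hper s}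
    (hw : w ∈ dom s ν p.2.2) {E : ℝ} (hE : E < m)
    (he : P ν T p.1 p.2.1 p.2.2 w = (E : ℂ) • toL2 w) :
    w = coeff 1 (toL2 w) • y₁ + coeff (-1) (toL2 w) • y₂ := by
  obtain ⟨l₁, l₂, -, -, -, -, w₁, hw₁, w₂, hw₂, n₁, n₂, ho, e₁, e₂, hlow⟩ := h.exists_eigenpair hm
  apply h.eq_of_mem_span
  have hd₁ := h.span_le_dom hw₁
  have hd₂ := h.span_le_dom hw₂
  have ho' : inner ℂ (toL2 w₂) (toL2 w₁) = 0 := by rw [← inner_conj_symm, ho, map_zero]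
  have h11 : inner ℂ (toL2 w₁) (toL2 w₁) = (1 : ℂ) := by
    rw [inner_self_eq_norm_sq_to_K, n₁]; simp
  have h22 : inner ℂ (toL2 w₂) (toL2 w₂) = (1 : ℂ) := by
    rw [inner_self_eq_norm_sq_to_K, n₂]; simp
  obtain ⟨α, hα⟩ : ∃ α, α = inner ℂ (toL2 w₁) (toL2 w) := ⟨_, rfl⟩
  obtain ⟨β, hβ⟩ : ∃ β, β = inner ℂ (toL2 w₂) (toL2 w) := ⟨_, rfl⟩
  obtain ⟨r, hr⟩ : ∃ r, r = w - α • w₁ - β • w₂ := ⟨_, rfl⟩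
  have hrd : r ∈ dom s ν p.2.2 := by
    rw [hr]
    exact Submodule.sub_mem _ (Submodule.sub_mem _ hw (Submodule.smul_mem _ _ hd₁))
      (Submodule.smul_mem _ _ hd₂)
  have r1 : inner ℂ (toL2 w₁) (toL2 r) = 0 := by
    rw [hr, map_sub, map_sub, map_smul, map_smul, inner_sub_right, inner_sub_right,
      inner_smul_right, inner_smul_right, h11, ho, ← hα]
    ring
  have r2 : inner ℂ (toL2 w₂) (toL2 r) = 0 := by
    rw [hr, map_sub, map_sub, map_smul, map_smul, inner_sub_right, inner_sub_right,
      inner_smul_right, inner_smul_right, h22, ho', ← hβ]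
    ring
  have r1' : inner ℂ (toL2 r) (toL2 w₁) = 0 := by rw [← inner_conj_symm, r1, map_zero]
  have r2' : inner ℂ (toL2 r) (toL2 w₂) = 0 := by rw [← inner_conj_symm, r2, map_zero]
  have hPr : inner ℂ (toL2 r) (P ν T p.1 p.2.1 p.2.2 r) = (E : ℂ) * inner ℂ (toL2 r) (toL2 r) := by
    have e3 : toL2 w = α • toL2 w₁ + β • toL2 w₂ + toL2 r := by
      rw [hr, map_sub, map_sub, map_smul, map_smul]; abel
    have e4 : P ν T p.1 p.2.1 p.2.2 r =
        (E : ℂ) • toL2 w - α • (l₁ : ℂ) • toL2 w₁ - β • (l₂ : ℂ) • toL2 w₂ := by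
      rw [hr, map_sub, map_sub, map_smul, map_smul, he, e₁, e₂]
    rw [e4, e3]
    simp only [inner_sub_right, inner_add_right, inner_smul_right, r1', r2', mul_zero, sub_zero,
      zero_add]
  have hfin := hlow r hrd r1 r2
  rw [hPr, Complex.re_ofReal_mul, show (inner ℂ (toL2 r) (toL2 r) : ℂ).re = ‖toL2 r‖ ^ 2 from
    inner_self_eq_norm_sq (𝕜 := ℂ) (toL2 r)] at hfin
  have hr0 : toL2 r = 0 := by
    have : ‖toL2 r‖ ^ 2 ≤ 0 := by nlinarith [sq_nonneg ‖toL2 r‖]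
    exact norm_eq_zero.mp (pow_eq_zero_iff two_ne_zero |>.mp (le_antisymm this (sq_nonneg _)))
  have hr0' : r = 0 := toL2_injective (by rw [hr0, map_zero])
  have : w = α • w₁ + β • w₂ := by
    rw [hr0'] at hr
    rw [eq_comm, sub_sub, sub_eq_zero] at hr
    exact hr
  rw [this]
  exact Submodule.add_mem _ (Submodule.smul_mem _ _ hw₁) (Submodule.smul_mem _ _ hw₂)

end IsReduced

theorem AreLowestTwo.rayleigh {ν : ℝ} {T : Family s} {a c κ l₁ l₂ : ℝ}
    (hT : IsSelfAdjoint (toUnbounded (T a c κ))) (h : AreLowestTwo ν T a c κ l₁ l₂)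
    {w : Hper s} (hw : w ∈ dom s ν κ) :
    l₁ * ‖toL2 w‖ ^ 2 ≤ (inner ℂ (toL2 w) (P ν T a c κ w)).re := by
  obtain ⟨hle, w₁, hw₁, w₂, hw₂, n₁, n₂, ho, e₁, e₂, hlow⟩ := h
  have h1 := rayleigh_lower_bound toL2 (P ν T a c κ) (dom s ν κ)
    (fun v hv w hw => P_symm hT hv hw) hw₁ hw₂ n₁ n₂ ho e₁ e₂ hlow hw
  have h2 : ‖(inner ℂ (toL2 w₁) (toL2 w) : ℂ)‖ ^ 2 ≤ ‖toL2 w‖ ^ 2 := by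
    have := norm_inner_le_norm (𝕜 := ℂ) (toL2 w₁) (toL2 w)
    rw [n₁, one_mul] at this
    gcongr
  nlinarith

/-- Min-max: the span of `v₁, v₂` contains a nonzero vector orthogonal to `w₁`, whose Rayleigh
quotient is at least `l₂` and at most `k₂`. The resulting uniqueness allows eigenvalues found in
different ways to be identified. -/
theorem AreLowestTwo.le {ν : ℝ} {T : Family s} {a c κ l₁ l₂ k₁ k₂ : ℝ}
    (hT : IsSelfAdjoint (toUnbounded (T a c κ))) (h : AreLowestTwo ν T a c κ l₁ l₂)
    (h' : AreLowestTwo ν T a c κ k₁ k₂) : l₁ ≤ k₁ ∧ l₂ ≤ k₂ := by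
  have hr := fun w hw => AreLowestTwo.rayleigh hT h (w := w) hw
  obtain ⟨-, w₁, hw₁, w₂, hw₂, n₁, n₂, ho, e₁, e₂, hlow⟩ := h
  obtain ⟨hle', v₁, hv₁, v₂, hv₂, m₁, m₂, ho', f₁, f₂, -⟩ := h'
  have i11 : inner ℂ (toL2 v₁) (toL2 v₁) = (1 : ℂ) := by
    rw [inner_self_eq_norm_sq_to_K, m₁]; simp
  have i22 : inner ℂ (toL2 v₂) (toL2 v₂) = (1 : ℂ) := by
    rw [inner_self_eq_norm_sq_to_K, m₂]; simp
  have i21 : inner ℂ (toL2 v₂) (toL2 v₁) = (0 : ℂ) := by rw [← inner_conj_symm, ho', map_zero]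
  constructor
  · have h1 := hr v₁ hv₁
    rw [f₁, inner_smul_right, i11, m₁] at h1
    simpa using h1
  · obtain ⟨α, β, hαβ, horth⟩ : ∃ α β : ℂ, 0 < ‖α‖ ^ 2 + ‖β‖ ^ 2 ∧
        α * inner ℂ (toL2 w₁) (toL2 v₁) + β * inner ℂ (toL2 w₁) (toL2 v₂) = 0 := by
      by_cases hz : inner ℂ (toL2 w₁) (toL2 v₁) = (0 : ℂ)
      · exact ⟨1, 0, by simp, by rw [hz]; ring⟩
      · refine ⟨-inner ℂ (toL2 w₁) (toL2 v₂), inner ℂ (toL2 w₁) (toL2 v₁), ?_, by ring⟩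
        have : 0 < ‖(inner ℂ (toL2 w₁) (toL2 v₁) : ℂ)‖ := norm_pos_iff.mpr hz
        positivity
    have hv : α • v₁ + β • v₂ ∈ dom s ν κ :=
      Submodule.add_mem _ (Submodule.smul_mem _ _ hv₁) (Submodule.smul_mem _ _ hv₂)
    have h1 := rayleigh_lower_bound toL2 (P ν T a c κ) (dom s ν κ)
      (fun v hv w hw => P_symm hT hv hw) hw₁ hw₂ n₁ n₂ ho e₁ e₂ hlow hv
    have e0 : inner ℂ (toL2 w₁) (toL2 (α • v₁ + β • v₂)) = (0 : ℂ) := by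
      rw [map_add, map_smul, map_smul, inner_add_right, inner_smul_right, inner_smul_right, horth]
    have e1 : inner ℂ (toL2 (α • v₁ + β • v₂)) (P ν T a c κ (α • v₁ + β • v₂)) =
        ((k₁ * ‖α‖ ^ 2 + k₂ * ‖β‖ ^ 2 : ℝ) : ℂ) := by
      simp only [map_add, map_smul, f₁, f₂, inner_add_left, inner_add_right, inner_smul_left,
        inner_smul_right, i11, i22, i21, ho']
      push_cast
      rw [← Complex.conj_mul', ← Complex.conj_mul']
      ring
    have e2 : ‖toL2 (α • v₁ + β • v₂)‖ ^ 2 = ‖α‖ ^ 2 + ‖β‖ ^ 2 := by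
      apply Complex.ofReal_injective
      have : (inner ℂ (toL2 (α • v₁ + β • v₂)) (toL2 (α • v₁ + β • v₂)) : ℂ) =
          ((‖α‖ ^ 2 + ‖β‖ ^ 2 : ℝ) : ℂ) := by
        simp only [map_add, map_smul, inner_add_left, inner_add_right, inner_smul_left,
          inner_smul_right, i11, i22, i21, ho']
        push_cast
        rw [← Complex.conj_mul', ← Complex.conj_mul']
        ring
      rw [inner_self_eq_norm_sq_to_K] at this
      rw [← this]
      push_cast
      rfl
    rw [e0, e1, e2, norm_zero, Complex.ofReal_re] at h1
    have h2 : l₂ * (‖α‖ ^ 2 + ‖β‖ ^ 2) ≤ k₂ * (‖α‖ ^ 2 + ‖β‖ ^ 2) := by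
      nlinarith [sq_nonneg ‖α‖]
    exact le_of_mul_le_mul_right h2 hαβ

theorem AreLowestTwo.unique {ν : ℝ} {T : Family s} {a c κ l₁ l₂ k₁ k₂ : ℝ}
    (hT : IsSelfAdjoint (toUnbounded (T a c κ))) (h : AreLowestTwo ν T a c κ l₁ l₂)
    (h' : AreLowestTwo ν T a c κ k₁ k₂) : l₁ = k₁ ∧ l₂ = k₂ :=
  ⟨le_antisymm (h.le hT h').1 (h'.le hT h).1, le_antisymm (h.le hT h').2 (h'.le hT h).2⟩

/-! ### Complex conjugation and parity -/

theorem coeff_eq_integral (n : ℤ) (f : L2per) :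
    coeff n f = ∫ z : AddCircle (2 * Real.pi), fourier (-n) z * f z ∂AddCircle.haarAddCircle := by
  unfold coeff mode
  rw [L2.inner_def]
  refine integral_congr_ae ?_
  filter_upwards [coeFn_fourierLp (T := 2 * Real.pi) 2 n] with z hz
  rw [hz, fourier_neg]
  simp [mul_comm]

theorem coeff_star (n : ℤ) (f : L2per) : coeff n (star f) = starRingEnd ℂ (coeff (-n) f) := by
  rw [coeff_eq_integral, coeff_eq_integral, ← integral_conj]
  refine integral_congr_ae ?_
  filter_upwards [Lp.coeFn_star f] with z hz
  rw [hz, neg_neg, map_mul, ← fourier_neg]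
  rfl

theorem coeff_neg_of_reflect {f : L2per} {r : ℂ}
    (h : (fun z => f (-z)) =ᵐ[AddCircle.haarAddCircle] fun z => r * f z) (n : ℤ) :
    coeff (-n) f = r * coeff n f := by
  rw [coeff_eq_integral, coeff_eq_integral, ← integral_neg_eq_self, ← integral_const_mul]
  refine integral_congr_ae ?_
  filter_upwards [h] with z hz
  rw [hz]
  have : fourier (- -n) (-z) = fourier (-n) z := by
    simp only [fourier_apply, neg_neg, smul_neg, neg_smul]
  rw [this]
  ring

theorem coeff_neg_of_even {f : L2per} (h : IsEvenF f) (n : ℤ) : coeff (-n) f = coeff n f := by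
  have h' : (fun z => f (-z)) =ᵐ[AddCircle.haarAddCircle] fun z => 1 * f z := by
    simpa [IsEvenF] using h
  rw [coeff_neg_of_reflect h', one_mul]

theorem coeff_neg_of_odd {f : L2per} (h : IsOddF f) (n : ℤ) : coeff (-n) f = -coeff n f := by
  have h' : (fun z => f (-z)) =ᵐ[AddCircle.haarAddCircle] fun z => (-1) * f z := by
    simpa [IsOddF] using h
  rw [coeff_neg_of_reflect h', neg_one_mul]

theorem inner_star_star (f g : L2per) :
    inner ℂ (star f) (star g) = starRingEnd ℂ (inner ℂ f g) := by
  rw [L2.inner_def, L2.inner_def, ← integral_conj]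
  refine integral_congr_ae ?_
  filter_upwards [Lp.coeFn_star f, Lp.coeFn_star g] with z hf hg
  rw [hf, hg]
  simp [mul_comm]

theorem norm_star_L2per (f : L2per) : ‖star f‖ = ‖f‖ := by
  have h : ‖star f‖ ^ 2 = ‖f‖ ^ 2 := by
    rw [← inner_self_eq_norm_sq (𝕜 := ℂ) (star f), ← inner_self_eq_norm_sq (𝕜 := ℂ) f,
      inner_star_star]
    exact Complex.conj_re _
  exact (pow_left_inj₀ (norm_nonneg _) (norm_nonneg _) two_ne_zero).mp h

theorem star_add_L2per (f g : L2per) : star (f + g) = star f + star g := by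
  refine ext_coeff fun n => ?_
  rw [coeff_add, coeff_star, coeff_star, coeff_star, coeff_add, map_add]

theorem star_sub_L2per (f g : L2per) : star (f - g) = star f - star g := by
  refine ext_coeff fun n => ?_
  rw [coeff_sub, coeff_star, coeff_star, coeff_star, coeff_sub, map_sub]

theorem exists_conj (w : Hper s) : ∃ w' : Hper s, toL2 w' = star (toL2 w) := by
  have h : star (toL2 w) ∈ sobolev s := by
    have hw : Memℓp (fun n : ℤ => (weight s n : ℂ) * coeff n (toL2 w)) 2 := w.2
    change Memℓp (fun n : ℤ => (weight s n : ℂ) * coeff n (star (toL2 w))) 2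
    have h1 := hw.summable (by norm_num)
    refine memℓp_gen ?_
    rw [← (Equiv.neg ℤ).summable_iff] at h1
    refine h1.congr fun n => ?_
    simp only [Function.comp_apply, Equiv.neg_apply]
    rw [coeff_star, norm_mul, norm_mul, RCLike.norm_conj]
    congr 3
    simp [weight]
  exact ⟨⟨_, h⟩, rfl⟩

/-- Complex conjugation is an antiunitary map from the fibre at κ to the fibre at -κ that
intertwines the operators and keeps the real eigenvalues. -/
theorem AreLowestTwo.neg {ν : ℝ} {T : Family s} {a c κ l₁ l₂ : ℝ} (hκ : κ ∈ BZ)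
    (hreal : ∀ κ ∈ BZ, ∀ w w' : Hper s, toL2 w' = star (toL2 w) →
      T a c (-κ) w' = star (T a c κ w))
    (h : AreLowestTwo ν T a c κ l₁ l₂) : AreLowestTwo ν T a c (-κ) l₁ l₂ := by
  have hdom : ∀ w w' : Hper s, toL2 w' = star (toL2 w) → w ∈ dom s ν κ → w' ∈ dom s ν (-κ) := by
    intro w w' hw' hw
    rw [mem_dom] at hw ⊢
    intro h1 h2
    rw [hw', coeff_star, neg_zero, hw h1 (neg_eq_zero.mp h2), map_zero]
  have hmean : ∀ f : L2per, meanProj (star f) = star (meanProj f) := by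
    intro f
    refine ext_coeff fun n => ?_
    rw [coeff_star, coeff_meanProj, coeff_meanProj, coeff_star]
    by_cases hn : n = 0
    · simp [hn]
    · simp [hn]
  have hsmul : ∀ (r : ℝ) (f : L2per), ((r : ℝ) : ℂ) • star f = star (((r : ℝ) : ℂ) • f) := by
    intro r f
    refine ext_coeff fun n => ?_
    rw [coeff_star, coeff_smul, coeff_smul, coeff_star, map_mul, Complex.conj_ofReal]
  have hproj : ∀ f : L2per, fibreProj ν (-κ) (star f) = star (fibreProj ν κ f) := by
    intro f
    unfold fibreProj
    by_cases h : ν ≠ 0 ∧ κ = 0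
    · rw [if_pos h, if_pos (by simpa using h)]
      change star f - meanProj (star f) = star (f - meanProj f)
      rw [hmean, star_sub_L2per]
    · rw [if_neg h, if_neg (by simpa using h)]
      rfl
  have hP : ∀ w w' : Hper s, toL2 w' = star (toL2 w) →
      P ν T a c (-κ) w' = star (P ν T a c κ w) := by
    intro w w' hw'
    rw [P_apply, P_apply, hreal κ hκ w w' hw', hw', hmean, neg_sq, hsmul, ← star_add_L2per, hproj]
  obtain ⟨hle, w₁, hw₁, w₂, hw₂, n₁, n₂, ho, e₁, e₂, hlow⟩ := h
  obtain ⟨v₁, hv₁⟩ := exists_conj w₁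
  obtain ⟨v₂, hv₂⟩ := exists_conj w₂
  refine ⟨hle, v₁, hdom _ _ hv₁ hw₁, v₂, hdom _ _ hv₂ hw₂, ?_, ?_, ?_, ?_, ?_, ?_⟩
  · rw [hv₁, norm_star_L2per, n₁]
  · rw [hv₂, norm_star_L2per, n₂]
  · rw [hv₁, hv₂, inner_star_star, ho, map_zero]
  · rw [hP _ _ hv₁, e₁, hv₁, hsmul]
  · rw [hP _ _ hv₂, e₂, hv₂, hsmul]
  · intro w hw o₁ o₂
    obtain ⟨v, hv⟩ := exists_conj w
    have hv' : toL2 w = star (toL2 v) := by rw [hv, star_star]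
    have hvd : v ∈ dom s ν κ := by
      rw [mem_dom] at hw ⊢
      intro h1 h2
      rw [hv, coeff_star, neg_zero, hw h1 (neg_eq_zero.mpr h2), map_zero]
    rw [hv₁, hv', inner_star_star, map_eq_zero] at o₁
    rw [hv₂, hv', inner_star_star, map_eq_zero] at o₂
    have := hlow v hvd o₁ o₂
    rw [hP v w hv', hv', inner_star_star, norm_star_L2per, Complex.conj_re]
    exact this

end Bloch

/-- A polynomial of degree `< n` that is `O(κ ^ n)` vanishes. -/
theorem coeff_eq_zero_of_norm_sum_pow_le {F : Type*} [NormedAddCommGroup F] [NormedSpace ℝ F]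
    (n : ℕ) (x : ℕ → F) (M : ℝ)
    (h : ∀ᶠ κ : ℝ in 𝓝 0, ‖∑ j ∈ Finset.range n, κ ^ j • x j‖ ≤ M * |κ| ^ n) :
    ∀ j < n, x j = 0 := by
  induction n generalizing x with
  | zero => intro j hj; omega
  | succ n ih =>
    have h0 : x 0 = 0 := by
      have := h.self_of_nhds
      rw [Finset.sum_range_succ'] at this
      simpa using this
    have hx : ∀ᶠ κ : ℝ in 𝓝[≠] 0,
        ‖∑ j ∈ Finset.range n, κ ^ j • x (j + 1)‖ ≤ M * |κ| ^ n := by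
      filter_upwards [h.filter_mono nhdsWithin_le_nhds, self_mem_nhdsWithin] with κ hκ hne
      rw [Finset.sum_range_succ', h0, smul_zero, add_zero] at hκ
      have e : ∑ j ∈ Finset.range n, κ ^ (j + 1) • x (j + 1) =
          κ • ∑ j ∈ Finset.range n, κ ^ j • x (j + 1) := by
        rw [Finset.smul_sum]
        refine Finset.sum_congr rfl fun j _ => ?_
        rw [smul_smul, pow_succ']
      rw [e, norm_smul, Real.norm_eq_abs, pow_succ, mul_comm (|κ| ^ n), ← mul_assoc,
        mul_comm M, mul_assoc] at hκ
      exact le_of_mul_le_mul_left hκ (abs_pos.mpr hne)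
    have hx' : ∀ᶠ κ : ℝ in 𝓝 0,
        ‖∑ j ∈ Finset.range n, κ ^ j • x (j + 1)‖ ≤ M * |κ| ^ n := by
      rw [← nhdsNE_sup_pure, eventually_sup]
      refine ⟨hx, ?_⟩
      rw [eventually_pure]
      have c1 : Tendsto (fun κ : ℝ => ‖∑ j ∈ Finset.range n, κ ^ j • x (j + 1)‖) (𝓝[≠] 0)
          (𝓝 ‖∑ j ∈ Finset.range n, (0 : ℝ) ^ j • x (j + 1)‖) := by
        have : Continuous fun κ : ℝ => ‖∑ j ∈ Finset.range n, κ ^ j • x (j + 1)‖ := by fun_prop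
        exact (this.tendsto 0).mono_left nhdsWithin_le_nhds
      have c2 : Tendsto (fun κ : ℝ => M * |κ| ^ n) (𝓝[≠] 0) (𝓝 (M * |(0 : ℝ)| ^ n)) := by
        have : Continuous fun κ : ℝ => M * |κ| ^ n := by fun_prop
        exact (this.tendsto 0).mono_left nhdsWithin_le_nhds
      exact le_of_tendsto_of_tendsto c1 c2 hx
    intro j hj
    cases j with
    | zero => exact h0
    | succ j => exact ih (fun j => x (j + 1)) hx' j (by omega)

/-- The Taylor polynomial of degree `i` differs from `e κ ^ i` by `O(κ ^ (i + 1))`, and a polynomial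
of degree `i` that small has zero coefficients. -/
theorem pderiv₃_eq_of_isBigO {c₀ e : ℝ} {f : ℝ × ℝ × ℝ → ℂ} (hf : ContDiffAt ℝ ∞ f (0, c₀, 0))
    (i : ℕ) (ho : (fun κ : ℝ => f (0, c₀, κ) - ((e * κ ^ i : ℝ) : ℂ)) =O[𝓝 0]
      fun κ : ℝ => κ ^ (i + 1)) : pderiv₃^[i] f (0, c₀, 0) = i.factorial * e := by
  obtain ⟨M, hM, r, hr, ht⟩ := exists_taylor_third (i + 1) hf
  obtain ⟨C, hC⟩ := ho.bound
  have h0 := coeff_eq_zero_of_norm_sum_pow_le (i + 1)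
    (fun j => ((j.factorial : ℝ)⁻¹) • pderiv₃^[j] f (0, c₀, 0) -
      if j = i then (e : ℂ) else 0) (M + C) ?_ i (Nat.lt_succ_self i)
  · have hi : (i.factorial : ℂ) ≠ 0 := by exact_mod_cast i.factorial_ne_zero
    simp only [if_true] at h0
    rw [sub_eq_zero, Complex.real_smul] at h0
    rw [← h0]
    push_cast
    field_simp
  · filter_upwards [hC, Metric.ball_mem_nhds (0 : ℝ) hr] with κ h1 h2
    rw [Metric.mem_ball, dist_zero_right, Real.norm_eq_abs] at h2
    have h3 := ht 0 c₀ κ (by simpa using hr) (by simpa using hr) h2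
    rw [norm_pow, Real.norm_eq_abs] at h1
    have e1 : ∑ j ∈ Finset.range (i + 1), κ ^ j •
        (((j.factorial : ℝ)⁻¹) • pderiv₃^[j] f (0, c₀, 0) - if j = i then (e : ℂ) else 0) =
        (f (0, c₀, κ) - ((e * κ ^ i : ℝ) : ℂ)) - (f (0, c₀, κ) -
          ∑ j ∈ Finset.range (i + 1), (κ ^ j / j.factorial) • pderiv₃^[j] f (0, c₀, 0)) := by
      have e2 : ∑ j ∈ Finset.range (i + 1), κ ^ j • (if j = i then (e : ℂ) else 0) =
          ((e * κ ^ i : ℝ) : ℂ) := by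
        rw [Finset.sum_eq_single_of_mem i (Finset.self_mem_range_succ i)
          (fun j _ hj => by rw [if_neg hj, smul_zero]), if_pos rfl, Complex.real_smul]
        push_cast
        ring
      simp only [smul_sub, Finset.sum_sub_distrib, e2, smul_smul, div_eq_mul_inv]
      ring
    rw [e1]
    calc _ ≤ _ := norm_sub_le _ _
      _ ≤ C * |κ| ^ (i + 1) + M * |κ| ^ (i + 1) := add_le_add h1 h3
      _ = _ := by ring

namespace Bloch
variable {s : ℝ}

/-! ### The reduced matrix -/

/-- The entries of the matrix of the fibres on the span of `y₁, y₂`. -/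
def entry (T : Family s) (y : ℝ × ℝ × ℝ → Hper s) (k : ℤ) (p : ℝ × ℝ × ℝ) : ℂ :=
  coeff k (T p.1 p.2.1 p.2.2 (y p))

/-- The trace and the determinant are smooth and depend only on the two eigenvalues, not on the
basis; the ordered eigenvalues themselves need not be smooth. -/
def redTrace (T : Family s) (y₁ y₂ : ℝ × ℝ × ℝ → Hper s) (p : ℝ × ℝ × ℝ) : ℂ :=
  entry T y₁ 1 p + entry T y₂ (-1) p

def redDet (T : Family s) (y₁ y₂ : ℝ × ℝ × ℝ → Hper s) (p : ℝ × ℝ × ℝ) : ℂ :=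
  entry T y₁ 1 p * entry T y₂ (-1) p - entry T y₂ 1 p * entry T y₁ (-1) p

/-- A smooth family of two-dimensional invariant subspaces near `(0, c₀, 0)`. -/
structure IsReduction (ν c₀ : ℝ) (T : Family s) (m : ℝ) (y₁ y₂ : ℝ × ℝ × ℝ → Hper s) :
    Prop where
  pos : 0 < m
  smooth₁ : ContDiffAt ℝ ∞ y₁ (0, c₀, 0)
  smooth₂ : ContDiffAt ℝ ∞ y₂ (0, c₀, 0)
  reduced : ∀ᶠ p : ℝ × ℝ × ℝ in 𝓝 (0, c₀, 0), IsReduced ν T m p (y₁ p) (y₂ p)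

theorem exists_isReduction (hs : 0 ≤ s) {ν c₀ d : ℝ} {T : Family s} (hP : IsBlochFamily ν c₀ T)
    (h₁ : UnperturbedBands ν c₀ T d) : ∃ m y₁ y₂, IsReduction ν c₀ T m y₁ y₂ := by
  obtain ⟨m, hm, y₁, y₂, hy₁, hy₂, -, -, h⟩ := exists_reduction hs hP h₁
  exact ⟨m, y₁, y₂, hm, hy₁, hy₂, h⟩

theorem contDiffAt_entry {ν c₀ : ℝ} {T : Family s} (hP : IsBlochFamily ν c₀ T)
    {y : ℝ × ℝ × ℝ → Hper s} (hy : ContDiffAt ℝ ∞ y (0, c₀, 0)) (k : ℤ) :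
    ContDiffAt ℝ ∞ (entry T y k) (0, c₀, 0) :=
  contDiffAt_const.inner ℂ ((hP.smooth 0 zero_mem_BZ).complex_clm_apply hy)

theorem IsReduced.eigen_coeff {ν m : ℝ} {T : Family s} {p : ℝ × ℝ × ℝ} {y₁ y₂ : Hper s}
    (h : IsReduced ν T m p y₁ y₂) {w : Hper s} {x₁ x₂ E : ℂ} (hw : w = x₁ • y₁ + x₂ • y₂)
    (he : P ν T p.1 p.2.1 p.2.2 w = E • toL2 w) :
    coeff 1 (T p.1 p.2.1 p.2.2 y₁) * x₁ + coeff 1 (T p.1 p.2.1 p.2.2 y₂) * x₂ = E * x₁ ∧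
    coeff (-1) (T p.1 p.2.1 p.2.2 y₁) * x₁ + coeff (-1) (T p.1 p.2.1 p.2.2 y₂) * x₂ = E * x₂ := by
  rw [hw, map_add, map_add, map_smul, map_smul, map_smul, map_smul, h.eq₁, h.eq₂] at he
  have e1 := congrArg (coeff 1) he
  have e2 := congrArg (coeff (-1)) he
  simp only [coeff_add, coeff_smul, h.coeff₁₁, h.coeff₁₂, h.coeff₂₁, h.coeff₂₂] at e1 e2
  constructor
  · linear_combination e1
  · linear_combination e2

namespace IsReduction
variable {ν c₀ m d : ℝ} {T : Family s} {y₁ y₂ : ℝ × ℝ × ℝ → Hper s}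

theorem contDiffAt_redTrace (h : IsReduction ν c₀ T m y₁ y₂) (hP : IsBlochFamily ν c₀ T) :
    ContDiffAt ℝ ∞ (redTrace T y₁ y₂) (0, c₀, 0) :=
  (contDiffAt_entry hP h.smooth₁ 1).add (contDiffAt_entry hP h.smooth₂ (-1))

theorem contDiffAt_redDet (h : IsReduction ν c₀ T m y₁ y₂) (hP : IsBlochFamily ν c₀ T) :
    ContDiffAt ℝ ∞ (redDet T y₁ y₂) (0, c₀, 0) :=
  ((contDiffAt_entry hP h.smooth₁ 1).mul (contDiffAt_entry hP h.smooth₂ (-1))).sub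
    ((contDiffAt_entry hP h.smooth₂ 1).mul (contDiffAt_entry hP h.smooth₁ (-1)))

theorem areLowestTwo (h : IsReduction ν c₀ T m y₁ y₂) :
    ∀ᶠ p : ℝ × ℝ × ℝ in 𝓝 (0, c₀, 0), ∃ l₁ l₂ : ℝ,
      AreLowestTwo ν T p.1 p.2.1 p.2.2 l₁ l₂ ∧ (l₁ + l₂ : ℂ) = redTrace T y₁ y₂ p ∧
        (l₁ * l₂ : ℂ) = redDet T y₁ y₂ p :=
  h.reduced.mono fun _ hp => hp.areLowestTwo h.pos

/-- Conjugation transfers the two lowest eigenvalues from κ to -κ and they are unique. The matrices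
at ±κ, which refer to different bases, are never compared. -/
theorem even (h : IsReduction ν c₀ T m y₁ y₂) (hP : IsBlochFamily ν c₀ T) :
    ∀ᶠ p : ℝ × ℝ × ℝ in 𝓝 (0, c₀, 0),
      redTrace T y₁ y₂ (p.1, p.2.1, -p.2.2) = redTrace T y₁ y₂ p ∧
      redDet T y₁ y₂ (p.1, p.2.1, -p.2.2) = redDet T y₁ y₂ p := by
  have ht : Tendsto (fun p : ℝ × ℝ × ℝ => (p.1, p.2.1, -p.2.2)) (𝓝 (0, c₀, 0))
      (𝓝 (0, c₀, 0)) := by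
    have : Continuous (fun p : ℝ × ℝ × ℝ => (p.1, p.2.1, -p.2.2)) := by fun_prop
    simpa using this.tendsto (0, c₀, 0)
  have ht2 : Tendsto (fun p : ℝ × ℝ × ℝ => (p.1, p.2.1)) (𝓝 (0, c₀, 0)) (𝓝 (0, c₀)) := by
    have : Continuous (fun p : ℝ × ℝ × ℝ => (p.1, p.2.1)) := by fun_prop
    exact this.tendsto (0, c₀, 0)
  filter_upwards [h.areLowestTwo, ht.eventually h.areLowestTwo, h.reduced,
    ht.eventually h.reduced, ht2.eventually hP.real] with p hp hp' hr hr' hreal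
  obtain ⟨l₁, l₂, hl, htr, hdet⟩ := hp
  obtain ⟨k₁, k₂, hk, htr', hdet'⟩ := hp'
  have hn := hl.neg hr.mem_BZ hreal
  obtain ⟨e1, e2⟩ := hn.unique hr'.selfAdjoint hk
  rw [← htr, ← hdet, ← htr', ← hdet', e1, e2]
  exact ⟨rfl, rfl⟩

/-- At (0, c₀, κ) the modes exp(±iz) are eigenfunctions with eigenvalues below `m`, so they lie in
the invariant subspace. The normalization identifies them with `y₁, y₂`, and the matrix is diagonal
with the two bands as entries. -/
theorem entry_unperturbed (h : IsReduction ν c₀ T m y₁ y₂) (hP : IsBlochFamily ν c₀ T)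
    (h₁ : UnperturbedBands ν c₀ T d) :
    ∀ᶠ κ : ℝ in 𝓝 0, entry T y₁ 1 (0, c₀, κ) = band ν T c₀ 1 κ ∧
      entry T y₁ (-1) (0, c₀, κ) = 0 ∧ entry T y₂ 1 (0, c₀, κ) = 0 ∧
      entry T y₂ (-1) (0, c₀, κ) = band ν T c₀ (-1) κ := by
  have ht : Tendsto (fun κ : ℝ => ((0 : ℝ), c₀, κ)) (𝓝 0) (𝓝 (0, c₀, 0)) := by
    have : Continuous (fun κ : ℝ => ((0 : ℝ), c₀, κ)) := by fun_prop
    exact this.tendsto 0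
  have hbs : ∀ f : ℝ → ℝ, ((fun κ => f κ - 1 / 2 * d * κ ^ 2) =O[𝓝 0] fun κ : ℝ => κ ^ 3) →
      ∀ᶠ κ in 𝓝 0, f κ < m := by
    intro f hf
    have t1 : Tendsto (fun κ : ℝ => κ ^ 3) (𝓝 0) (𝓝 0) := by
      have : Continuous (fun κ : ℝ => κ ^ 3) := by fun_prop
      simpa using this.tendsto 0
    have t2 : Tendsto (fun κ : ℝ => 1 / 2 * d * κ ^ 2) (𝓝 0) (𝓝 0) := by
      have : Continuous (fun κ : ℝ => 1 / 2 * d * κ ^ 2) := by fun_prop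
      simpa using this.tendsto 0
    have t3 := (hf.trans_tendsto t1).add t2
    simp only [sub_add_cancel, add_zero] at t3
    exact t3.eventually_lt_const h.pos
  filter_upwards [ht.eventually h.reduced, hbs _ h₁.convex_one, hbs _ h₁.convex_neg_one]
    with κ hr hb1 hb2
  obtain ⟨t, htt⟩ := exists_symbol hP hr.mem_BZ
  have key : ∀ n : ℤ, n ≠ 0 → band ν T c₀ n κ < m →
      T 0 c₀ κ (modeH s n) = (band ν T c₀ n κ : ℂ) • mode n ∧
      modeH s n = coeff 1 (toL2 (modeH s n)) • y₁ (0, c₀, κ) +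
        coeff (-1) (toL2 (modeH s n)) • y₂ (0, c₀, κ) := by
    intro n hn hb
    have hf : mode n ∈ fibre ν κ := mode_mem_fibre (Or.inr (Or.inr hn))
    have e1 := band_eq hf (htt n)
    rw [if_neg hn, add_zero] at e1
    obtain ⟨r, hr'⟩ := Complex.conj_eq_iff_real.mp
      (coeff_apply_of_diagonal hr.selfAdjoint (htt n)).1
    have e2 : T 0 c₀ κ (modeH s n) = (band ν T c₀ n κ : ℂ) • mode n := by
      rw [e1, hr', Complex.ofReal_re, ← hr', htt]
    refine ⟨e2, hr.eq_of_eigenvector h.pos (w := modeH s n) hf hb ?_⟩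
    change P ν T 0 c₀ κ (modeH s n) = (band ν T c₀ n κ : ℂ) • mode n
    rw [P_apply, e2]
    change fibreProj ν κ (_ + _ • meanProj (mode n)) = _
    rw [meanProj_apply, coeff_mode, if_neg hn.symm, zero_smul, smul_zero, add_zero,
      fibreProj_of_mem (Submodule.smul_mem _ _ hf)]
  obtain ⟨k1, k1'⟩ := key 1 (by norm_num) hb1
  obtain ⟨k2, k2'⟩ := key (-1) (by norm_num) hb2
  have c11 : coeff 1 (toL2 (modeH s 1)) = 1 := (coeff_mode 1 1).trans (if_pos rfl)
  have c21 : coeff (-1) (toL2 (modeH s 1)) = 0 := (coeff_mode (-1) 1).trans (if_neg (by norm_num))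
  have c12 : coeff 1 (toL2 (modeH s (-1))) = 0 := (coeff_mode 1 (-1)).trans (if_neg (by norm_num))
  have c22 : coeff (-1) (toL2 (modeH s (-1))) = 1 := (coeff_mode (-1) (-1)).trans (if_pos rfl)
  rw [c11, c21, one_smul, zero_smul, add_zero] at k1'
  rw [c12, c22, one_smul, zero_smul, zero_add] at k2'
  unfold entry
  simp only [← k1', ← k2', k1, k2, coeff_smul, coeff_mode]
  norm_num

/-- The second derivatives of the entries at the base point. -/
theorem pderiv₃_entry (h : IsReduction ν c₀ T m y₁ y₂) (hP : IsBlochFamily ν c₀ T)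
    (h₁ : UnperturbedBands ν c₀ T d) :
    pderiv₃^[2] (entry T y₁ 1) (0, c₀, 0) = d ∧ pderiv₃^[2] (entry T y₁ (-1)) (0, c₀, 0) = 0 ∧
    pderiv₃^[2] (entry T y₂ 1) (0, c₀, 0) = 0 ∧ pderiv₃^[2] (entry T y₂ (-1)) (0, c₀, 0) = d := by
  have key : ∀ (f : ℝ × ℝ × ℝ → ℂ) (e : ℝ), ContDiffAt ℝ ∞ f (0, c₀, 0) →
      ((fun κ : ℝ => f (0, c₀, κ) - ((1 / 2 * e * κ ^ 2 : ℝ) : ℂ)) =O[𝓝 0] fun κ : ℝ => κ ^ 3) →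
      pderiv₃^[2] f (0, c₀, 0) = e := by
    intro f e hf ho
    rw [pderiv₃_eq_of_isBigO hf 2 ho]
    push_cast [Nat.factorial]
    ring
  have hev := h.entry_unperturbed hP h₁
  have hreal : ∀ f : ℝ → ℝ, ((fun κ => f κ - 1 / 2 * d * κ ^ 2) =O[𝓝 0] fun κ : ℝ => κ ^ 3) →
      ((fun κ => ((f κ : ℝ) : ℂ) - ((1 / 2 * d * κ ^ 2 : ℝ) : ℂ)) =O[𝓝 0] fun κ : ℝ => κ ^ 3) := by
    intro f hf
    refine (Asymptotics.IsBigO.of_bound 1 (Eventually.of_forall fun κ => ?_)).trans hf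
    rw [← Complex.ofReal_sub, Complex.norm_real, one_mul]
  refine ⟨key _ d (contDiffAt_entry hP h.smooth₁ 1) ?_, ?_, ?_,
    key _ d (contDiffAt_entry hP h.smooth₂ (-1)) ?_⟩
  · refine (hreal _ h₁.convex_one).congr' ?_ EventuallyEq.rfl
    filter_upwards [hev] with κ hκ
    rw [hκ.1]
  · have := key (entry T y₁ (-1)) 0 (contDiffAt_entry hP h.smooth₁ (-1)) ?_
    · simpa using this
    · refine (Asymptotics.isBigO_zero _ _).congr' ?_ EventuallyEq.rfl
      filter_upwards [hev] with κ hκ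
      rw [hκ.2.1]; simp
  · have := key (entry T y₂ 1) 0 (contDiffAt_entry hP h.smooth₂ 1) ?_
    · simpa using this
    · refine (Asymptotics.isBigO_zero _ _).congr' ?_ EventuallyEq.rfl
      filter_upwards [hev] with κ hκ
      rw [hκ.2.2.1]; simp
  · refine (hreal _ h₁.convex_neg_one).congr' ?_ EventuallyEq.rfl
    filter_upwards [hev] with κ hκ
    rw [hκ.2.2.2]

end IsReduction
end Bloch

/-! ### Differentiating the invariance relation at κ = 0 -/

theorem HasDerivAt.complex_clm_apply {D F : Type*} [NormedAddCommGroup D] [NormedSpace ℂ D]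
    [NormedAddCommGroup F] [NormedSpace ℂ F] {A : ℝ → D →L[ℂ] F} {A' : D →L[ℂ] F} {w : ℝ → D}
    {w' : D} {x : ℝ} (hA : HasDerivAt A A' x) (hw : HasDerivAt w w' x) :
    HasDerivAt (fun κ => A κ (w κ)) (A' (w x) + A x w') x := by
  have h : HasDerivAt (fun κ => (A κ).restrictScalars ℝ) (A'.restrictScalars ℝ) x :=
    (ContinuousLinearMap.restrictScalarsIsometry ℂ D F ℝ
      ℝ).toContinuousLinearMap.hasFDerivAt.comp_hasDerivAt x hA
  exact h.clm_apply hw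

/-- The right-hand side has a double zero at κ = 0. -/
theorem deriv_eq_zero_of_sq_mul {g h : ℝ → ℂ} {g' : ℂ} {ν : ℝ} (hν : ν ≠ 0)
    (hg : HasDerivAt g g' 0) (hh : DifferentiableAt ℝ h 0)
    (he : ∀ᶠ κ : ℝ in 𝓝 0, (ν : ℂ) * g κ = ((κ : ℝ) : ℂ) ^ 2 * h κ) : g' = 0 := by
  have h1 : HasDerivAt (fun κ => (ν : ℂ) * g κ) ((ν : ℂ) * g') 0 := hg.const_mul _
  have hid : HasDerivAt (fun κ : ℝ => ((κ : ℝ) : ℂ)) 1 0 := (hasDerivAt_id (0 : ℝ)).ofReal_comp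
  have h2 := (hid.pow 2).mul hh.hasDerivAt
  have h3 := h1.unique (h2.congr_of_eventuallyEq he)
  have hν' : (ν : ℂ) ≠ 0 := by exact_mod_cast hν
  have : (ν : ℂ) * g' = 0 := by rw [h3]; simp
  exact (mul_eq_zero.mp this).resolve_left hν'

namespace Bloch
variable {s : ℝ}

theorem hasDerivAt_coeff {f : ℝ → L2per} {f' : L2per} {x : ℝ} (n : ℤ) (hf : HasDerivAt f f' x) :
    HasDerivAt (fun κ => coeff n (f κ)) (coeff n f') x := by
  have := (hasDerivAt_const x (mode n)).inner ℂ hf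
  simpa [coeff] using this

theorem hasDerivAt_toL2 (hs : 0 ≤ s) {u : ℝ → Hper s} {u' : Hper s} {x : ℝ}
    (hu : HasDerivAt u u' x) : HasDerivAt (fun κ => toL2 (u κ)) (toL2 u') x :=
  ((incl hs).restrictScalars ℝ).hasFDerivAt.comp_hasDerivAt x hu

section Curve

variable {ν m a c : ℝ} {T : Family s} {A' : Hper s →L[ℂ] L2per} {u₁ u₂ : ℝ → Hper s}
  {u₁' u₂' : Hper s}

/-- The derivatives at `κ = 0` of a reducing pair lie in the domain of the fibre at `κ = 0`. -/
theorem deriv_mem_dom (hs : 0 ≤ s) (hA : HasDerivAt (fun κ => T a c κ) A' 0)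
    (hu₁ : HasDerivAt u₁ u₁' 0) (hu₂ : HasDerivAt u₂ u₂' 0)
    (h : ∀ᶠ κ in 𝓝 0, IsReduced ν T m (a, c, κ) (u₁ κ) (u₂ κ)) :
    u₁' ∈ dom s ν 0 ∧ u₂' ∈ dom s ν 0 := by
  have key : ∀ (u : ℝ → Hper s) (u' : Hper s), HasDerivAt u u' 0 →
      (∀ᶠ κ in 𝓝 0, u κ ∈ dom s ν κ ∧ P ν T a c κ (u κ) =
        coeff 1 (T a c κ (u κ)) • toL2 (u₁ κ) + coeff (-1) (T a c κ (u κ)) • toL2 (u₂ κ)) →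
      u' ∈ dom s ν 0 := by
    intro u u' hu he
    rw [mem_dom]
    intro hν _
    have hT := hA.complex_clm_apply hu
    -- The zeroth Fourier mode of the invariance relation, multiplied by `κ ^ 2`, expresses ν times
    -- the mean of `u κ` as `κ ^ 2` times a differentiable function.
    refine deriv_eq_zero_of_sq_mul hν (hasDerivAt_coeff 0 (hasDerivAt_toL2 hs hu))
      (h := fun κ => coeff 1 (T a c κ (u κ)) * coeff 0 (toL2 (u₁ κ)) +
        coeff (-1) (T a c κ (u κ)) * coeff 0 (toL2 (u₂ κ)) - coeff 0 (T a c κ (u κ))) ?_ ?_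
    · exact ((((hasDerivAt_coeff 1 hT).mul (hasDerivAt_coeff 0 (hasDerivAt_toL2 hs hu₁))).add
        ((hasDerivAt_coeff (-1) hT).mul (hasDerivAt_coeff 0 (hasDerivAt_toL2 hs hu₂)))).sub
        (hasDerivAt_coeff 0 hT)).differentiableAt
    · filter_upwards [he] with κ hκ
      by_cases h0 : κ = 0
      · rw [mem_dom.mp hκ.1 hν h0, h0]; simp
      · have e := congrArg (coeff 0) hκ.2
        rw [P_apply, fibreProj_of_mem (mem_fibre.mpr fun _ h => absurd h h0), coeff_add, coeff_add,
          coeff_smul, coeff_smul, coeff_smul, coeff_meanProj, if_pos rfl] at e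
        rw [← e]
        have h0' : (κ : ℂ) ≠ 0 := by exact_mod_cast h0
        push_cast
        field_simp
        ring
  exact ⟨key u₁ u₁' hu₁ (h.mono fun κ hκ => ⟨hκ.mem₁, hκ.eq₁⟩),
    key u₂ u₂' hu₂ (h.mono fun κ hκ => ⟨hκ.mem₂, hκ.eq₂⟩)⟩

/-- Extend `w` to `x₁ u₁(κ) + x₂ u₂(κ)`, pair the invariance relation with the fixed eigenvector
`v`, and differentiate. On the left, symmetry of the fibre at 0 moves it onto `v` and produces the
factor `l`, which needs the derivatives of `uᵢ` in the domain. On the right, the undifferentiated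
matrix acts on its eigenvector (x₁, x₂) and produces `E`. -/
theorem inner_deriv_eq (hs : 0 ≤ s) (hA : HasDerivAt (fun κ => T a c κ) A' 0)
    (hu₁ : HasDerivAt u₁ u₁' 0) (hu₂ : HasDerivAt u₂ u₂' 0)
    (h : ∀ᶠ κ in 𝓝 0, IsReduced ν T m (a, c, κ) (u₁ κ) (u₂ κ))
    {b₁₁ b₁₂ b₂₁ b₂₂ : ℂ}
    (h₁₁ : HasDerivAt (fun κ => coeff 1 (T a c κ (u₁ κ))) b₁₁ 0)
    (h₂₁ : HasDerivAt (fun κ => coeff (-1) (T a c κ (u₁ κ))) b₂₁ 0)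
    (h₁₂ : HasDerivAt (fun κ => coeff 1 (T a c κ (u₂ κ))) b₁₂ 0)
    (h₂₂ : HasDerivAt (fun κ => coeff (-1) (T a c κ (u₂ κ))) b₂₂ 0)
    {v w : Hper s} {l : ℝ} {x₁ x₂ E : ℂ} (hv : v ∈ dom s ν 0)
    (hvl : P ν T a c 0 v = (l : ℂ) • toL2 v) (hw : w = x₁ • u₁ 0 + x₂ • u₂ 0)
    (hwE : P ν T a c 0 w = E • toL2 w) :
    inner ℂ (toL2 v) (A' w) + l * inner ℂ (toL2 v) (toL2 (x₁ • u₁' + x₂ • u₂')) =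
      (b₁₁ * x₁ + b₁₂ * x₂) * inner ℂ (toL2 v) (toL2 (u₁ 0)) +
      (b₂₁ * x₁ + b₂₂ * x₂) * inner ℂ (toL2 v) (toL2 (u₂ 0)) +
      E * inner ℂ (toL2 v) (toL2 (x₁ • u₁' + x₂ • u₂')) := by
  obtain ⟨d₁, d₂⟩ := deriv_mem_dom hs hA hu₁ hu₂ h
  have hr := h.self_of_nhds
  have hwd : HasDerivAt (fun κ => x₁ • u₁ κ + x₂ • u₂ κ) (x₁ • u₁' + x₂ • u₂') 0 :=
    (hu₁.const_smul x₁).add (hu₂.const_smul x₂)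
  have hi : ∀ {f : ℝ → L2per} {f' : L2per}, HasDerivAt f f' 0 →
      HasDerivAt (fun κ => inner ℂ (toL2 v) (f κ)) (inner ℂ (toL2 v) f') 0 := by
    intro f f' hf
    simpa using (hasDerivAt_const (0 : ℝ) (toL2 v)).inner ℂ hf
  have hL := hi (hA.complex_clm_apply hwd)
  have hR := (((h₁₁.mul_const x₁).add (h₁₂.mul_const x₂)).mul (hi (hasDerivAt_toL2 hs hu₁))).add
    (((h₂₁.mul_const x₁).add (h₂₂.mul_const x₂)).mul (hi (hasDerivAt_toL2 hs hu₂)))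
  have he := hL.unique (hR.congr_of_eventuallyEq (h.mono fun κ hκ => ?_))
  · obtain ⟨q1, q2⟩ := hr.eigen_coeff hw hwE
    have hd' : x₁ • u₁' + x₂ • u₂' ∈ dom s ν 0 :=
      add_mem (Submodule.smul_mem _ _ d₁) (Submodule.smul_mem _ _ d₂)
    have e1 : inner ℂ (toL2 v) (T a c 0 (x₁ • u₁' + x₂ • u₂')) =
        l * inner ℂ (toL2 v) (toL2 (x₁ • u₁' + x₂ • u₂')) := by
      rw [← inner_P_of_mem_zero hv, ← P_symm hr.selfAdjoint hv hd', hvl, inner_smul_left,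
        Complex.conj_ofReal]
    rw [inner_add_right, e1, ← hw] at he
    simp only at q1 q2
    simp only [Pi.add_apply] at he
    rw [he, q1, q2]
    simp only [map_add, map_smul, inner_add_right, inner_smul_right]
    ring
  · change inner ℂ (toL2 v) (T a c κ (x₁ • u₁ κ + x₂ • u₂ κ)) =
      (coeff 1 (T a c κ (u₁ κ)) * x₁ + coeff 1 (T a c κ (u₂ κ)) * x₂) *
        inner ℂ (toL2 v) (toL2 (u₁ κ)) +
      (coeff (-1) (T a c κ (u₁ κ)) * x₁ + coeff (-1) (T a c κ (u₂ κ)) * x₂) *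
        inner ℂ (toL2 v) (toL2 (u₂ κ))
    have k1 := hκ.eq₁
    have k2 := hκ.eq₂
    simp only at k1 k2
    rw [← inner_P_of_mem_zero hv, map_add, map_smul, map_smul, k1, k2]
    simp only [inner_add_right, inner_smul_right]
    ring

end Curve

theorem inner_dP {ν : ℝ} {T : Family s} {a c : ℝ} {v : L2per} (hv : v ∈ fibre ν 0) (w : Hper s) :
    inner ℂ v (dP ν T a c w) = inner ℂ v (deriv (fun κ => T a c κ) 0 w) := by
  change inner ℂ v (fibreProj ν 0 _) = _
  rw [← inner_fibreProj, fibreProj_of_mem hv]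
  rfl

end Bloch

/-! ### Product rules and order estimates in the parameters (a, c) -/

theorem pderiv₃_congr {F : Type*} [NormedAddCommGroup F] [NormedSpace ℝ F] {f g : ℝ × ℝ × ℝ → F}
    {p : ℝ × ℝ × ℝ} (h : f =ᶠ[𝓝 p] g) : pderiv₃ f =ᶠ[𝓝 p] pderiv₃ g :=
  (h.fderiv (𝕜 := ℝ)).mono fun q hq => by simp only [pderiv₃, hq]

theorem eventually_pderiv₃_mul {f g : ℝ × ℝ × ℝ → ℂ} {p : ℝ × ℝ × ℝ} (hf : ContDiffAt ℝ ∞ f p)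
    (hg : ContDiffAt ℝ ∞ g p) :
    pderiv₃ (fun q => f q * g q) =ᶠ[𝓝 p] fun q => pderiv₃ f q * g q + f q * pderiv₃ g q := by
  filter_upwards [hf.eventually_differentiableAt, hg.eventually_differentiableAt] with q h1 h2
  simp only [pderiv₃, fderiv_fun_mul h1 h2]
  simp
  ring

theorem eventually_pderiv₃_add {f g : ℝ × ℝ × ℝ → ℂ} {p : ℝ × ℝ × ℝ} (hf : ContDiffAt ℝ ∞ f p)
    (hg : ContDiffAt ℝ ∞ g p) :
    pderiv₃ (fun q => f q + g q) =ᶠ[𝓝 p] fun q => pderiv₃ f q + pderiv₃ g q := by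
  filter_upwards [hf.eventually_differentiableAt, hg.eventually_differentiableAt] with q h1 h2
  simp only [pderiv₃, fderiv_fun_add h1 h2]
  simp

theorem eventually_pderiv₃_sub {f g : ℝ × ℝ × ℝ → ℂ} {p : ℝ × ℝ × ℝ} (hf : ContDiffAt ℝ ∞ f p)
    (hg : ContDiffAt ℝ ∞ g p) :
    pderiv₃ (fun q => f q - g q) =ᶠ[𝓝 p] fun q => pderiv₃ f q - pderiv₃ g q := by
  filter_upwards [hf.eventually_differentiableAt, hg.eventually_differentiableAt] with q h1 h2
  simp only [pderiv₃, fderiv_fun_sub h1 h2]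
  simp

theorem eventually_pderiv₃_two_add {f g : ℝ × ℝ × ℝ → ℂ} {p : ℝ × ℝ × ℝ}
    (hf : ContDiffAt ℝ ∞ f p) (hg : ContDiffAt ℝ ∞ g p) :
    pderiv₃^[2] (fun q => f q + g q) =ᶠ[𝓝 p] fun q => pderiv₃^[2] f q + pderiv₃^[2] g q :=
  (pderiv₃_congr (eventually_pderiv₃_add hf hg)).trans (eventually_pderiv₃_add hf.pderiv₃ hg.pderiv₃)

theorem eventually_pderiv₃_two_sub {f g : ℝ × ℝ × ℝ → ℂ} {p : ℝ × ℝ × ℝ}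
    (hf : ContDiffAt ℝ ∞ f p) (hg : ContDiffAt ℝ ∞ g p) :
    pderiv₃^[2] (fun q => f q - g q) =ᶠ[𝓝 p] fun q => pderiv₃^[2] f q - pderiv₃^[2] g q :=
  (pderiv₃_congr (eventually_pderiv₃_sub hf hg)).trans (eventually_pderiv₃_sub hf.pderiv₃ hg.pderiv₃)

theorem eventually_pderiv₃_two_mul {f g : ℝ × ℝ × ℝ → ℂ} {p : ℝ × ℝ × ℝ}
    (hf : ContDiffAt ℝ ∞ f p) (hg : ContDiffAt ℝ ∞ g p) :
    pderiv₃^[2] (fun q => f q * g q) =ᶠ[𝓝 p] fun q =>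
      pderiv₃^[2] f q * g q + 2 * (pderiv₃ f q * pderiv₃ g q) + f q * pderiv₃^[2] g q := by
  refine (pderiv₃_congr (eventually_pderiv₃_mul hf hg)).trans ?_
  refine (eventually_pderiv₃_add (hf.pderiv₃.mul hg) (hf.mul hg.pderiv₃)).trans ?_
  filter_upwards [eventually_pderiv₃_mul hf.pderiv₃ hg, eventually_pderiv₃_mul hf hg.pderiv₃]
    with q h1 h2
  change pderiv₃ (fun q => pderiv₃ f q * g q) q + pderiv₃ (fun q => f q * pderiv₃ g q) q = _
  rw [h1, h2]
  simp only [Function.iterate_succ, Function.iterate_zero, Function.comp_apply, id]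
  ring

/-- The distance from `(0, c₀)` in the parameter plane. -/
def paramDist (c₀ : ℝ) (p : ℝ × ℝ) : ℝ := |p.1| + |p.2 - c₀|

/-- Parameters near `(0, c₀)` with nonzero first coordinate. -/
def paramFilter (c₀ : ℝ) : Filter (ℝ × ℝ) := 𝓝 (0, c₀) ⊓ 𝓟 {p | p.1 ≠ 0}

theorem eventually_paramFilter {c₀ : ℝ} {Q : ℝ × ℝ → Prop} :
    (∀ᶠ p in paramFilter c₀, Q p) ↔ ∀ᶠ p in 𝓝 (0, c₀), p.1 ≠ 0 → Q p :=
  eventually_inf_principal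

theorem paramFilter_le (c₀ : ℝ) : paramFilter c₀ ≤ 𝓝 (0, c₀) := inf_le_left

theorem paramDist_nonneg (c₀ : ℝ) (p : ℝ × ℝ) : 0 ≤ paramDist c₀ p := by
  unfold paramDist; positivity

theorem tendsto_paramDist (c₀ : ℝ) : Tendsto (paramDist c₀) (paramFilter c₀) (𝓝 0) := by
  have : Continuous (paramDist c₀) := by unfold paramDist; fun_prop
  have h := this.tendsto (0, c₀)
  simp only [paramDist, abs_zero, sub_self, add_zero] at h
  exact h.mono_left (paramFilter_le c₀)

theorem isBigO_paramDist_one (c₀ : ℝ) :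
    paramDist c₀ =O[paramFilter c₀] fun _ => (1 : ℝ) :=
  (tendsto_paramDist c₀).isBigO_one ℝ

theorem isBigO_paramDist_pow (c₀ : ℝ) {i j : ℕ} (h : j ≤ i) :
    (fun p => paramDist c₀ p ^ i) =O[paramFilter c₀] fun p => paramDist c₀ p ^ j := by
  obtain ⟨k, rfl⟩ := Nat.exists_eq_add_of_le h
  have h1 := (Asymptotics.isBigO_refl (fun p => paramDist c₀ p ^ j) (paramFilter c₀)).mul
    ((isBigO_paramDist_one c₀).pow k)
  simpa [pow_add] using h1

theorem isBigO_fst_paramDist (c₀ : ℝ) :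
    (fun p : ℝ × ℝ => p.1) =O[paramFilter c₀] paramDist c₀ := by
  refine Asymptotics.IsBigO.of_bound 1 (Eventually.of_forall fun p => ?_)
  rw [Real.norm_eq_abs, Real.norm_of_nonneg (paramDist_nonneg _ _), one_mul]
  unfold paramDist
  linarith [abs_nonneg (p.2 - c₀)]

theorem isBigO_snd_paramDist (c₀ : ℝ) :
    (fun p : ℝ × ℝ => p.2 - c₀) =O[paramFilter c₀] paramDist c₀ := by
  refine Asymptotics.IsBigO.of_bound 1 (Eventually.of_forall fun p => ?_)
  rw [Real.norm_eq_abs, Real.norm_of_nonneg (paramDist_nonneg _ _), one_mul]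
  unfold paramDist
  linarith [abs_nonneg p.1]

theorem isBigO_sub_paramDist {F : Type*} [NormedAddCommGroup F] [NormedSpace ℝ F] {c₀ : ℝ}
    {f : ℝ × ℝ × ℝ → F} (hf : ContDiffAt ℝ ∞ f (0, c₀, 0)) :
    (fun p : ℝ × ℝ => f (p.1, p.2, 0) - f (0, c₀, 0)) =O[paramFilter c₀] paramDist c₀ := by
  obtain ⟨M, hM, r, hr, h⟩ := exists_lipschitz_first_two hf
  refine Asymptotics.IsBigO.of_bound M (Eventually.filter_mono (paramFilter_le c₀) ?_)
  rw [eventually_nhds_pair_iff]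
  refine ⟨r, hr, fun a c ha hc => ?_⟩
  rw [Real.norm_of_nonneg (paramDist_nonneg _ _)]
  exact h a c ha hc

theorem isBigO_one_of_sub {F : Type*} [NormedAddCommGroup F] {c₀ : ℝ}
    {f : ℝ × ℝ → F} {x : F} (hf : (fun p => f p - x) =O[paramFilter c₀] paramDist c₀) :
    f =O[paramFilter c₀] fun _ => (1 : ℝ) := by
  have h := (hf.trans (isBigO_paramDist_one c₀)).add (Asymptotics.isBigO_const_const x
    (one_ne_zero : (1 : ℝ) ≠ 0) (paramFilter c₀))
  simpa using h

theorem tendsto_of_isBigO_sub {F : Type*} [NormedAddCommGroup F] {c₀ : ℝ}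
    {f : ℝ × ℝ → F} {x : F} (hf : (fun p => f p - x) =O[paramFilter c₀] paramDist c₀) :
    Tendsto f (paramFilter c₀) (𝓝 x) := by
  have h := hf.trans_tendsto (tendsto_paramDist c₀)
  simpa using h.add_const x

theorem Asymptotics.IsBigO.complex_inner {α H : Type*} [NormedAddCommGroup H]
    [InnerProductSpace ℂ H] {l : Filter α} {f g : α → H} {u v : α → ℝ} (hf : f =O[l] u)
    (hg : g =O[l] v) : (fun x => (inner ℂ (f x) (g x) : ℂ)) =O[l] fun x => u x * v x := by
  refine Asymptotics.IsBigO.trans ?_ (hf.norm_left.mul hg.norm_left)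
  refine Asymptotics.IsBigO.of_bound 1 (Eventually.of_forall fun x => ?_)
  rw [one_mul, norm_mul, _root_.norm_norm, _root_.norm_norm]
  exact norm_inner_le_norm _ _

/-- If `u = u₀ + O(ε)`, `X = r x₀ + b F + O(ε²)` with `r, b = O(ε)` and `F` bounded and orthogonal
to `u₀`, then `⟨u, X⟩ = r ⟨u₀, x₀⟩ + O(ε²)`. -/
theorem isBigO_inner_sub {H : Type*} [NormedAddCommGroup H] [InnerProductSpace ℂ H] {c₀ : ℝ}
    {u X F : ℝ × ℝ → H} {u₀ x₀ : H} {r b : ℝ × ℝ → ℂ}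
    (hu : (fun p => u p - u₀) =O[paramFilter c₀] paramDist c₀)
    (hr : r =O[paramFilter c₀] paramDist c₀) (hb : b =O[paramFilter c₀] paramDist c₀)
    (hF : F =O[paramFilter c₀] fun _ => (1 : ℝ))
    (ho : ∀ᶠ p in paramFilter c₀, (inner ℂ u₀ (F p) : ℂ) = 0)
    (hX : (fun p => X p - (r p • x₀ + b p • F p)) =O[paramFilter c₀]
      fun p => paramDist c₀ p ^ 2) :
    (fun p => inner ℂ (u p) (X p) - r p * inner ℂ u₀ x₀) =O[paramFilter c₀]
      fun p => paramDist c₀ p ^ 2 := by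
  have h1 := (isBigO_one_of_sub hu).complex_inner hX
  have h2 : (fun p => r p • x₀ + b p • F p) =O[paramFilter c₀] paramDist c₀ := by
    have e1 := hr.smul (Asymptotics.isBigO_const_const x₀ (one_ne_zero : (1 : ℝ) ≠ 0)
      (paramFilter c₀))
    have e2 := hb.smul hF
    simpa using e1.add e2
  have h3 := hu.complex_inner h2
  simp only [one_mul, ← pow_two] at h1 h3
  refine (h1.add h3).congr' ?_ EventuallyEq.rfl
  filter_upwards [ho] with p hp
  simp only [inner_sub_left, inner_sub_right, inner_add_right, inner_smul_right, hp]
  ring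

/-! ### The eigenfunctions W and V paired with P'(0) -/

namespace Bloch
variable {s : ℝ}

theorem coeff_sinF (n : ℤ) : coeff n sinF =
    1 / (2 * Complex.I) * ((if n = 1 then 1 else 0) - if n = -1 then 1 else 0) := by
  rw [sinF, coeff_smul, coeff_sub, coeff_mode, coeff_mode]

theorem coeff_cosF (n : ℤ) : coeff n cosF =
    1 / 2 * ((if n = 1 then 1 else 0) + if n = -1 then 1 else 0) := by
  rw [cosF, coeff_smul, coeff_add, coeff_mode, coeff_mode]

theorem inner_sinF_left (f : L2per) :
    inner ℂ sinF f = -(1 / (2 * Complex.I)) * (coeff 1 f - coeff (-1) f) := by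
  rw [sinF, inner_smul_left, inner_sub_left]
  simp [coeff, map_ofNat (starRingEnd ℂ) 2]

theorem inner_cosF_left (f : L2per) :
    inner ℂ cosF f = 1 / 2 * (coeff 1 f + coeff (-1) f) := by
  rw [cosF, inner_smul_left, inner_add_left]
  simp [coeff, map_ofNat (starRingEnd ℂ) 2]

theorem inner_sinF_sinF : inner ℂ sinF sinF = (1 / 2 : ℂ) := by
  rw [inner_sinF_left, coeff_sinF, coeff_sinF]
  norm_num
  linear_combination (-1 / 2 : ℂ) * Complex.I_mul_I

theorem inner_cosF_cosF : inner ℂ cosF cosF = (1 / 2 : ℂ) := by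
  rw [inner_cosF_left, coeff_cosF, coeff_cosF]
  norm_num

theorem inner_sinF_cosF : inner ℂ sinF cosF = (0 : ℂ) := by
  rw [inner_sinF_left, coeff_cosF, coeff_cosF]
  norm_num

theorem inner_cosF_sinF : inner ℂ cosF sinF = (0 : ℂ) := by
  rw [inner_cosF_left, coeff_sinF, coeff_sinF]
  norm_num

theorem inner_sinF_of_even {f : L2per} (h : IsEvenF f) : inner ℂ sinF f = (0 : ℂ) := by
  rw [inner_sinF_left, coeff_neg_of_even h, sub_self, mul_zero]

theorem inner_cosF_of_odd {f : L2per} (h : IsOddF f) : inner ℂ cosF f = (0 : ℂ) := by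
  rw [inner_cosF_left, coeff_neg_of_odd h, add_neg_cancel, mul_zero]

variable {ν c₀ d μ m : ℝ} {T : Family s} {lam2 : ℝ → ℝ} {lam : ℝ → ℝ → ℝ} {W : ℝ → Hper s}
  {V : ℝ → ℝ → Hper s}

namespace SplitEigenvalues

theorem isBigO_lam (h₂ : SplitEigenvalues ν c₀ T lam2 lam W V) :
    (fun p : ℝ × ℝ => (lam p.1 p.2 : ℂ)) =O[paramFilter c₀] fun p => paramDist c₀ p ^ 2 := by
  obtain ⟨M, hM⟩ := h₂.lam_expansion
  have e1 : (fun p : ℝ × ℝ => lam p.1 p.2 - lam2 p.2 * p.1 ^ 2) =O[paramFilter c₀]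
      fun p => paramDist c₀ p ^ 2 := by
    have h3 : (fun p : ℝ × ℝ => lam p.1 p.2 - lam2 p.2 * p.1 ^ 2) =O[paramFilter c₀]
        fun p => p.1 ^ 3 := by
      refine Asymptotics.IsBigO.of_bound M ?_
      filter_upwards [eventually_paramFilter.mpr hM] with p hp
      simpa using hp
    exact (h3.trans ((isBigO_fst_paramDist c₀).pow 3)).trans (isBigO_paramDist_pow c₀ (by norm_num))
  have ht : Tendsto (fun p : ℝ × ℝ => lam2 p.2) (paramFilter c₀) (𝓝 (lam2 c₀)) := by
    have : Tendsto (fun p : ℝ × ℝ => p.2) (𝓝 (0, c₀)) (𝓝 c₀) := continuous_snd.tendsto (0, c₀)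
    exact h₂.lam2_smooth.continuousAt.tendsto.comp (this.mono_left (paramFilter_le c₀))
  have e2 := (ht.isBigO_one ℝ).mul ((isBigO_fst_paramDist c₀).pow 2)
  simp only [one_mul] at e2
  have e3 := e1.add e2
  simp only [sub_add_cancel] at e3
  exact (Complex.isBigO_ofReal_left).mpr e3

theorem isBigO_W (h₂ : SplitEigenvalues ν c₀ T lam2 lam W V) :
    (fun p : ℝ × ℝ => toL2 (W p.1) - sinF) =O[paramFilter c₀] paramDist c₀ := by
  obtain ⟨M, hM⟩ := h₂.W_expansion
  have ht : Tendsto (fun p : ℝ × ℝ => p.1) (𝓝 (0, c₀)) (𝓝 0) := continuous_fst.tendsto (0, c₀)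
  refine (Asymptotics.IsBigO.of_bound M ?_).trans (isBigO_fst_paramDist c₀)
  exact eventually_paramFilter.mpr (ht.eventually hM)

theorem isBigO_V (h₂ : SplitEigenvalues ν c₀ T lam2 lam W V) :
    (fun p : ℝ × ℝ => toL2 (V p.1 p.2) - cosF) =O[paramFilter c₀] paramDist c₀ := by
  obtain ⟨M, hM⟩ := h₂.V_expansion
  refine (Asymptotics.IsBigO.of_bound M ?_).trans (isBigO_fst_paramDist c₀)
  exact eventually_paramFilter.mpr hM

end SplitEigenvalues

theorem isBigO_coeff_sub {f : ℝ × ℝ → L2per} {x : L2per} (n : ℤ)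
    (hf : (fun p => f p - x) =O[paramFilter c₀] paramDist c₀) :
    (fun p => coeff n (f p) - coeff n x) =O[paramFilter c₀] paramDist c₀ := by
  have h := (Asymptotics.isBigO_const_const (mode n) (one_ne_zero : (1 : ℝ) ≠ 0)
    (paramFilter c₀)).complex_inner hf
  simp only [inner_sub_right, one_mul] at h
  exact h

/-- The second-order parts of the pairings of the eigenfunctions with `P'(0)`. -/
theorem isBigO_inner_dP (h₂ : SplitEigenvalues ν c₀ T lam2 lam W V)
    (h₃ : NonDegenerate ν c₀ T W V μ) :
    ((fun p : ℝ × ℝ => inner ℂ (toL2 (W p.1)) (dP ν T p.1 p.2 (W p.1))) =O[paramFilter c₀]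
      fun p => paramDist c₀ p ^ 2) ∧
    ((fun p : ℝ × ℝ => inner ℂ (toL2 (V p.1 p.2)) (dP ν T p.1 p.2 (W p.1)) +
      Complex.I * μ * (p.2 - c₀) / 2) =O[paramFilter c₀] fun p => paramDist c₀ p ^ 2) ∧
    ((fun p : ℝ × ℝ => inner ℂ (toL2 (W p.1)) (dP ν T p.1 p.2 (V p.1 p.2)) -
      Complex.I * μ * (p.2 - c₀) / 2) =O[paramFilter c₀] fun p => paramDist c₀ p ^ 2) ∧
    ((fun p : ℝ × ℝ => inner ℂ (toL2 (V p.1 p.2)) (dP ν T p.1 p.2 (V p.1 p.2))) =O[paramFilter c₀]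
      fun p => paramDist c₀ p ^ 2) := by
  obtain ⟨F, M, hF, hX⟩ := h₃.expansion_W
  obtain ⟨G, N, hG, hY⟩ := h₃.expansion_V
  have ht : Tendsto (fun p : ℝ × ℝ => p.2) (paramFilter c₀) (𝓝 c₀) :=
    (continuous_snd.tendsto (0, c₀)).mono_left (paramFilter_le c₀)
  have hF' := ht.eventually hF
  have hG' := ht.eventually hG
  have hr : (fun p : ℝ × ℝ => Complex.I * μ * ((p.2 : ℂ) - c₀)) =O[paramFilter c₀]
      paramDist c₀ := by
    refine Asymptotics.IsBigO.const_mul_left ?_ _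
    have := Complex.isBigO_ofReal_left.mpr (isBigO_snd_paramDist c₀)
    simpa using this
  have hb : (fun p : ℝ × ℝ => (p.1 : ℂ)) =O[paramFilter c₀] paramDist c₀ :=
    Complex.isBigO_ofReal_left.mpr (isBigO_fst_paramDist c₀)
  have hF1 : (fun p : ℝ × ℝ => F p.2) =O[paramFilter c₀] fun _ => (1 : ℝ) := by
    refine Asymptotics.IsBigO.of_bound M (hF'.mono fun p hp => ?_)
    simpa using hp.2.2
  have hG1 : (fun p : ℝ × ℝ => G p.2) =O[paramFilter c₀] fun _ => (1 : ℝ) := by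
    refine Asymptotics.IsBigO.of_bound N (hG'.mono fun p hp => ?_)
    simpa using hp.2.2
  have sq : (fun p : ℝ × ℝ => p.1 ^ 2) =O[paramFilter c₀] fun p => paramDist c₀ p ^ 2 :=
    (isBigO_fst_paramDist c₀).pow 2
  have hX' : (fun p : ℝ × ℝ => dP ν T p.1 p.2 (W p.1) -
      ((-(Complex.I * μ * ((p.2 : ℂ) - c₀))) • cosF + (p.1 : ℂ) • F p.2)) =O[paramFilter c₀]
      fun p => paramDist c₀ p ^ 2 := by
    refine (Asymptotics.IsBigO.of_bound M ?_).trans sq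
    filter_upwards [eventually_paramFilter.mpr hX] with p hp
    simpa using hp
  have hY' : (fun p : ℝ × ℝ => dP ν T p.1 p.2 (V p.1 p.2) -
      ((Complex.I * μ * ((p.2 : ℂ) - c₀)) • sinF + (p.1 : ℂ) • G p.2)) =O[paramFilter c₀]
      fun p => paramDist c₀ p ^ 2 := by
    refine (Asymptotics.IsBigO.of_bound N ?_).trans sq
    filter_upwards [eventually_paramFilter.mpr hY] with p hp
    simpa using hp
  -- In the two diagonal pairings the terms `a F` drop out at leading order by parity, in the two
  -- off-diagonal ones by the assumed orthogonality to `cos` and `sin`.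
  refine ⟨?_, ?_, ?_, ?_⟩
  · have := isBigO_inner_sub h₂.isBigO_W hr.neg_left hb hF1
      (hF'.mono fun p hp => inner_sinF_of_even hp.1) hX'
    simpa only [inner_sinF_cosF, mul_zero, sub_zero] using this
  · have := isBigO_inner_sub h₂.isBigO_V hr.neg_left hb hF1 (hF'.mono fun p hp => hp.2.1) hX'
    refine this.congr_left fun p => ?_
    rw [inner_cosF_cosF]; ring
  · have := isBigO_inner_sub h₂.isBigO_W hr hb hG1 (hG'.mono fun p hp => hp.2.1) hY'
    refine this.congr_left fun p => ?_
    rw [inner_sinF_sinF]; ring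
  · have := isBigO_inner_sub h₂.isBigO_V hr hb hG1
      (hG'.mono fun p hp => inner_cosF_of_odd hp.1) hY'
    simpa only [inner_cosF_sinF, mul_zero, sub_zero] using this

end Bloch

/-! ### The reduced matrix at κ = 0 -/

namespace Bloch
variable {s : ℝ}

namespace IsReduction
variable {ν c₀ d μ m : ℝ} {T : Family s} {y₁ y₂ : ℝ × ℝ × ℝ → Hper s} {lam2 : ℝ → ℝ}
  {lam : ℝ → ℝ → ℝ} {W : ℝ → Hper s} {V : ℝ → ℝ → Hper s}

theorem reduced_paramFilter (h : IsReduction ν c₀ T m y₁ y₂) :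
    ∀ᶠ p in paramFilter c₀, ∀ᶠ κ in 𝓝 (0 : ℝ),
      IsReduced ν T m (p.1, p.2, κ) (y₁ (p.1, p.2, κ)) (y₂ (p.1, p.2, κ)) := by
  refine Eventually.filter_mono (paramFilter_le c₀) ?_
  obtain ⟨r, hr, hh⟩ := eventually_nhds_triple_iff.mp h.reduced
  refine eventually_nhds_pair_iff.mpr ⟨r, hr, fun a c ha hc => ?_⟩
  filter_upwards [Metric.ball_mem_nhds (0 : ℝ) hr] with κ hκ
  exact hh a c κ ha hc (by simpa using hκ)

/-- An eigenfunction with eigenvalue below `m` lies in the invariant subspace. This is how W, and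
likewise V, becomes an eigenvector of the reduced matrix. -/
theorem eq_W (h : IsReduction ν c₀ T m y₁ y₂) (h₂ : SplitEigenvalues ν c₀ T lam2 lam W V) :
    ∀ᶠ p in paramFilter c₀, W p.1 = coeff 1 (toL2 (W p.1)) • y₁ (p.1, p.2, 0) +
      coeff (-1) (toL2 (W p.1)) • y₂ (p.1, p.2, 0) := by
  filter_upwards [h.reduced_paramFilter, eventually_paramFilter.mpr h₂.eigen_W] with p hr hw
  refine hr.self_of_nhds.eq_of_eigenvector h.pos hw.1 (E := 0) h.pos ?_
  simpa using hw.2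

theorem eq_V (h : IsReduction ν c₀ T m y₁ y₂) (h₂ : SplitEigenvalues ν c₀ T lam2 lam W V) :
    ∀ᶠ p in paramFilter c₀, V p.1 p.2 = coeff 1 (toL2 (V p.1 p.2)) • y₁ (p.1, p.2, 0) +
      coeff (-1) (toL2 (V p.1 p.2)) • y₂ (p.1, p.2, 0) := by
  have hl : ∀ᶠ p in paramFilter c₀, lam p.1 p.2 < m := by
    have h0 := (tendsto_paramDist c₀).pow 2
    rw [zero_pow two_ne_zero] at h0
    have h1 := h₂.isBigO_lam.trans_tendsto h0
    have h2 := (Complex.continuous_re.tendsto 0).comp h1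
    exact h2.eventually_lt_const h.pos
  filter_upwards [h.reduced_paramFilter, eventually_paramFilter.mpr h₂.eigen_V, hl] with p hr hw hl
  exact hr.self_of_nhds.eq_of_eigenvector h.pos hw.1 hl hw.2

/-- The equations for the entries at `κ = 0` given by the two eigenvectors. -/
theorem entry_zero (h : IsReduction ν c₀ T m y₁ y₂)
    (h₂ : SplitEigenvalues ν c₀ T lam2 lam W V) :
    ∀ᶠ p in paramFilter c₀,
      (entry T y₁ 1 (p.1, p.2, 0) * coeff 1 (toL2 (W p.1)) +
        entry T y₂ 1 (p.1, p.2, 0) * coeff (-1) (toL2 (W p.1)) = 0 ∧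
      entry T y₁ (-1) (p.1, p.2, 0) * coeff 1 (toL2 (W p.1)) +
        entry T y₂ (-1) (p.1, p.2, 0) * coeff (-1) (toL2 (W p.1)) = 0) ∧
      (entry T y₁ 1 (p.1, p.2, 0) * coeff 1 (toL2 (V p.1 p.2)) +
        entry T y₂ 1 (p.1, p.2, 0) * coeff (-1) (toL2 (V p.1 p.2)) =
          lam p.1 p.2 * coeff 1 (toL2 (V p.1 p.2)) ∧
      entry T y₁ (-1) (p.1, p.2, 0) * coeff 1 (toL2 (V p.1 p.2)) +
        entry T y₂ (-1) (p.1, p.2, 0) * coeff (-1) (toL2 (V p.1 p.2)) =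
          lam p.1 p.2 * coeff (-1) (toL2 (V p.1 p.2))) := by
  filter_upwards [h.reduced_paramFilter, h.eq_W h₂, h.eq_V h₂,
    eventually_paramFilter.mpr h₂.eigen_V, eventually_paramFilter.mpr h₂.eigen_W] with p hr h3 h4
    hv hw
  have e1 := hr.self_of_nhds.eigen_coeff h3 (E := 0) (by rw [zero_smul]; exact hw.2)
  have e2 := hr.self_of_nhds.eigen_coeff h4 hv.2
  rw [zero_mul, zero_mul] at e1
  exact ⟨e1, e2⟩

/-- The determinant of the coefficients of the two eigenvectors. -/
theorem tendsto_frame (h₂ : SplitEigenvalues ν c₀ T lam2 lam W V) :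
    Tendsto (fun p : ℝ × ℝ => coeff 1 (toL2 (W p.1)) * coeff (-1) (toL2 (V p.1 p.2)) -
      coeff (-1) (toL2 (W p.1)) * coeff 1 (toL2 (V p.1 p.2))) (paramFilter c₀)
      (𝓝 (1 / (2 * Complex.I))) := by
  have hW := fun n => tendsto_of_isBigO_sub (isBigO_coeff_sub n h₂.isBigO_W)
  have hV := fun n => tendsto_of_isBigO_sub (isBigO_coeff_sub n h₂.isBigO_V)
  have h := ((hW 1).mul (hV (-1))).sub ((hW (-1)).mul (hV 1))
  simp only [coeff_sinF, coeff_cosF] at h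
  convert h using 2
  norm_num
  ring

theorem frame_limit_ne_zero : (1 / (2 * Complex.I) : ℂ) ≠ 0 := by simp

/-- At `κ = 0` the eigenvalues of the reduced matrix are `0` and `lam`. -/
theorem redTrace_redDet_zero (h : IsReduction ν c₀ T m y₁ y₂)
    (h₂ : SplitEigenvalues ν c₀ T lam2 lam W V) :
    ∀ᶠ p in paramFilter c₀, redTrace T y₁ y₂ (p.1, p.2, 0) = lam p.1 p.2 ∧
      redDet T y₁ y₂ (p.1, p.2, 0) = 0 := by
  filter_upwards [h.entry_zero h₂, (tendsto_frame h₂).eventually_ne frame_limit_ne_zero]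
    with p ⟨⟨e1, e2⟩, e3, e4⟩ hΔ
  unfold redTrace redDet
  generalize entry T y₁ 1 (p.1, p.2, 0) = b₁₁ at *
  generalize entry T y₂ 1 (p.1, p.2, 0) = b₁₂ at *
  generalize entry T y₁ (-1) (p.1, p.2, 0) = b₂₁ at *
  generalize entry T y₂ (-1) (p.1, p.2, 0) = b₂₂ at *
  generalize coeff 1 (toL2 (W p.1)) = α₁ at *
  generalize coeff (-1) (toL2 (W p.1)) = α₂ at *
  generalize coeff 1 (toL2 (V p.1 p.2)) = β₁ at *
  generalize coeff (-1) (toL2 (V p.1 p.2)) = β₂ at *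
  constructor
  · refine mul_right_cancel₀ hΔ ?_
    linear_combination β₂ * e1 - β₁ * e2 - α₂ * e3 + α₁ * e4
  · refine mul_right_cancel₀ hΔ ?_
    rw [zero_mul]
    linear_combination (b₂₁ * β₁ + b₂₂ * β₂) * e1 - (b₁₁ * β₁ + b₁₂ * β₂) * e2

theorem isBigO_entry (h : IsReduction ν c₀ T m y₁ y₂)
    (h₂ : SplitEigenvalues ν c₀ T lam2 lam W V) :
    ((fun p : ℝ × ℝ => entry T y₁ 1 (p.1, p.2, 0)) =O[paramFilter c₀]
      fun p => paramDist c₀ p ^ 2) ∧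
    ((fun p : ℝ × ℝ => entry T y₁ (-1) (p.1, p.2, 0)) =O[paramFilter c₀]
      fun p => paramDist c₀ p ^ 2) ∧
    ((fun p : ℝ × ℝ => entry T y₂ 1 (p.1, p.2, 0)) =O[paramFilter c₀]
      fun p => paramDist c₀ p ^ 2) ∧
    ((fun p : ℝ × ℝ => entry T y₂ (-1) (p.1, p.2, 0)) =O[paramFilter c₀]
      fun p => paramDist c₀ p ^ 2) := by
  have hΔ := ((tendsto_frame h₂).inv₀ frame_limit_ne_zero).isBigO_one ℝ
  have hW := fun n => isBigO_one_of_sub (isBigO_coeff_sub n h₂.isBigO_W)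
  have hV := fun n => isBigO_one_of_sub (isBigO_coeff_sub n h₂.isBigO_V)
  -- The reduced matrix kills W and multiplies V by λ, so it is λ times the projection onto V along
  -- W. Its entries are, up to sign, these products over the determinant of the frame, which stays
  -- away from zero.
  have key : ∀ i j : ℤ, (fun p : ℝ × ℝ => lam p.1 p.2 * coeff i (toL2 (V p.1 p.2)) *
      coeff j (toL2 (W p.1)) * (coeff 1 (toL2 (W p.1)) * coeff (-1) (toL2 (V p.1 p.2)) -
      coeff (-1) (toL2 (W p.1)) * coeff 1 (toL2 (V p.1 p.2)))⁻¹) =O[paramFilter c₀]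
      fun p => paramDist c₀ p ^ 2 := by
    intro i j
    have := ((h₂.isBigO_lam.mul (hV i)).mul (hW j)).mul hΔ
    simpa only [mul_one] using this
  have he := (h.entry_zero h₂).and ((tendsto_frame h₂).eventually_ne frame_limit_ne_zero)
  refine ⟨(key 1 (-1)).neg_left.congr' ?_ EventuallyEq.rfl,
    (key (-1) (-1)).neg_left.congr' ?_ EventuallyEq.rfl,
    (key 1 1).congr' ?_ EventuallyEq.rfl, (key (-1) 1).congr' ?_ EventuallyEq.rfl⟩ <;>
  · filter_upwards [he] with p ⟨⟨⟨e1, e2⟩, e3, e4⟩, hΔ⟩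
    try simp only [← neg_mul]
    rw [← div_eq_mul_inv, div_eq_iff hΔ]
    first
      | linear_combination coeff (-1) (toL2 (V p.1 p.2)) * e1 - coeff (-1) (toL2 (W p.1)) * e3
      | linear_combination coeff (-1) (toL2 (V p.1 p.2)) * e2 - coeff (-1) (toL2 (W p.1)) * e4
      | linear_combination -coeff 1 (toL2 (V p.1 p.2)) * e1 + coeff 1 (toL2 (W p.1)) * e3
      | linear_combination -coeff 1 (toL2 (V p.1 p.2)) * e2 + coeff 1 (toL2 (W p.1)) * e4
      | linear_combination -coeff (-1) (toL2 (V p.1 p.2)) * e1 + coeff (-1) (toL2 (W p.1)) * e3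
      | linear_combination -coeff (-1) (toL2 (V p.1 p.2)) * e2 + coeff (-1) (toL2 (W p.1)) * e4
      | linear_combination coeff 1 (toL2 (V p.1 p.2)) * e1 - coeff 1 (toL2 (W p.1)) * e3
      | linear_combination coeff 1 (toL2 (V p.1 p.2)) * e2 - coeff 1 (toL2 (W p.1)) * e4

end IsReduction
end Bloch

/-! ### The first-order part of the reduced matrix -/

namespace Bloch
variable {s : ℝ}

namespace IsReduction
variable {ν c₀ d μ m : ℝ} {T : Family s} {y₁ y₂ : ℝ × ℝ × ℝ → Hper s} {lam2 : ℝ → ℝ}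
  {lam : ℝ → ℝ → ℝ} {W : ℝ → Hper s} {V : ℝ → ℝ → Hper s}

/-- Eigenvectors for the distinct eigenvalues 0 and λ > 0; this makes the Gram matrix of W, V
diagonal. -/
theorem inner_W_V (h : IsReduction ν c₀ T m y₁ y₂) (h₂ : SplitEigenvalues ν c₀ T lam2 lam W V) :
    ∀ᶠ p in paramFilter c₀, inner ℂ (toL2 (W p.1)) (toL2 (V p.1 p.2)) = (0 : ℂ) := by
  filter_upwards [h.reduced_paramFilter, eventually_paramFilter.mpr h₂.eigen_V,
    eventually_paramFilter.mpr h₂.eigen_W, eventually_paramFilter.mpr h₂.lam_pos] with p hr hv hw hl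
  have e := P_symm hr.self_of_nhds.selfAdjoint hw.1 hv.1
  simp only at e
  rw [hw.2, hv.2, inner_zero_left, inner_smul_right] at e
  exact (mul_eq_zero.mp e.symm).resolve_left (by exact_mod_cast hl.ne')

theorem eventually_hasDerivAt {F : Type*} [NormedAddCommGroup F] [NormedSpace ℝ F]
    {f : ℝ × ℝ × ℝ → F} (hf : ContDiffAt ℝ ∞ f (0, c₀, 0)) :
    ∀ᶠ p in paramFilter c₀, HasDerivAt (fun κ => f (p.1, p.2, κ)) (pderiv₃ f (p.1, p.2, 0)) 0 := by
  refine Eventually.filter_mono (paramFilter_le c₀) ?_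
  have ht : Tendsto (fun p : ℝ × ℝ => (p.1, p.2, (0 : ℝ))) (𝓝 (0, c₀)) (𝓝 (0, c₀, 0)) := by
    have : Continuous (fun p : ℝ × ℝ => (p.1, p.2, (0 : ℝ))) := by fun_prop
    exact this.tendsto (0, c₀)
  filter_upwards [ht.eventually hf.eventually_differentiableAt] with p hp
  exact hp.hasDerivAt_third

/-- The determinant of the first-order part of the reduced matrix in terms of the pairings of
the eigenfunctions with `P'(0)`. -/
theorem det_pderiv₃_entry (hs : 0 ≤ s) (h : IsReduction ν c₀ T m y₁ y₂)
    (hP : IsBlochFamily ν c₀ T) (h₂ : SplitEigenvalues ν c₀ T lam2 lam W V) :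
    ∀ᶠ p in paramFilter c₀,
      (pderiv₃ (entry T y₁ 1) (p.1, p.2, 0) * pderiv₃ (entry T y₂ (-1)) (p.1, p.2, 0) -
        pderiv₃ (entry T y₂ 1) (p.1, p.2, 0) * pderiv₃ (entry T y₁ (-1)) (p.1, p.2, 0)) *
        (inner ℂ (toL2 (W p.1)) (toL2 (W p.1)) *
          inner ℂ (toL2 (V p.1 p.2)) (toL2 (V p.1 p.2))) =
      inner ℂ (toL2 (W p.1)) (dP ν T p.1 p.2 (W p.1)) *
        inner ℂ (toL2 (V p.1 p.2)) (dP ν T p.1 p.2 (V p.1 p.2)) -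
      (inner ℂ (toL2 (W p.1)) (dP ν T p.1 p.2 (V p.1 p.2)) - lam p.1 p.2 *
        inner ℂ (toL2 (W p.1)) (toL2 (coeff 1 (toL2 (V p.1 p.2)) • pderiv₃ y₁ (p.1, p.2, 0) +
          coeff (-1) (toL2 (V p.1 p.2)) • pderiv₃ y₂ (p.1, p.2, 0)))) *
      (inner ℂ (toL2 (V p.1 p.2)) (dP ν T p.1 p.2 (W p.1)) + lam p.1 p.2 *
        inner ℂ (toL2 (V p.1 p.2)) (toL2 (coeff 1 (toL2 (W p.1)) • pderiv₃ y₁ (p.1, p.2, 0) +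
          coeff (-1) (toL2 (W p.1)) • pderiv₃ y₂ (p.1, p.2, 0)))) := by
  filter_upwards [h.reduced_paramFilter, eventually_paramFilter.mpr h₂.eigen_V,
    eventually_paramFilter.mpr h₂.eigen_W, h.inner_W_V h₂, h.eq_W h₂, h.eq_V h₂,
    eventually_hasDerivAt (hP.smooth 0 zero_mem_BZ), eventually_hasDerivAt h.smooth₁,
    eventually_hasDerivAt h.smooth₂, eventually_hasDerivAt (contDiffAt_entry hP h.smooth₁ 1),
    eventually_hasDerivAt (contDiffAt_entry hP h.smooth₁ (-1)),
    eventually_hasDerivAt (contDiffAt_entry hP h.smooth₂ 1),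
    eventually_hasDerivAt (contDiffAt_entry hP h.smooth₂ (-1))]
    with p hr hV hW hWV eW eV dT d₁ d₂ d₁₁ d₂₁ d₁₂ d₂₂
  have hW0 : P ν T p.1 p.2 0 (W p.1) = ((0 : ℝ) : ℂ) • toL2 (W p.1) := by simpa using hW.2
  have iWW := inner_deriv_eq hs dT d₁ d₂ hr d₁₁ d₂₁ d₁₂ d₂₂ hW.1 hW0 eW hW0
  have iWV := inner_deriv_eq hs dT d₁ d₂ hr d₁₁ d₂₁ d₁₂ d₂₂ hW.1 hW0 eV hV.2
  have iVW := inner_deriv_eq hs dT d₁ d₂ hr d₁₁ d₂₁ d₁₂ d₂₂ hV.1 hV.2 eW hW0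
  have iVV := inner_deriv_eq hs dT d₁ d₂ hr d₁₁ d₂₁ d₁₂ d₂₂ hV.1 hV.2 eV hV.2
  rw [Complex.ofReal_zero, zero_mul, add_zero, add_zero] at iWW
  rw [Complex.ofReal_zero, zero_mul, add_zero] at iWV
  rw [Complex.ofReal_zero, zero_mul, add_zero] at iVW
  have iVV' := add_right_cancel iVV
  rw [inner_dP hW.1, inner_dP hW.1, inner_dP hV.1, inner_dP hV.1, dT.deriv, iWW, iWV, iVW, iVV']
  have hVW : inner ℂ (toL2 (V p.1 p.2)) (toL2 (W p.1)) = (0 : ℂ) := by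
    rw [← inner_conj_symm, hWV, map_zero]
  -- The corrected pairings form the matrix N B' X, where X holds the coordinates of W, V in the
  -- basis `y₁, y₂` and N their pairings with it. The product N X is the Gram matrix of W, V, so its
  -- determinant is the factor multiplying det B'.
  have gram : ∀ v : L2per,
      inner ℂ v (toL2 (W p.1)) = coeff 1 (toL2 (W p.1)) * inner ℂ v (toL2 (y₁ (p.1, p.2, 0))) +
        coeff (-1) (toL2 (W p.1)) * inner ℂ v (toL2 (y₂ (p.1, p.2, 0))) ∧
      inner ℂ v (toL2 (V p.1 p.2)) =
        coeff 1 (toL2 (V p.1 p.2)) * inner ℂ v (toL2 (y₁ (p.1, p.2, 0))) +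
        coeff (-1) (toL2 (V p.1 p.2)) * inner ℂ v (toL2 (y₂ (p.1, p.2, 0))) := by
    intro v
    constructor
    · conv_lhs => rw [eW]
      rw [map_add, map_smul, map_smul, inner_add_right, inner_smul_right, inner_smul_right]
    · conv_lhs => rw [eV]
      rw [map_add, map_smul, map_smul, inner_add_right, inner_smul_right, inner_smul_right]
  have g11 := (gram (toL2 (W p.1))).1
  have g12 := (gram (toL2 (W p.1))).2
  have g21 := (gram (toL2 (V p.1 p.2))).1
  have g22 := (gram (toL2 (V p.1 p.2))).2
  rw [hWV] at g12
  rw [hVW] at g21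
  rw [g11, g22]
  generalize inner ℂ (toL2 (W p.1)) (toL2 (y₁ (p.1, p.2, 0))) = n₁₁ at *
  generalize inner ℂ (toL2 (W p.1)) (toL2 (y₂ (p.1, p.2, 0))) = n₁₂ at *
  generalize inner ℂ (toL2 (V p.1 p.2)) (toL2 (y₁ (p.1, p.2, 0))) = n₂₁ at *
  generalize inner ℂ (toL2 (V p.1 p.2)) (toL2 (y₂ (p.1, p.2, 0))) = n₂₂ at *
  generalize pderiv₃ (entry T y₁ 1) (p.1, p.2, 0) = b₁₁ at *
  generalize pderiv₃ (entry T y₂ 1) (p.1, p.2, 0) = b₁₂ at *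
  generalize pderiv₃ (entry T y₁ (-1)) (p.1, p.2, 0) = b₂₁ at *
  generalize pderiv₃ (entry T y₂ (-1)) (p.1, p.2, 0) = b₂₂ at *
  generalize coeff 1 (toL2 (W p.1)) = α₁ at *
  generalize coeff (-1) (toL2 (W p.1)) = α₂ at *
  generalize coeff 1 (toL2 (V p.1 p.2)) = β₁ at *
  generalize coeff (-1) (toL2 (V p.1 p.2)) = β₂ at *
  linear_combination -(b₁₁ * b₂₂ - b₁₂ * b₂₁) * (α₁ * n₂₁ + α₂ * n₂₂) * g12

/-- The off-diagonal pairings are ±iμ(c - c₀)/2 + O(ε²), including the corrections with λ = O(ε²),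
so their product is μ²(c - c₀)²/4 + O(ε³). The product of the diagonal ones is O(ε⁴), and the Gram
determinant is 1/4 + O(ε). -/
theorem isBigO_det_pderiv₃_entry (hs : 0 ≤ s) (h : IsReduction ν c₀ T m y₁ y₂)
    (hP : IsBlochFamily ν c₀ T) (h₂ : SplitEigenvalues ν c₀ T lam2 lam W V)
    (h₃ : NonDegenerate ν c₀ T W V μ) :
    (fun p : ℝ × ℝ =>
      pderiv₃ (entry T y₁ 1) (p.1, p.2, 0) * pderiv₃ (entry T y₂ (-1)) (p.1, p.2, 0) -
        pderiv₃ (entry T y₂ 1) (p.1, p.2, 0) * pderiv₃ (entry T y₁ (-1)) (p.1, p.2, 0) +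
        (μ * (p.2 - c₀)) ^ 2) =O[paramFilter c₀] fun p => paramDist c₀ p ^ 3 := by
  obtain ⟨o₁₁, o₂₁, o₁₂, o₂₂⟩ := isBigO_inner_dP h₂ h₃
  have bW := isBigO_one_of_sub h₂.isBigO_W
  have bV := isBigO_one_of_sub h₂.isBigO_V
  have cW := fun n => isBigO_one_of_sub (isBigO_coeff_sub n h₂.isBigO_W)
  have cV := fun n => isBigO_one_of_sub (isBigO_coeff_sub n h₂.isBigO_V)
  have by₁ := isBigO_one_of_sub (isBigO_sub_paramDist h.smooth₁.pderiv₃)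
  have by₂ := isBigO_one_of_sub (isBigO_sub_paramDist h.smooth₂.pderiv₃)
  have lift : ∀ {f g : ℝ × ℝ → ℂ}, (f =O[paramFilter c₀] fun _ => (1 : ℝ)) →
      (g =O[paramFilter c₀] fun _ => (1 : ℝ)) →
      (fun p => toL2 (f p • pderiv₃ y₁ (p.1, p.2, 0) + g p • pderiv₃ y₂ (p.1, p.2, 0)))
        =O[paramFilter c₀] fun _ => (1 : ℝ) := by
    intro f g hf hg
    have h1 := (hf.smul by₁).add (hg.smul by₂)
    simp only [smul_eq_mul, mul_one] at h1
    exact ((incl hs).isBigO_comp _ _).trans h1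
  have ζ₁ := h₂.isBigO_lam.mul (bW.complex_inner (lift (cV 1) (cV (-1))))
  have ζ₂ := h₂.isBigO_lam.mul (bV.complex_inner (lift (cW 1) (cW (-1))))
  simp only [mul_one] at ζ₁ ζ₂
  have q₁₂ := o₁₂.sub ζ₁
  have q₂₁ := o₂₁.add ζ₂
  have hγ : (fun p : ℝ × ℝ => Complex.I * μ * ((p.2 : ℂ) - c₀) / 2) =O[paramFilter c₀]
      paramDist c₀ := by
    have := (Complex.isBigO_ofReal_left.mpr (isBigO_snd_paramDist c₀)).const_mul_left
      (Complex.I * μ / 2)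
    refine this.congr_left fun p => ?_
    push_cast; ring
  -- the product of the off-diagonal terms
  have r1 := (q₁₂.mul q₂₁).trans (g := fun p => paramDist c₀ p ^ 2 * paramDist c₀ p ^ 2)
    (k := fun p => paramDist c₀ p ^ 3)
    ((Asymptotics.isBigO_of_le _ fun p => by rw [← pow_add]).trans
      (isBigO_paramDist_pow c₀ (i := 4) (by norm_num)))
  have r2 := (o₁₁.mul o₂₂).trans (g := fun p => paramDist c₀ p ^ 2 * paramDist c₀ p ^ 2)
    (k := fun p => paramDist c₀ p ^ 3)
    ((Asymptotics.isBigO_of_le _ fun p => by rw [← pow_add]).trans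
      (isBigO_paramDist_pow c₀ (i := 4) (by norm_num)))
  have e3 : ∀ p, paramDist c₀ p ^ 3 = paramDist c₀ p ^ 2 * paramDist c₀ p := fun p => pow_succ _ _
  have r3 := (q₁₂.mul hγ).congr_right fun p => (e3 p).symm
  have r4 := (q₂₁.mul hγ).congr_right fun p => (e3 p).symm
  have hdet := h.det_pderiv₃_entry hs hP h₂
  have hn : (fun p : ℝ × ℝ => inner ℂ (toL2 (W p.1)) (toL2 (W p.1)) *
      inner ℂ (toL2 (V p.1 p.2)) (toL2 (V p.1 p.2)) - (1 / 4 : ℂ)) =O[paramFilter c₀]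
      paramDist c₀ := by
    have k1 := h₂.isBigO_W.complex_inner bW
    have k2 := (Asymptotics.isBigO_const_const sinF (one_ne_zero : (1 : ℝ) ≠ 0)
      (paramFilter c₀)).complex_inner h₂.isBigO_W
    have k3 := h₂.isBigO_V.complex_inner bV
    have k4 := (Asymptotics.isBigO_const_const cosF (one_ne_zero : (1 : ℝ) ≠ 0)
      (paramFilter c₀)).complex_inner h₂.isBigO_V
    simp only [mul_one, one_mul] at k1 k2 k3 k4
    have k5 := bV.complex_inner bV
    have k6 := (k1.add k2).mul k5
    have k7 := (k3.add k4).const_mul_left (1 / 2)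
    simp only [mul_one] at k6
    refine (k6.add k7).congr_left fun p => ?_
    simp only [inner_sub_left, inner_sub_right, inner_sinF_sinF, inner_cosF_cosF]
    ring
  have hninv := ((tendsto_of_isBigO_sub hn).inv₀ (by norm_num)).isBigO_one ℝ
  have hne := (tendsto_of_isBigO_sub hn).eventually_ne (by norm_num : (1 / 4 : ℂ) ≠ 0)
  have hγ2 : (fun p : ℝ × ℝ => ((μ * (p.2 - c₀)) ^ 2 : ℂ)) =O[paramFilter c₀]
      fun p => paramDist c₀ p ^ 2 := by
    have := (hγ.pow 2).const_mul_left (-4)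
    refine this.congr_left fun p => ?_
    linear_combination -(μ : ℂ) ^ 2 * (p.2 - c₀) ^ 2 * Complex.I_sq
  have r5 := ((hγ2.mul hn).congr_right fun p => (e3 p).symm)
  have total := (((r2.sub r1).add (r3.sub r4)).add r5).mul hninv
  simp only [mul_one] at total
  refine total.congr' ?_ EventuallyEq.rfl
  filter_upwards [hdet, hne] with p hp hne
  rw [mul_inv_eq_iff_eq_mul₀ hne]
  linear_combination -hp - (1 / 4 : ℂ) * (μ : ℂ) ^ 2 * (p.2 - c₀) ^ 2 * Complex.I_sq

end IsReduction
end Bloch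

/-! ### Second and fourth derivatives of trace and determinant -/

namespace Bloch
variable {s : ℝ}

namespace IsReduction
variable {ν c₀ d μ m : ℝ} {T : Family s} {y₁ y₂ : ℝ × ℝ × ℝ → Hper s} {lam2 : ℝ → ℝ}
  {lam : ℝ → ℝ → ℝ} {W : ℝ → Hper s} {V : ℝ → ℝ → Hper s}

theorem tendsto_triple (c₀ : ℝ) : Tendsto (fun p : ℝ × ℝ => (p.1, p.2, (0 : ℝ)))
    (𝓝 (0, c₀)) (𝓝 (0, c₀, 0)) := by
  have : Continuous (fun p : ℝ × ℝ => (p.1, p.2, (0 : ℝ))) := by fun_prop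
  exact this.tendsto (0, c₀)

/-- The second derivative of the determinant at `κ = 0`. -/
theorem isBigO_pderiv₃_redDet (hs : 0 ≤ s) (h : IsReduction ν c₀ T m y₁ y₂)
    (hP : IsBlochFamily ν c₀ T) (h₁ : UnperturbedBands ν c₀ T d)
    (h₂ : SplitEigenvalues ν c₀ T lam2 lam W V) (h₃ : NonDegenerate ν c₀ T W V μ) :
    (fun p : ℝ × ℝ => 1 / 2 * pderiv₃^[2] (redDet T y₁ y₂) (p.1, p.2, 0) -
      (lam p.1 p.2 * d / 2 - (μ * (p.2 - c₀)) ^ 2)) =O[paramFilter c₀]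
      fun p => paramDist c₀ p ^ 3 := by
  have s₁₁ := contDiffAt_entry hP h.smooth₁ 1
  have s₂₁ := contDiffAt_entry hP h.smooth₁ (-1)
  have s₁₂ := contDiffAt_entry hP h.smooth₂ 1
  have s₂₂ := contDiffAt_entry hP h.smooth₂ (-1)
  obtain ⟨b₁₁, b₂₁, b₁₂, b₂₂⟩ := h.isBigO_entry h₂
  obtain ⟨d₁₁, d₂₁, d₁₂, d₂₂⟩ := h.pderiv₃_entry hP h₁
  have q₁₁ := isBigO_sub_paramDist (s₁₁.iterate_pderiv₃ 2)
  have q₂₁ := isBigO_sub_paramDist (s₂₁.iterate_pderiv₃ 2)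
  have q₁₂ := isBigO_sub_paramDist (s₁₂.iterate_pderiv₃ 2)
  have q₂₂ := isBigO_sub_paramDist (s₂₂.iterate_pderiv₃ 2)
  rw [d₁₁] at q₁₁
  rw [d₂₁] at q₂₁
  rw [d₁₂] at q₁₂
  rw [d₂₂] at q₂₂
  have t1 := h.isBigO_det_pderiv₃_entry hs hP h₂ h₃
  have e3 : ∀ p, paramDist c₀ p ^ 3 = paramDist c₀ p ^ 2 * paramDist c₀ p := fun p => pow_succ _ _
  -- Replacing the second derivatives of the entries by their base values d and 0 costs O(ε) against
  -- entries of size O(ε²). What remains is d/2 times the trace at κ = 0, which is λ d/2.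
  have t2 := ((b₁₁.mul q₂₂).add (b₂₂.mul q₁₁)).sub ((b₁₂.mul q₂₁).add (b₂₁.mul q₁₂))
  have t3 := (t2.congr_right fun p => (e3 p).symm).const_mul_left (1 / 2)
  refine (t1.add t3).congr' ?_ EventuallyEq.rfl
  have hE := (eventually_pderiv₃_two_sub (s₁₁.mul s₂₂) (s₁₂.mul s₂₁)).and
    ((eventually_pderiv₃_two_mul s₁₁ s₂₂).and (eventually_pderiv₃_two_mul s₁₂ s₂₁))
  filter_upwards [((tendsto_triple c₀).mono_left (paramFilter_le c₀)).eventually hE,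
    h.redTrace_redDet_zero h₂] with p ⟨h1, h2, h3⟩ h4
  change _ = 1 / 2 * pderiv₃^[2] (fun q => entry T y₁ 1 q * entry T y₂ (-1) q -
    entry T y₂ 1 q * entry T y₁ (-1) q) (p.1, p.2, 0) - _
  have h5 : entry T y₁ 1 (p.1, p.2, 0) + entry T y₂ (-1) (p.1, p.2, 0) = lam p.1 p.2 := h4.1
  refine Eq.trans ?_ (congrArg (fun x => 1 / 2 * x - _) h1.symm)
  change _ = 1 / 2 * (pderiv₃^[2] (fun q => entry T y₁ 1 q * entry T y₂ (-1) q) (p.1, p.2, 0) -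
    pderiv₃^[2] (fun q => entry T y₂ 1 q * entry T y₁ (-1) q) (p.1, p.2, 0)) - _
  rw [h2, h3, ← h5]
  ring

/-- At the base point the second derivative of the trace is `2 d` and the fourth derivative of the
determinant is `6 d ^ 2`. -/
theorem pderiv₃_redTrace_redDet (h : IsReduction ν c₀ T m y₁ y₂) (hP : IsBlochFamily ν c₀ T)
    (h₁ : UnperturbedBands ν c₀ T d) :
    pderiv₃^[2] (redTrace T y₁ y₂) (0, c₀, 0) = 2 * d ∧
      pderiv₃^[4] (redDet T y₁ y₂) (0, c₀, 0) = 6 * d ^ 2 := by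
  constructor
  · obtain ⟨d₁₁, -, -, d₂₂⟩ := h.pderiv₃_entry hP h₁
    have := (eventually_pderiv₃_two_add (contDiffAt_entry hP h.smooth₁ 1)
      (contDiffAt_entry hP h.smooth₂ (-1))).self_of_nhds
    refine this.trans ?_
    simp only [d₁₁, d₂₂]
    ring
  · have hb : ∀ f g : ℝ → ℝ, ((fun κ => f κ - 1 / 2 * d * κ ^ 2) =O[𝓝 0] fun κ : ℝ => κ ^ 3) →
        ((fun κ => g κ - 1 / 2 * d * κ ^ 2) =O[𝓝 0] fun κ : ℝ => κ ^ 3) →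
        ((fun κ => f κ * g κ - d ^ 2 / 4 * κ ^ 4) =O[𝓝 0] fun κ : ℝ => κ ^ (4 + 1)) := by
      intro f g hf hg
      have i1 : (fun κ : ℝ => κ ^ 3) =O[𝓝 0] fun κ : ℝ => κ ^ 2 := by
        have := (Asymptotics.isBigO_refl (fun κ : ℝ => κ ^ 2) (𝓝 0)).mul
          ((continuous_id.tendsto (0 : ℝ)).isBigO_one ℝ)
        simpa [pow_succ] using this
      have i2 : (fun κ : ℝ => 1 / 2 * d * κ ^ 2) =O[𝓝 0] fun κ : ℝ => κ ^ 2 :=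
        (Asymptotics.isBigO_refl _ _).const_mul_left _
      have i3 := (hf.trans i1).add i2
      simp only [sub_add_cancel] at i3
      refine ((i3.mul hg).add (i2.mul hf)).congr (fun κ => ?_) (fun κ => ?_) <;> ring
    -- At (0, c₀, κ) the determinant is the product of the two bands, d² κ⁴/4 + O(κ⁵);
    -- multiplication by 4! gives 6 d².
    have h0 := hb _ _ h₁.convex_one h₁.convex_neg_one
    have h5 := pderiv₃_eq_of_isBigO (e := d ^ 2 / 4) (h.contDiffAt_redDet hP) 4 ?_
    · rw [h5]
      push_cast [Nat.factorial]
      ring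
    · refine (Complex.isBigO_ofReal_left.mpr h0).congr' ?_ EventuallyEq.rfl
      filter_upwards [h.entry_unperturbed hP h₁] with κ ⟨k1, k2, k3, k4⟩
      rw [redDet, k1, k2, k3, k4]
      push_cast
      ring

end IsReduction
end Bloch

/-! ### Expansions of trace and determinant, and the roots they determine -/

namespace Bloch
variable {s : ℝ} {ν c₀ d μ : ℝ} {T : Family s} {lam2 : ℝ → ℝ}
  {lam : ℝ → ℝ → ℝ} {W : ℝ → Hper s} {V : ℝ → ℝ → Hper s}

/-- Freezing `lam2` at `c₀` costs O(|c - c₀|) by differentiability. The factor `a ^ 2` is kept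
because the later argument divides by `a ^ 2`. -/
theorem SplitEigenvalues.isBigO_lam_sub (h₂ : SplitEigenvalues ν c₀ T lam2 lam W V) :
    (fun p : ℝ × ℝ => lam p.1 p.2 - lam2 c₀ * p.1 ^ 2) =O[paramFilter c₀]
      fun p => p.1 ^ 2 * paramDist c₀ p := by
  obtain ⟨M, hM⟩ := h₂.lam_expansion
  have e1 : (fun p : ℝ × ℝ => lam p.1 p.2 - lam2 p.2 * p.1 ^ 2) =O[paramFilter c₀]
      fun p => p.1 ^ 2 * p.1 := by
    refine Asymptotics.IsBigO.of_bound M ?_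
    filter_upwards [eventually_paramFilter.mpr hM] with p hp
    simpa [← pow_succ] using hp
  have e2 := e1.trans ((Asymptotics.isBigO_refl (fun p : ℝ × ℝ => p.1 ^ 2) _).mul
    (isBigO_fst_paramDist c₀))
  have ht : Tendsto (fun p : ℝ × ℝ => p.2) (paramFilter c₀) (𝓝 c₀) :=
    (continuous_snd.tendsto (0, c₀)).mono_left (paramFilter_le c₀)
  have hd : DifferentiableAt ℝ lam2 c₀ := h₂.lam2_smooth.differentiableAt (by simp)
  have e3 : (fun p : ℝ × ℝ => lam2 p.2 - lam2 c₀) =O[paramFilter c₀] paramDist c₀ :=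
    (hd.isBigO_sub.comp_tendsto ht).trans (isBigO_snd_paramDist c₀)
  have e4 := (Asymptotics.isBigO_refl (fun p : ℝ × ℝ => p.1 ^ 2) (paramFilter c₀)).mul e3
  refine (e2.add e4).congr_left fun p => ?_
  ring

/-- The expansion of the two lowest eigenvalues `l₁ ≤ l₂` near `κ = 0`, in terms of their sum and
product. -/
theorem exists_lowestTwo_expansion (hs : 0 ≤ s) (hP : IsBlochFamily ν c₀ T)
    (h₁ : UnperturbedBands ν c₀ T d) (h₂ : SplitEigenvalues ν c₀ T lam2 lam W V)
    (h₃ : NonDegenerate ν c₀ T W V μ) :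
    ∃ (τ δ η : ℝ → ℝ → ℝ) (K r : ℝ), 0 < K ∧ 0 < r ∧
      ∀ a c : ℝ, a ≠ 0 → |a| < r → |c - c₀| < r →
        |δ a c - (lam a c * d / 2 - (μ * (c - c₀)) ^ 2)| ≤ K * (|a| + |c - c₀|) ^ 3 ∧
        |τ a c - d| ≤ K * (|a| + |c - c₀|) ∧
        |lam a c - lam2 c₀ * a ^ 2| ≤ K * (a ^ 2 * (|a| + |c - c₀|)) ∧ 0 < lam a c ∧
        d ^ 2 / 8 ≤ η a c ∧
        ∀ κ : ℝ, |κ| < r → κ ∈ BZ ∧ IsSelfAdjoint (toUnbounded (T a c κ)) ∧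
          ∃ l₁ l₂ : ℝ, AreLowestTwo ν T a c κ l₁ l₂ ∧
            |l₁ + l₂ - (lam a c + τ a c * κ ^ 2)| ≤ K * κ ^ 4 ∧
            |l₁ * l₂ - δ a c * κ ^ 2| ≤ K * κ ^ 4 ∧
            |l₁ * l₂ - (δ a c * κ ^ 2 + η a c * κ ^ 4)| ≤ K * |κ| ^ 5 := by
  obtain ⟨m, y₁, y₂, h⟩ := exists_isReduction hs hP h₁
  have hst := h.contDiffAt_redTrace hP
  have hsd := h.contDiffAt_redDet hP
  obtain ⟨v2, v4⟩ := h.pderiv₃_redTrace_redDet hP h₁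
  obtain ⟨K₁, hK₁, hb₁⟩ := (h.isBigO_pderiv₃_redDet hs hP h₁ h₂ h₃).exists_pos
  obtain ⟨K₂, hK₂, r₂, hr₂, hb₂⟩ := exists_lipschitz_first_two (hst.iterate_pderiv₃ 2)
  obtain ⟨K₃, hK₃, hb₃⟩ := h₂.isBigO_lam_sub.exists_pos
  obtain ⟨K₄, hK₄, r₄, hr₄, hb₄⟩ := exists_taylor_third 4 hst
  obtain ⟨K₅, hK₅, r₅, hr₅, hb₅⟩ := exists_taylor_third 4 hsd
  obtain ⟨K₆, hK₆, r₆, hr₆, hb₆⟩ := exists_taylor_third 5 hsd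
  have hη : ∀ᶠ p : ℝ × ℝ × ℝ in 𝓝 (0, c₀, 0),
      d ^ 2 / 8 < (pderiv₃^[4] (redDet T y₁ y₂) p).re / 24 := by
    have h1 : Tendsto (fun p => (pderiv₃^[4] (redDet T y₁ y₂) p).re / 24) (𝓝 (0, c₀, 0))
        (𝓝 ((6 * d ^ 2 : ℂ).re / 24)) := by
      rw [← v4]
      exact (Complex.continuous_re.continuousAt.tendsto.comp
        (hsd.iterate_pderiv₃ 4).continuousAt.tendsto).div_const _
    refine h1.eventually_const_lt ?_
    have : (6 * d ^ 2 : ℂ).re = 6 * d ^ 2 := by norm_cast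
    rw [this]
    nlinarith [pow_pos h₁.d_pos 2]
  have hpair : ∀ {Q : ℝ × ℝ → Prop}, (∀ᶠ p in paramFilter c₀, Q p) →
      ∃ r > 0, ∀ a c : ℝ, |a| < r → |c - c₀| < r → a ≠ 0 → Q (a, c) := fun hQ =>
    eventually_nhds_pair_iff.mp (eventually_paramFilter.mp hQ)
  obtain ⟨q₁, hq₁, g₁⟩ := hpair (hb₁.bound.and (hb₃.bound.and ((h.redTrace_redDet_zero h₂).and
    (eventually_paramFilter.mpr h₂.lam_pos))))
  obtain ⟨q₂, hq₂, g₂⟩ := eventually_nhds_triple_iff.mp (hη.and (h.areLowestTwo.and (h.reduced.and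
    ((odd_pderiv₃_eq_zero_of_even hst ((h.even hP).mono fun p hp => hp.1)).and
      (odd_pderiv₃_eq_zero_of_even hsd ((h.even hP).mono fun p hp => hp.2))))))
  -- Taylor coefficients of trace and determinant. Evenness removes the odd orders, so the quadratic
  -- truncations have error O(κ⁴). The fourth-order form of the determinant is needed for
  -- positivity, where δ may be arbitrarily small.
  refine ⟨fun a c => (pderiv₃^[2] (redTrace T y₁ y₂) (a, c, 0)).re / 2,
    fun a c => (pderiv₃^[2] (redDet T y₁ y₂) (a, c, 0)).re / 2,
    fun a c => (pderiv₃^[4] (redDet T y₁ y₂) (a, c, 0)).re / 24,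
    K₁ + K₂ + K₃ + K₄ + K₅ + K₆, min (min (min r₂ r₄) (min r₅ r₆)) (min q₁ q₂),
    by positivity, by positivity, ?_⟩
  intro a c ha har hcr
  simp only [lt_min_iff] at har hcr
  have hε : 0 ≤ |a| + |c - c₀| := by positivity
  obtain ⟨f1, f2, ⟨f3, f3'⟩, f4⟩ := g₁ a c har.2.1 hcr.2.1 ha
  obtain ⟨f5, -⟩ := g₂ a c 0 har.2.2 hcr.2.2 (by simpa using hq₂)
  have mono : ∀ {x y : ℝ} (A : ℝ), x ≤ A * y → A ≤ K₁ + K₂ + K₃ + K₄ + K₅ + K₆ → 0 ≤ y →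
      x ≤ (K₁ + K₂ + K₃ + K₄ + K₅ + K₆) * y := fun A h1 h2 h3 =>
    h1.trans (mul_le_mul_of_nonneg_right h2 h3)
  refine ⟨?_, ?_, ?_, f4, f5.le, fun κ hκ => ?_⟩
  · refine mono K₁ ?_ (by linarith) (by positivity)
    have e : (1 / 2 * pderiv₃^[2] (redDet T y₁ y₂) (a, c, 0) -
        ((lam a c : ℂ) * d / 2 - (μ * (c - c₀)) ^ 2)).re =
        (pderiv₃^[2] (redDet T y₁ y₂) (a, c, 0)).re / 2 -
          (lam a c * d / 2 - (μ * (c - c₀)) ^ 2) := by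
      have : ((lam a c : ℂ) * d / 2 - (μ * (c - c₀)) ^ 2) =
          ((lam a c * d / 2 - (μ * (c - c₀)) ^ 2 : ℝ) : ℂ) := by push_cast; ring
      rw [this, Complex.sub_re, Complex.ofReal_re]
      have : (1 / 2 : ℂ) = ((1 / 2 : ℝ) : ℂ) := by norm_num
      rw [this, Complex.re_ofReal_mul]
      ring
    rw [← e]
    refine (Complex.abs_re_le_norm _).trans (f1.trans_eq ?_)
    rw [Real.norm_of_nonneg (pow_nonneg (paramDist_nonneg _ _) _)]
    rfl
  · refine mono K₂ ?_ (by linarith) hε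
    have f6 := hb₂ a c har.1.1.1 hcr.1.1.1
    rw [v2] at f6
    have f7 := (Complex.abs_re_le_norm _).trans f6
    have : (2 * d : ℂ).re = 2 * d := by norm_cast
    rw [Complex.sub_re, this] at f7
    have e : (pderiv₃^[2] (redTrace T y₁ y₂) (a, c, 0)).re / 2 - d =
        ((pderiv₃^[2] (redTrace T y₁ y₂) (a, c, 0)).re - 2 * d) / 2 := by ring
    rw [e, abs_div, abs_two]
    have := abs_nonneg ((pderiv₃^[2] (redTrace T y₁ y₂) (a, c, 0)).re - 2 * d)
    linarith
  · refine mono K₃ ?_ (by linarith) (by positivity)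
    refine f2.trans_eq ?_
    rw [Real.norm_of_nonneg (mul_nonneg (sq_nonneg _) (paramDist_nonneg _ _))]
    rfl
  · simp only [lt_min_iff] at hκ
    obtain ⟨-, ⟨l₁, l₂, hl, htr, hdet⟩, hred, ⟨o1, o3⟩, p1, p3⟩ := g₂ a c κ har.2.2 hcr.2.2 hκ.2.2
    refine ⟨hred.mem_BZ, hred.selfAdjoint, l₁, l₂, hl, ?_, ?_, ?_⟩
    · refine mono K₄ ?_ (by linarith) (by positivity)
      have k := hb₄ a c κ har.1.1.2 hcr.1.1.2 hκ.1.1.2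
      rw [pow_abs, abs_of_nonneg (by positivity : 0 ≤ κ ^ 4)] at k
      refine le_trans ?_ k
      refine le_of_eq_of_le (congrArg abs ?_) (Complex.abs_re_le_norm _)
      rw [← htr]
      simp only [Finset.sum_range_succ, Finset.sum_range_zero, o1, o3, smul_zero, Nat.factorial,
        Function.iterate_zero, id, f3]
      simp [-Complex.ofReal_pow]
      ring
    · refine mono K₅ ?_ (by linarith) (by positivity)
      have k := hb₅ a c κ har.1.2.1 hcr.1.2.1 hκ.1.2.1
      rw [pow_abs, abs_of_nonneg (by positivity : 0 ≤ κ ^ 4)] at k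
      refine le_trans ?_ k
      refine le_of_eq_of_le (congrArg abs ?_) (Complex.abs_re_le_norm _)
      rw [← hdet]
      simp only [Finset.sum_range_succ, Finset.sum_range_zero, p1, p3, smul_zero, Nat.factorial,
        Function.iterate_zero, id, f3']
      simp [-Complex.ofReal_pow]
      ring
    · refine mono K₆ ?_ (by linarith) (by positivity)
      have k := hb₆ a c κ har.1.2.2 hcr.1.2.2 hκ.1.2.2
      refine le_trans ?_ k
      refine le_of_eq_of_le (congrArg abs ?_) (Complex.abs_re_le_norm _)
      rw [← hdet]
      simp only [Finset.sum_range_succ, Finset.sum_range_zero, p1, p3, smul_zero, Nat.factorial,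
        Function.iterate_zero, id, f3']
      simp [-Complex.ofReal_pow]
      ring

end Bloch

/-- The roots `l₁ ≤ l₂` with sum `λ + τ κ² + O(κ⁴)` and product `δ κ² + O(κ⁴)`, where `λ` is of
size `A` and `δ = O(A)`, for `κ² ≤ C² A²`. -/
theorem roots_expansion {q B K C A lam τ δ κ l₁ l₂ : ℝ} (hq : 0 < q) (hK : 0 ≤ K)
    (hA : 0 < A) (hle : l₁ ≤ l₂) (hlam : 4 * q * A ≤ lam)
    (hτ : |τ| ≤ B) (hδ : |δ| ≤ B * A) (hκ : κ ^ 2 ≤ C ^ 2 * A ^ 2)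
    (hA1 : C ^ 2 * A ≤ 1) (hA2 : A ≤ 1) (hA3 : (B + K) * (C ^ 2 * A) ≤ 2 * q)
    (hS : |l₁ + l₂ - (lam + τ * κ ^ 2)| ≤ K * κ ^ 4) (hD : |l₁ * l₂ - δ * κ ^ 2| ≤ K * κ ^ 4) :
    |l₁ - δ / lam * κ ^ 2| ≤
      (K / q + B * ((B + K) / q + B + K) / q ^ 2) * (κ ^ 4 / A) := by
  obtain ⟨x, hx⟩ : ∃ x, x = κ ^ 2 := ⟨_, rfl⟩
  have hx0 : 0 ≤ x := by rw [hx]; positivity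
  have hx4 : κ ^ 4 = x ^ 2 := by rw [hx]; ring
  rw [hx4] at hS hD ⊢
  rw [← hx] at hS hD hκ ⊢
  have hB : 0 ≤ B := (abs_nonneg _).trans hτ
  have hxA : x ≤ A := by
    calc x ≤ C ^ 2 * A * A := hκ.trans_eq (by ring)
      _ ≤ 1 * A := mul_le_mul_of_nonneg_right hA1 hA.le
      _ = A := one_mul A
  have hx1 : x ≤ 1 := hxA.trans hA2
  have hxx : x ^ 2 ≤ x := by nlinarith
  have hlam0 : 0 < lam := lt_of_lt_of_le (by positivity) hlam
  have h1 : |τ * x| ≤ B * x := by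
    rw [abs_mul, abs_of_nonneg hx0]; exact mul_le_mul_of_nonneg_right hτ hx0
  have h2 : |δ * x| ≤ B * A * x := by
    rw [abs_mul, abs_of_nonneg hx0]; exact mul_le_mul_of_nonneg_right hδ hx0
  have h3 : |l₁ + l₂ - lam| ≤ (B + K) * x := by
    have e : l₁ + l₂ - lam = (l₁ + l₂ - (lam + τ * x)) + τ * x := by ring
    rw [e]
    refine (abs_add_le _ _).trans ?_
    nlinarith
  have h4 : (B + K) * x ≤ 2 * q * A := by
    calc (B + K) * x ≤ (B + K) * (C ^ 2 * A ^ 2) := mul_le_mul_of_nonneg_left hκ (by positivity)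
      _ = (B + K) * (C ^ 2 * A) * A := by ring
      _ ≤ _ := mul_le_mul_of_nonneg_right hA3 hA.le
  -- As `l₁ ≤ l₂`, twice `l₂` is at least the sum, which is at least `4 q A - 2 q A`.
  have hl₂ : q * A ≤ l₂ := by
    have := (abs_le.mp h3).1
    nlinarith
  have hqA : 0 < q * A := by positivity
  have hl₂0 : 0 < l₂ := hqA.trans_le hl₂
  have h5 : |l₁ * l₂| ≤ (B + K) * A * x := by
    have e : l₁ * l₂ = (l₁ * l₂ - δ * x) + δ * x := by ring
    rw [e]
    refine (abs_add_le _ _).trans ?_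
    nlinarith [mul_le_mul_of_nonneg_left hxA (mul_nonneg hK hx0)]
  have h6 : |l₁| ≤ (B + K) / q * x := by
    rw [abs_mul, abs_of_pos hl₂0] at h5
    have h7 : |l₁| * (q * A) ≤ (B + K) * A * x :=
      (mul_le_mul_of_nonneg_left hl₂ (abs_nonneg _)).trans h5
    have h8 : |l₁| * q ≤ (B + K) * x := by
      refine le_of_mul_le_mul_right ?_ hA
      nlinarith
    rw [div_mul_eq_mul_div, le_div_iff₀ hq]
    exact h8
  have h7 : |lam - l₂| ≤ ((B + K) / q + B + K) * x := by
    have e : lam - l₂ = l₁ - (l₁ + l₂ - lam) := by ring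
    rw [e]
    refine (abs_sub _ _).trans ?_
    linarith
  -- Divide the product by `l₂`, then exchange `l₂` for `lam`. The first error is O(x²/A) and the
  -- second is A x · x / A², again O(x²/A).
  have e : l₁ - δ / lam * x = (l₁ * l₂ - δ * x) / l₂ + δ * x * (lam - l₂) / (l₂ * lam) := by
    field_simp
    ring
  have hlamA : q * A ≤ lam := by nlinarith
  rw [e]
  refine (abs_add_le _ _).trans ?_
  have k1 : |(l₁ * l₂ - δ * x) / l₂| ≤ K * x ^ 2 / (q * A) := by
    rw [abs_div, abs_of_pos hl₂0]
    exact div_le_div₀ (by positivity) hD hqA hl₂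
  have k2 : |δ * x * (lam - l₂) / (l₂ * lam)| ≤
      (B * A * x) * (((B + K) / q + B + K) * x) / ((q * A) * (q * A)) := by
    rw [abs_div, abs_of_pos (mul_pos hl₂0 hlam0), abs_mul]
    exact div_le_div₀ (by positivity) (mul_le_mul h2 h7 (abs_nonneg _) (by positivity))
      (by positivity) (mul_le_mul hl₂ hlamA hqA.le hl₂0.le)
  refine (add_le_add k1 k2).trans_eq ?_
  field_simp

/-! ### Expansion of the two lowest eigenvalues -/

namespace Bloch
variable {s : ℝ} {ν c₀ d μ : ℝ} {T : Family s} {lam2 : ℝ → ℝ}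
  {lam : ℝ → ℝ → ℝ} {W : ℝ → Hper s} {V : ℝ → ℝ → Hper s}

theorem eventually_mul_pow_lt (k : ℝ) (i : ℕ) (hi : i ≠ 0) {b : ℝ} (hb : 0 < b) :
    ∀ᶠ x : ℝ in 𝓝 0, k * x ^ i < b := by
  have h : Continuous fun x : ℝ => k * x ^ i := by fun_prop
  exact (h.tendsto' 0 0 (by simp [hi])).eventually_lt_const hb

/-- The quadratic coefficient `δ / l` of the lower eigenvalue. -/
theorem abs_quadratic_coeff_le {Λ K C d l δ g a : ℝ} (hΛ : 0 < Λ) (hK : 0 ≤ K) (hC : 0 ≤ C)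
    (ha : a ≠ 0) (hl : Λ * a ^ 2 / 2 ≤ l) (hl' : |l - Λ * a ^ 2| ≤ K * |a| ^ 3)
    (hg : 0 ≤ g) (hg' : g ≤ C * a ^ 2) (hδ : |δ - (l * d / 2 - g)| ≤ K * |a| ^ 3) :
    |δ / l - 1 / 2 * d + g / (Λ * a ^ 2)| ≤ (2 * K / Λ + 2 * C * K / Λ ^ 2) * |a| := by
  have hA : 0 < a ^ 2 := by positivity
  have hΛA : 0 < Λ * a ^ 2 / 2 := by positivity
  have hl0 : 0 < l := hΛA.trans_le hl
  have e3 : |a| ^ 3 = a ^ 2 * |a| := by rw [pow_succ, sq_abs]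
  rw [e3] at hl' hδ
  have e : δ / l - 1 / 2 * d + g / (Λ * a ^ 2) =
      (δ - (l * d / 2 - g)) / l + g * (l - Λ * a ^ 2) / (l * (Λ * a ^ 2)) := by
    field_simp
    ring
  rw [e]
  have k1 : |(δ - (l * d / 2 - g)) / l| ≤ K * (a ^ 2 * |a|) / (Λ * a ^ 2 / 2) := by
    rw [abs_div, abs_of_pos hl0]
    exact div_le_div₀ (by positivity) hδ hΛA hl
  have k2 : |g * (l - Λ * a ^ 2) / (l * (Λ * a ^ 2))| ≤
      (C * a ^ 2) * (K * (a ^ 2 * |a|)) / ((Λ * a ^ 2 / 2) * (Λ * a ^ 2)) := by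
    rw [abs_div, abs_mul, abs_of_nonneg hg,
      abs_of_pos (by positivity : 0 < l * (Λ * a ^ 2))]
    exact div_le_div₀ (by positivity) (mul_le_mul hg' hl' (abs_nonneg _) (by positivity))
      (by positivity) (mul_le_mul_of_nonneg_right hl (by positivity))
  refine (abs_add_le _ _).trans ((add_le_add k1 k2).trans_eq ?_)
  field_simp

/-- For |c - c₀| ≤ C|a| the distance ε is at most (1 + C)|a|, so all remainders become powers of
|a|, and λ is comparable to a². Then `roots_expansion` applies with A = a². -/
theorem exists_expansion (hs : 0 ≤ s) (hP : IsBlochFamily ν c₀ T)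
    (h₁ : UnperturbedBands ν c₀ T d) (h₂ : SplitEigenvalues ν c₀ T lam2 lam W V)
    (h₃ : NonDegenerate ν c₀ T W V μ) {C : ℝ} (hC : 0 < C) :
    ∃ a₀ > 0, ∃ κ₀ > 0, ∃ M > 0, C * a₀ ^ 2 ≤ κ₀ ∧
      ∃ (gr ex : ℝ → ℝ → ℝ → ℝ) (r₀ r₁ r₂ : ℝ → ℝ → ℝ),
        ∀ a : ℝ, a ≠ 0 → |a| < a₀ → ∀ c : ℝ, |c - c₀| ≤ C * |a| →
          |r₀ a c| ≤ M * |a| ^ 3 ∧ |r₁ a c| ≤ M * |a| ∧ |r₂ a c| ≤ M * |a| ∧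
          (∀ κ : ℝ, |κ| ≤ κ₀ → AreLowestTwo ν T a c κ (gr a c κ) (ex a c κ)) ∧
          ∀ κ : ℝ, |κ| ≤ C * a ^ 2 →
            |gr a c κ -
              (1 / 2 * d - μ ^ 2 * (c - c₀) ^ 2 / (lam2 c₀ * a ^ 2) + r₁ a c) * κ ^ 2|
                ≤ M * |κ| ^ 3 ∧
            |ex a c κ - (lam2 c₀ * a ^ 2 + r₀ a c +
              (1 / 2 * d + μ ^ 2 * (c - c₀) ^ 2 / (lam2 c₀ * a ^ 2) + r₂ a c) * κ ^ 2)|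
                ≤ M * |κ| ^ 3 := by
  obtain ⟨τ, δ, η, K, r, hK, hr, h⟩ := exists_lowestTwo_expansion hs hP h₁ h₂ h₃
  have hΛ := h₂.lam2_pos
  have hd := h₁.d_pos
  obtain ⟨Λ, hΛe⟩ : ∃ Λ, Λ = lam2 c₀ := ⟨_, rfl⟩
  simp only [← hΛe] at *
  obtain ⟨K', hK'⟩ : ∃ K', K' = K * (1 + C) + K * (1 + C) ^ 3 := ⟨_, rfl⟩
  have hK'0 : 0 < K' := by rw [hK']; positivity
  obtain ⟨B, hB⟩ : ∃ B, B = d + K' + (Λ + K') * d / 2 + μ ^ 2 * C ^ 2 := ⟨_, rfl⟩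
  have hB0 : 0 < B := by rw [hB]; positivity
  -- With this choice the requirement `4 * q * a ^ 2 ≤ lam` is the lower bound `Λ * a ^ 2 / 2 ≤
  -- lam`.
  obtain ⟨q, hq⟩ : ∃ q, q = Λ / 8 := ⟨_, rfl⟩
  have hq0 : 0 < q := by rw [hq]; positivity
  obtain ⟨M₁, hM₁⟩ : ∃ M₁, M₁ = K / q + B * ((B + K) / q + B + K) / q ^ 2 := ⟨_, rfl⟩
  have hM₁0 : 0 < M₁ := by rw [hM₁]; positivity
  obtain ⟨M₂, hM₂⟩ : ∃ M₂, M₂ = 2 * K' / Λ + 2 * (μ ^ 2 * C ^ 2) * K' / Λ ^ 2 := ⟨_, rfl⟩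
  have hM₂0 : 0 < M₂ := by rw [hM₂]; positivity
  obtain ⟨a₀, ⟨⟨s1, s2, s3⟩, s4, s5, s6⟩, ha₀⟩ :=
    ((((eventually_mul_pow_lt (1 + C) 1 one_ne_zero hr).and
    ((eventually_mul_pow_lt 1 1 one_ne_zero one_pos).and
    (eventually_mul_pow_lt (C ^ 2) 2 two_ne_zero one_pos))).and
    ((eventually_mul_pow_lt ((B + K) * C ^ 2) 2 two_ne_zero (by positivity : 0 < 2 * q)).and
    ((eventually_mul_pow_lt K' 1 one_ne_zero (by positivity : 0 < Λ / 2)).and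
    (eventually_mul_pow_lt C 2 two_ne_zero (by positivity : 0 < r / 2))))).filter_mono
    (nhdsWithin_le_nhds (s := Ioi 0)) |>.and self_mem_nhdsWithin).exists
  rw [pow_one] at s1 s2 s5
  refine ⟨a₀, ha₀, r / 2, by positivity, K' + M₂ + (M₁ * C + K * C), by positivity, s6.le, ?_⟩
  have hch : ∀ a c κ : ℝ, ∃ l : ℝ × ℝ, a ≠ 0 → |a| < r → |c - c₀| < r → |κ| < r →
      AreLowestTwo ν T a c κ l.1 l.2 ∧
            |l.1 + l.2 - (lam a c + τ a c * κ ^ 2)| ≤ K * κ ^ 4 ∧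
            |l.1 * l.2 - δ a c * κ ^ 2| ≤ K * κ ^ 4 := by
    intro a c κ
    by_cases hh : a ≠ 0 ∧ |a| < r ∧ |c - c₀| < r ∧ |κ| < r
    · obtain ⟨l₁, l₂, k⟩ := ((h a c hh.1 hh.2.1 hh.2.2.1).2.2.2.2.2 κ hh.2.2.2).2.2
      exact ⟨(l₁, l₂), fun _ _ _ _ => ⟨k.1, k.2.1, k.2.2.1⟩⟩
    · exact ⟨0, fun k1 k2 k3 k4 => absurd ⟨k1, k2, k3, k4⟩ hh⟩
  choose l hl using hch
  -- The remainder `r₁` is what makes the quadratic coefficient equal to δ/λ; `r₂` is `τ - d` minus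
  -- `r₁`, since the upper eigenvalue is the trace minus the lower one.
  refine ⟨fun a c κ => (l a c κ).1, fun a c κ => (l a c κ).2, fun a c => lam a c - Λ * a ^ 2,
    fun a c => δ a c / lam a c - 1 / 2 * d + (μ * (c - c₀)) ^ 2 / (Λ * a ^ 2),
    fun a c => (τ a c - d) - (δ a c / lam a c - 1 / 2 * d + (μ * (c - c₀)) ^ 2 / (Λ * a ^ 2)),
    ?_⟩
  intro a ha haa c hc
  have ha0 := abs_pos.mpr ha
  have hsum : |a| + |c - c₀| ≤ (1 + C) * |a| := by linarith
  have hlt : (1 + C) * |a| < r := (mul_lt_mul_of_pos_left haa (by positivity)).trans s1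
  have har : |a| < r := by linarith [abs_nonneg (c - c₀)]
  have hcr : |c - c₀| < r := by linarith
  have ha1 : |a| < 1 := by linarith
  obtain ⟨f1, f2, f3, f4, -, -⟩ := h a c ha har hcr
  have hsq : a ^ 2 ≤ a₀ ^ 2 := sq_le_sq' (by linarith [(abs_lt.mp haa).1]) (abs_lt.mp haa).2.le
  have hA : 0 < a ^ 2 := by positivity
  have hA1 : a ^ 2 ≤ |a| := by rw [← sq_abs]; nlinarith
  have e3 : |a| ^ 3 = a ^ 2 * |a| := by rw [pow_succ, sq_abs]
  have g1 : |δ a c - (lam a c * d / 2 - (μ * (c - c₀)) ^ 2)| ≤ K' * |a| ^ 3 := by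
    refine f1.trans ?_
    calc K * (|a| + |c - c₀|) ^ 3 ≤ K * ((1 + C) * |a|) ^ 3 := by gcongr
      _ = K * (1 + C) ^ 3 * |a| ^ 3 := by ring
      _ ≤ K' * |a| ^ 3 := by
        refine mul_le_mul_of_nonneg_right ?_ (by positivity)
        have : 0 ≤ K * (1 + C) := by positivity
        rw [hK']; linarith
  have hKK : K * (1 + C) ≤ K' := by
    rw [hK']
    have : 0 ≤ K * (1 + C) ^ 3 := by positivity
    linarith
  have g2 : |τ a c - d| ≤ K' * |a| := by
    refine f2.trans ?_
    calc K * (|a| + |c - c₀|) ≤ K * ((1 + C) * |a|) := by gcongr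
      _ = K * (1 + C) * |a| := by ring
      _ ≤ K' * |a| := mul_le_mul_of_nonneg_right hKK ha0.le
  have g3 : |lam a c - Λ * a ^ 2| ≤ K' * |a| ^ 3 := by
    refine f3.trans ?_
    calc K * (a ^ 2 * (|a| + |c - c₀|)) ≤ K * (a ^ 2 * ((1 + C) * |a|)) := by gcongr
      _ = K * (1 + C) * |a| ^ 3 := by rw [e3]; ring
      _ ≤ K' * |a| ^ 3 := mul_le_mul_of_nonneg_right hKK (by positivity)
  have hKa : K' * |a| < Λ / 2 := (mul_lt_mul_of_pos_left haa hK'0).trans s5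
  have g4 : Λ * a ^ 2 / 2 ≤ lam a c := by
    have := (abs_le.mp g3).1
    rw [e3] at this
    have := mul_lt_mul_of_pos_right hKa hA
    linarith
  have hγ : (μ * (c - c₀)) ^ 2 ≤ μ ^ 2 * C ^ 2 * a ^ 2 := by
    rw [mul_pow, mul_assoc]
    refine mul_le_mul_of_nonneg_left ?_ (sq_nonneg _)
    rw [← mul_pow]
    refine sq_le_sq.mpr ?_
    rw [abs_mul C, abs_of_pos hC]
    exact hc
  have g5 := abs_quadratic_coeff_le hΛ hK'0.le (by positivity : 0 ≤ μ ^ 2 * C ^ 2) ha g4 g3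
    (sq_nonneg _) hγ g1
  rw [← hM₂] at g5
  have hB1 : |τ a c| ≤ B := by
    have e : τ a c = (τ a c - d) + d := by ring
    rw [e]
    refine (abs_add_le _ _).trans ?_
    rw [abs_of_pos hd, hB]
    have h1 : 0 ≤ (Λ + K') * d / 2 + μ ^ 2 * C ^ 2 := by positivity
    have h2 : K' * |a| ≤ K' := mul_le_of_le_one_right hK'0.le ha1.le
    linarith
  have hB2 : |δ a c| ≤ B * a ^ 2 := by
    have e : δ a c = (δ a c - (lam a c * d / 2 - (μ * (c - c₀)) ^ 2)) +
      (lam a c * d / 2 - (μ * (c - c₀)) ^ 2) := by ring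
    rw [e]
    have k3 : K' * |a| ^ 3 ≤ K' * a ^ 2 := by
      rw [e3]
      exact mul_le_mul_of_nonneg_left (mul_le_of_le_one_right hA.le ha1.le) hK'0.le
    have k1 : lam a c ≤ (Λ + K') * a ^ 2 := by
      have := (abs_le.mp g3).2
      linarith
    have k2 : |lam a c * d / 2 - (μ * (c - c₀)) ^ 2| ≤
        (Λ + K') * d / 2 * a ^ 2 + μ ^ 2 * C ^ 2 * a ^ 2 := by
      refine (abs_sub _ _).trans ?_
      rw [abs_of_nonneg (sq_nonneg (μ * (c - c₀))), abs_of_nonneg (by positivity)]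
      have := mul_le_mul_of_nonneg_right k1 (by positivity : 0 ≤ d / 2)
      linarith
    refine (abs_add_le _ _).trans ?_
    rw [hB]
    have k4 : 0 ≤ d * a ^ 2 := by positivity
    linarith
  refine ⟨?_, ?_, ?_, fun κ hκ => ?_, fun κ hκ => ?_⟩
  · refine g3.trans (mul_le_mul_of_nonneg_right ?_ (by positivity))
    have : 0 ≤ M₁ * C + K * C := by positivity
    linarith
  · refine g5.trans (mul_le_mul_of_nonneg_right ?_ ha0.le)
    have : 0 ≤ M₁ * C + K * C := by positivity
    linarith
  · refine (abs_sub _ _).trans ?_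
    have : 0 ≤ (M₁ * C + K * C) * |a| := by positivity
    linarith
  · exact (hl a c κ ha har hcr (by linarith)).1
  · have hCa : C * a ^ 2 < r / 2 := (mul_le_mul_of_nonneg_left hsq hC.le).trans_lt s6
    obtain ⟨m1, m2, m3⟩ := hl a c κ ha har hcr (by linarith)
    have hκ2 : κ ^ 2 ≤ C ^ 2 * (a ^ 2) ^ 2 := by
      rw [← mul_pow, ← sq_abs]
      exact pow_le_pow_left₀ (abs_nonneg _) hκ 2
    have m4 := roots_expansion hq0 hK.le hA m1.1 (by rw [hq]; linarith) hB1 hB2 hκ2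
      ((mul_le_mul_of_nonneg_left hsq (by positivity)).trans s3.le) (by linarith)
      (by
        rw [← mul_assoc]
        exact (mul_le_mul_of_nonneg_left hsq (by positivity)).trans s4.le) m2 m3
    rw [← hM₁] at m4
    have e4 : κ ^ 4 = |κ| * |κ| ^ 3 := by
      rw [← abs_of_nonneg (by positivity : 0 ≤ κ ^ 4), abs_pow]; ring
    have m5 : |(l a c κ).1 - δ a c / lam a c * κ ^ 2| ≤ M₁ * C * |κ| ^ 3 := by
      refine m4.trans ?_
      rw [mul_assoc]
      refine mul_le_mul_of_nonneg_left ?_ hM₁0.le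
      -- The range of κ in the statement comes from here: κ⁴/a² ≤ C|κ|³ as soon as |κ| ≤ C a².
      rw [div_le_iff₀ hA, e4]
      have := mul_le_mul_of_nonneg_right hκ (by positivity : 0 ≤ |κ| ^ 3)
      linarith
    have m6 : K * κ ^ 4 ≤ K * C * |κ| ^ 3 := by
      rw [mul_assoc]
      refine mul_le_mul_of_nonneg_left ?_ hK.le
      rw [e4]
      refine mul_le_mul_of_nonneg_right (hκ.trans ?_) (by positivity)
      exact mul_le_of_le_one_right hC.le (by linarith)
    have hp : 0 ≤ (K' + M₂) * |κ| ^ 3 := by positivity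
    have hp' : 0 ≤ K * C * |κ| ^ 3 := by positivity
    constructor
    · have e : (l a c κ).1 - (1 / 2 * d - μ ^ 2 * (c - c₀) ^ 2 / (Λ * a ^ 2) +
          (δ a c / lam a c - 1 / 2 * d + (μ * (c - c₀)) ^ 2 / (Λ * a ^ 2))) * κ ^ 2 =
          (l a c κ).1 - δ a c / lam a c * κ ^ 2 := by ring
      simp only [e]
      linarith
    · have e : (l a c κ).2 - (Λ * a ^ 2 + (lam a c - Λ * a ^ 2) +
          (1 / 2 * d + μ ^ 2 * (c - c₀) ^ 2 / (Λ * a ^ 2) + ((τ a c - d) -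
          (δ a c / lam a c - 1 / 2 * d + (μ * (c - c₀)) ^ 2 / (Λ * a ^ 2)))) * κ ^ 2) =
          ((l a c κ).1 + (l a c κ).2 - (lam a c + τ a c * κ ^ 2)) -
          ((l a c κ).1 - δ a c / lam a c * κ ^ 2) := by ring
      simp only [e]
      refine (abs_sub _ _).trans ?_
      linarith

end Bloch

/-! ### Positivity of the quadratic forms -/

namespace Bloch
variable {s : ℝ} {ν c₀ d μ : ℝ} {T : Family s} {lam2 : ℝ → ℝ}
  {lam : ℝ → ℝ → ℝ} {W : ℝ → Hper s} {V : ℝ → ℝ → Hper s}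

/-- Positivity of the form of the fibre at `κ`. -/
def IsPositiveAt (ν : ℝ) (T : Family s) (a c κ : ℝ) : Prop :=
  ∀ w ∈ dom s ν κ, w ≠ 0 → 0 < (inner ℂ (toL2 w) (P ν T a c κ w)).re

theorem norm_toL2_pos {w : Hper s} (hw : w ≠ 0) : 0 < ‖toL2 w‖ :=
  norm_pos_iff.mpr fun h => hw (toL2_injective (by rw [h, map_zero]))

theorem AreLowestTwo.isPositiveAt {a c κ l₁ l₂ : ℝ} (hT : IsSelfAdjoint (toUnbounded (T a c κ)))
    (h : AreLowestTwo ν T a c κ l₁ l₂) (hl : 0 < l₁) : IsPositiveAt ν T a c κ := fun w hw h0 =>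
  (mul_pos hl (pow_pos (norm_toL2_pos h0) 2)).trans_le (h.rayleigh hT hw)

/-- If the lowest eigenvalue is zero and simple, the form is positive off its eigenspace. -/
theorem AreLowestTwo.pos_of_notMem_span {a c κ l₂ : ℝ}
    (hT : IsSelfAdjoint (toUnbounded (T a c κ))) (h : AreLowestTwo ν T a c κ 0 l₂) (hl : 0 < l₂)
    {v w : Hper s} (hv : v ∈ dom s ν κ) (hv0 : v ≠ 0) (hPv : P ν T a c κ v = 0)
    (hw : w ∈ dom s ν κ) (hwv : w ∉ Submodule.span ℂ {v}) :
    0 < (inner ℂ (toL2 w) (P ν T a c κ w)).re := by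
  obtain ⟨-, w₁, hw₁, w₂, hw₂, n₁, n₂, ho, e₁, e₂, hlow⟩ := h
  -- With `l₁ = 0`, a nonpositive form forces equality in Bessel's inequality for `w₁`, so `u` is a
  -- multiple of `w₁`. Applied to `w` and to `v ≠ 0`, this makes `w` a multiple of `v`.
  have key : ∀ u ∈ dom s ν κ, (inner ℂ (toL2 u) (P ν T a c κ u)).re ≤ 0 →
      u = (inner ℂ (toL2 w₁) (toL2 u) : ℂ) • w₁ := by
    intro u hu hle
    have hr := rayleigh_lower_bound toL2 (P ν T a c κ) (dom s ν κ)
      (fun v hv w hw => P_symm hT hv hw) hw₁ hw₂ n₁ n₂ ho e₁ e₂ hlow hu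
    rw [sub_zero] at hr
    have h1 : ‖toL2 u‖ ^ 2 ≤ ‖(inner ℂ (toL2 w₁) (toL2 u) : ℂ)‖ ^ 2 :=
      le_of_mul_le_mul_left (by linarith) hl
    have h2 : ‖toL2 u - (inner ℂ (toL2 w₁) (toL2 u) : ℂ) • toL2 w₁‖ ^ 2 =
        ‖toL2 u‖ ^ 2 - ‖(inner ℂ (toL2 w₁) (toL2 u) : ℂ)‖ ^ 2 := by
      rw [@norm_sub_sq ℂ, norm_smul, n₁, mul_one, inner_smul_right, ← inner_conj_symm (toL2 u),
        Complex.mul_conj']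
      have : ∀ x : ℝ, RCLike.re ((x : ℂ) ^ 2) = x ^ 2 := fun x => by
        rw [← Complex.ofReal_pow]; exact Complex.ofReal_re _
      rw [this]
      ring
    have h3 : ‖toL2 u - (inner ℂ (toL2 w₁) (toL2 u) : ℂ) • toL2 w₁‖ ^ 2 ≤ 0 := by linarith
    have h4 := norm_eq_zero.mp (pow_eq_zero_iff two_ne_zero |>.mp
      (le_antisymm h3 (sq_nonneg _)))
    apply toL2_injective
    rw [map_smul]
    exact sub_eq_zero.mp h4
  by_contra hcon
  have k1 := key w hw (not_lt.mp hcon)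
  have k2 := key v hv (by rw [hPv, inner_zero_right]; exact le_rfl)
  have hc : (inner ℂ (toL2 w₁) (toL2 v) : ℂ) ≠ 0 := fun h => hv0 (by rw [k2, h, zero_smul])
  apply hwv
  rw [Submodule.mem_span_singleton]
  refine ⟨inner ℂ (toL2 w₁) (toL2 w) / inner ℂ (toL2 w₁) (toL2 v), ?_⟩
  exact (congrArg _ k2).trans (by rw [smul_smul, div_mul_cancel₀ _ hc]; exact k1.symm)

/-- Away from `κ = 0` the fibres are uniformly positive. -/
theorem eventually_isPositiveAt (hs : 0 ≤ s) (hP : IsBlochFamily ν c₀ T)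
    (h₁ : UnperturbedBands ν c₀ T d)
    (hb : ∀ κ ∈ BZ, κ ≠ 0 → 0 < band ν T c₀ 1 κ ∧ 0 < band ν T c₀ (-1) κ) {κ₀ : ℝ}
    (hκ₀ : κ₀ ∈ BZ) (hne : κ₀ ≠ 0) :
    ∀ᶠ p : ℝ × ℝ × ℝ in 𝓝 (0, c₀, κ₀), p.2.2 ∈ BZ → IsPositiveAt ν T p.1 p.2.1 p.2.2 := by
  obtain ⟨t, ht⟩ := exists_symbol hP hκ₀
  obtain ⟨C, hC, hgap⟩ := h₁.gap
  have hm : ∀ n : ℤ, mode n ∈ fibre ν κ₀ := fun n => mode_mem_fibre (Or.inr (Or.inl hne))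
  obtain ⟨b1, b2⟩ := hb κ₀ hκ₀ hne
  set e := min C (min (band ν T c₀ 1 κ₀) (band ν T c₀ (-1) κ₀)) with he
  have he0 : 0 < e := lt_min hC (lt_min b1 b2)
  -- No correction is needed in the modes ±1, and in the zeroth mode it is the singular term frozen
  -- at `κ₀`. Its variation near `κ₀ ≠ 0` costs at most `e / 4` of the lower bound `e / 2`.
  have hlow : ∀ n : ℤ, e ≤ (t n).re + (if n = 1 ∨ n = -1 then 0 else 0) +
      if n = 0 then ν / κ₀ ^ 2 else 0 := by
    intro n
    rw [ite_self, add_zero, ← band_eq (hm n) (ht n)]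
    by_cases n1 : n = 1
    · rw [n1]; exact (min_le_right _ _).trans (min_le_left _ _)
    by_cases n2 : n = -1
    · rw [n2]; exact (min_le_right _ _).trans (min_le_right _ _)
    exact (min_le_left _ _).trans (hgap κ₀ hκ₀ n n1 n2 (hm n))
  have hcont : Tendsto (fun p : ℝ × ℝ × ℝ => ν / p.2.2 ^ 2) (𝓝 (0, c₀, κ₀))
      (𝓝 (ν / κ₀ ^ 2)) := by
    have h1 : Tendsto (fun p : ℝ × ℝ × ℝ => p.2.2 ^ 2) (𝓝 (0, c₀, κ₀)) (𝓝 (κ₀ ^ 2)) := by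
      have : Continuous (fun p : ℝ × ℝ × ℝ => p.2.2 ^ 2) := by fun_prop
      exact this.tendsto (0, c₀, κ₀)
    exact tendsto_const_nhds.div h1 (pow_ne_zero 2 hne)
  filter_upwards [eventually_form_lower_bound hs hP hκ₀ he0 ht hlow,
    hcont.eventually_const_lt (by linarith : ν / κ₀ ^ 2 - e / 4 < ν / κ₀ ^ 2)] with p hp hq hBZ
  intro w hw h0
  have h1 := hp hBZ w
  have hc : ‖coeff 0 (toL2 w)‖ ^ 2 ≤ ‖toL2 w‖ ^ 2 := by
    refine pow_le_pow_left₀ (norm_nonneg _) ?_ 2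
    refine (norm_inner_le_norm _ _).trans ?_
    have : ‖mode 0‖ = 1 := (orthonormal_fourier (T := 2 * Real.pi)).1 0
    rw [this, one_mul]
  rw [re_inner_P hw]
  rw [zero_mul, add_zero] at h1
  have h2 : (ν / κ₀ ^ 2 - ν / p.2.2 ^ 2) * ‖coeff 0 (toL2 w)‖ ^ 2 ≤ e / 4 * ‖toL2 w‖ ^ 2 :=
    (mul_le_mul_of_nonneg_right (by linarith) (sq_nonneg _)).trans
      (mul_le_mul_of_nonneg_left hc (by positivity))
  have h3 : 0 < e / 4 * ‖toL2 w‖ ^ 2 := by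
    have := norm_toL2_pos h0
    positivity
  linarith

theorem sinF_ne_zero : sinF ≠ 0 := by
  intro h
  have := inner_sinF_sinF
  rw [h, inner_zero_left] at this
  norm_num at this

theorem SplitEigenvalues.W_ne_zero (h₂ : SplitEigenvalues ν c₀ T lam2 lam W V) :
    ∀ᶠ a in 𝓝 (0 : ℝ), a ≠ 0 → W a ≠ 0 := by
  obtain ⟨M, hM⟩ := h₂.W_expansion
  have ht : Continuous fun a : ℝ => M * |a| := by fun_prop
  filter_upwards [hM, (ht.tendsto' 0 0 (by simp)).eventually_lt_const
    (norm_pos_iff.mpr sinF_ne_zero)] with a h1 h2 ha h0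
  have := h1 ha
  rw [h0, map_zero, zero_sub, norm_neg] at this
  linarith

end Bloch

/-- The determinant coefficient is positive for `|γ|` below the threshold `k |a| - N a²`. -/
theorem det_coeff_pos {Λ K d k N l δ a g μ : ℝ} (hK : 0 < K) (hd : 0 < d) (hk : 0 < k)
    (hμ : 0 < μ ^ 2) (hkk : μ ^ 2 * k ^ 2 = Λ * d / 2)
    (hN : μ ^ 2 * k * N = d / 2 * K * (1 + k) + K * (1 + k) ^ 3) (ha : a ≠ 0) (hg : 0 ≤ g)
    (hga : g < k * |a| - N * a ^ 2)
    (hl : |l - Λ * a ^ 2| ≤ K * (a ^ 2 * (|a| + g)))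
    (hδ : |δ - (l * d / 2 - μ ^ 2 * g ^ 2)| ≤ K * (|a| + g) ^ 3) : 0 < δ := by
  obtain ⟨x, hx⟩ : ∃ x, x = |a| := ⟨_, rfl⟩
  have hx0 : 0 < x := hx ▸ abs_pos.mpr ha
  have hax : a ^ 2 = x ^ 2 := by rw [hx, sq_abs]
  rw [← hx, hax] at hga hl
  rw [← hx] at hδ
  have hN0 : 0 < N := by
    have h1 : 0 < μ ^ 2 * k * N := by rw [hN]; positivity
    exact pos_of_mul_pos_right h1 (by positivity)
  have hNx : N * x < k := by
    have : N * x * x < k * x := by nlinarith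
    exact lt_of_mul_lt_mul_right this hx0.le
  have hgk : x + g ≤ (1 + k) * x := by
    have : 0 ≤ N * x ^ 2 := by positivity
    linarith
  have h1 : Λ * x ^ 2 - K * (1 + k) * x ^ 3 ≤ l := by
    have e1 := (abs_le.mp hl).1
    have e2 : K * (x ^ 2 * (x + g)) ≤ K * (x ^ 2 * ((1 + k) * x)) := by gcongr
    linarith
  have h2 : l * d / 2 - μ ^ 2 * g ^ 2 - K * (1 + k) ^ 3 * x ^ 3 ≤ δ := by
    have e1 := (abs_le.mp hδ).1
    have e2 : K * (x + g) ^ 3 ≤ K * ((1 + k) * x) ^ 3 := by gcongr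
    rw [mul_pow] at e2
    linarith
  have h3 : μ ^ 2 * g ^ 2 ≤ μ ^ 2 * (k * x - N * x ^ 2) ^ 2 := by gcongr
  have h4 : (Λ * x ^ 2 - K * (1 + k) * x ^ 3) * (d / 2) ≤ l * (d / 2) :=
    mul_le_mul_of_nonneg_right h1 (by positivity)
  -- At leading order μ²k² cancels Λ d/2. Since `N * x < k`, the cubic term gains more than `μ² k N
  -- x³`, and `N` was chosen so that `μ² k N` equals the sum of the error constants.
  have e1 : μ ^ 2 * (k * x - N * x ^ 2) ^ 2 =
      Λ * d / 2 * x ^ 2 - x ^ 3 * (2 * (μ ^ 2 * k * N) - μ ^ 2 * N * (N * x)) := by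
    rw [← hkk]; ring
  have h5 : μ ^ 2 * N * (N * x) < μ ^ 2 * k * N := by
    calc μ ^ 2 * N * (N * x) < μ ^ 2 * N * k := mul_lt_mul_of_pos_left hNx (by positivity)
      _ = _ := by ring
  have h6 : x ^ 3 * (d / 2 * K * (1 + k) + K * (1 + k) ^ 3) <
      x ^ 3 * (2 * (μ ^ 2 * k * N) - μ ^ 2 * N * (N * x)) :=
    mul_lt_mul_of_pos_left (by rw [← hN]; linarith) (by positivity)
  rw [e1] at h3
  linarith

namespace Bloch
variable {s : ℝ} {ν c₀ d μ : ℝ} {T : Family s} {lam2 : ℝ → ℝ}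
  {lam : ℝ → ℝ → ℝ} {W : ℝ → Hper s} {V : ℝ → ℝ → Hper s}

/-- For κ ≠ 0, δ > 0 makes the lowest eigenvalue positive near κ = 0, and the positive bands take
care of the rest of the zone. At κ = 0 the zero eigenvalue is simple, with W as eigenvector. -/
theorem exists_positivity_interval (hs : 0 ≤ s) (hP : IsBlochFamily ν c₀ T)
    (h₁ : UnperturbedBands ν c₀ T d) (h₂ : SplitEigenvalues ν c₀ T lam2 lam W V)
    (h₃ : NonDegenerate ν c₀ T W V μ)
    (hb : ∀ κ ∈ BZ, κ ≠ 0 → 0 < band ν T c₀ 1 κ ∧ 0 < band ν T c₀ (-1) κ) :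
    ∃ cm cp : ℝ → ℝ,
      (fun a => cm a - (c₀ - √(lam2 c₀ * d) / (√2 * |μ|) * |a|)) =O[𝓝 0] (fun a => a ^ 2) ∧
      (fun a => cp a - (c₀ + √(lam2 c₀ * d) / (√2 * |μ|) * |a|)) =O[𝓝 0] (fun a => a ^ 2) ∧
      ∀ᶠ a in 𝓝[≠] 0, ∀ c ∈ Ioo (cm a) (cp a), IsPositive ν T a c (W a) := by
  obtain ⟨τ, δ, η, K, r, hK, hr, h⟩ := exists_lowestTwo_expansion hs hP h₁ h₂ h₃
  have hΛ := h₂.lam2_pos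
  have hd := h₁.d_pos
  have hμ0 := h₃.mu_ne_zero
  have hμ := abs_pos.mpr hμ0
  set k := √(lam2 c₀ * d) / (√2 * |μ|) with hk
  have hk0 : 0 < k := by positivity
  have hμ2 : 0 < μ ^ 2 := by rw [← sq_abs]; positivity
  have hkk : μ ^ 2 * k ^ 2 = lam2 c₀ * d / 2 := by
    rw [hk, div_pow, mul_pow, Real.sq_sqrt (by positivity), Real.sq_sqrt (by norm_num), sq_abs]
    field_simp
  set N := (d / 2 * K * (1 + k) + K * (1 + k) ^ 3) / (μ ^ 2 * k) with hN
  have hN' : μ ^ 2 * k * N = d / 2 * K * (1 + k) + K * (1 + k) ^ 3 := by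
    rw [hN]; field_simp
  have hN0 : 0 < N := by positivity
  -- the fibres with nonzero quasimomentum
  have hpos : ∀ᶠ p : ℝ × ℝ in 𝓝 (0, c₀), ∀ κ ∈ BZ, κ ∈ BZ → p.1 ≠ 0 →
      0 < δ p.1 p.2 → κ ≠ 0 →
      IsPositiveAt ν T p.1 p.2 κ := by
    -- Local statements around each `κ₀`, including 0, are patched by compactness into one
    -- neighbourhood of (0, c₀). The sign of δ is kept as a hypothesis inside, since it does not
    -- hold on a full neighbourhood.
    refine isCompact_Icc.eventually_forall_of_forall_eventually (K := BZ) fun κ₀ hκ₀ => ?_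
    have hassoc : Tendsto (fun z : (ℝ × ℝ) × ℝ => (z.1.1, z.1.2, z.2)) (𝓝 ((0, c₀), κ₀))
        (𝓝 (0, c₀, κ₀)) := by
      have : Continuous (fun z : (ℝ × ℝ) × ℝ => (z.1.1, z.1.2, z.2)) := by fun_prop
      exact this.tendsto ((0, c₀), κ₀)
    by_cases hne : κ₀ = 0
    · subst hne
      refine hassoc.eventually (p := fun q : ℝ × ℝ × ℝ => q.2.2 ∈ BZ → q.1 ≠ 0 →
        0 < δ q.1 q.2.1 → q.2.2 ≠ 0 → IsPositiveAt ν T q.1 q.2.1 q.2.2) (eventually_nhds_triple_iff.mpr ?_)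
      -- The bound `d / (4 K)` on |a| and |c - c₀| gives τ ≥ d/2; on |κ|, together with |κ| < 1, it
      -- lets τκ² absorb the error of the trace. The bound `d² / (8 K)` lets ηκ⁴ absorb the error of
      -- the determinant.
      refine ⟨min r (min (d / (4 * K)) (min (d ^ 2 / (8 * K)) 1)), by positivity, ?_⟩
      intro a c κ har hcr hκr _ ha hδ hκ
      simp only [lt_min_iff] at har hcr hκr
      obtain ⟨-, f2, -, f4, f5, f6⟩ := h a c ha har.1 hcr.1
      obtain ⟨-, hT, l₁, l₂, hl, hS, -, hD⟩ := f6 κ hκr.1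
      have hκ0 : 0 < |κ| := abs_pos.mpr hκ
      have e4 : κ ^ 4 = |κ| ^ 4 := by rw [pow_abs, abs_of_nonneg (by positivity : 0 ≤ κ ^ 4)]
      have hτ : d / 2 ≤ τ a c := by
        have e1 := (abs_le.mp f2).1
        have e2 := (lt_div_iff₀ (by positivity)).mp har.2.1
        have e3 := (lt_div_iff₀ (by positivity)).mp hcr.2.1
        linarith
      have hsum : 0 < l₁ + l₂ := by
        have e1 := (abs_le.mp hS).1
        have e2 := (lt_div_iff₀ (by positivity)).mp hκr.2.1
        have e3 : K * κ ^ 4 ≤ d / 2 * κ ^ 2 := by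
          have e5 : κ ^ 4 = |κ| * |κ| * κ ^ 2 := by rw [abs_mul_abs_self]; ring
          rw [e5, ← mul_assoc]
          refine mul_le_mul_of_nonneg_right ?_ (sq_nonneg _)
          have : K * (|κ| * |κ|) ≤ K * |κ| :=
            mul_le_mul_of_nonneg_left (mul_le_of_le_one_right hκ0.le hκr.2.2.2.le) hK.le
          linarith
        have e4 := mul_le_mul_of_nonneg_right hτ (sq_nonneg κ)
        linarith
      have hprod : 0 < l₁ * l₂ := by
        have e1 := (abs_le.mp hD).1
        have e2 := (lt_div_iff₀ (by positivity)).mp hκr.2.2.1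
        have e3 : K * |κ| ^ 5 < d ^ 2 / 8 * κ ^ 4 := by
          rw [e4, pow_succ, mul_comm (|κ| ^ 4), ← mul_assoc]
          exact mul_lt_mul_of_pos_right (by linarith) (by positivity)
        have e5 := mul_le_mul_of_nonneg_right f5 (by positivity : 0 ≤ κ ^ 4)
        have e6 : 0 < δ a c * κ ^ 2 := by positivity
        linarith
      refine hl.isPositiveAt hT ?_
      by_contra hcon
      have := hl.1
      rcases (not_lt.mp hcon).lt_or_eq with h0 | h0
      · have := neg_of_mul_pos_right hprod h0.le
        linarith
      · rw [h0, zero_mul] at hprod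
        exact lt_irrefl _ hprod
    · filter_upwards [hassoc.eventually (eventually_isPositiveAt hs hP h₁ hb hκ₀ hne)]
        with z hz hBZ _ _ _
      exact hz hBZ
  -- The ideal interval is shortened by N a² on each side to absorb the cubic errors in δ.
  refine ⟨fun a => c₀ - (k * |a| - N * a ^ 2), fun a => c₀ + (k * |a| - N * a ^ 2), ?_, ?_, ?_⟩
  · refine ((Asymptotics.isBigO_refl (fun a : ℝ => a ^ 2) (𝓝 0)).const_mul_left N).congr_left
      fun a => ?_
    ring
  · refine ((Asymptotics.isBigO_refl (fun a : ℝ => a ^ 2) (𝓝 0)).const_mul_left (-N)).congr_left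
      fun a => ?_
    ring
  obtain ⟨q, hq, hq'⟩ := eventually_nhds_pair_iff.mp (hpos.and h₂.eigen_W)
  have hsmall : ∀ᶠ a : ℝ in 𝓝 0, (1 + k) * |a| < min r q := by
    have : Continuous fun a : ℝ => (1 + k) * |a| := by fun_prop
    exact (this.tendsto' 0 0 (by simp)).eventually_lt_const (lt_min hr hq)
  filter_upwards [hsmall.filter_mono nhdsWithin_le_nhds,
    h₂.W_ne_zero.filter_mono nhdsWithin_le_nhds, self_mem_nhdsWithin] with a hsm hW ha c hc
  have ha : a ≠ 0 := ha
  have ha0 := abs_pos.mpr ha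
  have hg : |c - c₀| < k * |a| - N * a ^ 2 := abs_lt.mpr ⟨by linarith [hc.1], by linarith [hc.2]⟩
  have hg' : |c - c₀| < (1 + k) * |a| := by
    have : 0 ≤ N * a ^ 2 := by positivity
    linarith
  have ha' : |a| < (1 + k) * |a| := by
    have := mul_pos hk0 ha0
    linarith
  obtain ⟨m1, m2⟩ := lt_min_iff.mp (ha'.trans hsm)
  obtain ⟨m3, m4⟩ := lt_min_iff.mp (hg'.trans hsm)
  obtain ⟨f1, -, f3, f4, -, f6⟩ := h a c ha m1 m3
  rw [mul_pow, ← sq_abs (c - c₀)] at f1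
  have hδ := det_coeff_pos hK hd hk0 hμ2 hkk hN' ha (abs_nonneg _) hg f3 f1
  obtain ⟨hp, hWd⟩ := hq' a c m2 m4
  obtain ⟨hWd, hPW⟩ := hWd ha
  refine ⟨fun κ hκ w hw hw0 hne => ?_, hWd, hPW⟩
  by_cases hκ0 : κ = 0
  · subst hκ0
    -- At κ = 0 the error terms vanish, so the sum is exactly λ > 0 and the product exactly 0; hence
    -- `l₁ = 0 < l₂`.
    obtain ⟨-, hT, l₁, l₂, hl, hS, hD, -⟩ := f6 0 (by simpa using hr)
    have hS' : l₁ + l₂ = lam a c := by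
      have : |l₁ + l₂ - lam a c| ≤ 0 := by simpa using hS
      exact sub_eq_zero.mp (abs_nonpos_iff.mp this)
    have hD' : l₁ * l₂ = 0 := by
      have : |l₁ * l₂| ≤ 0 := hD.trans_eq' (by simp) |>.trans_eq (by simp)
      exact abs_nonpos_iff.mp this
    have hle := hl.1
    have hl₂ : 0 < l₂ := by linarith
    have hl₁ : l₁ = 0 := (mul_eq_zero.mp hD').resolve_right hl₂.ne'
    rw [hl₁] at hl
    exact hl.pos_of_notMem_span hT hl₂ hWd (hW ha) hPW hw fun hmem => hne ⟨rfl, hmem⟩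
  · exact hp κ hκ hκ ha hδ hκ0 w hw hw0

end Bloch

end

theorem mainTheorem3 (s : ℝ) (hs : 0 ≤ s) (ν c₀ d μ : ℝ) (T : Bloch.Family s)
    (lam2 : ℝ → ℝ) (lam : ℝ → ℝ → ℝ) (W : ℝ → Bloch.Hper s) (V : ℝ → ℝ → Bloch.Hper s)
    (hP : Bloch.IsBlochFamily ν c₀ T)
    (h₁ : Bloch.UnperturbedBands ν c₀ T d)
    (h₂ : Bloch.SplitEigenvalues ν c₀ T lam2 lam W V)
    (h₃ : Bloch.NonDegenerate ν c₀ T W V μ) :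
    (∀ C > 0, ∃ a₀ > 0, ∃ κ₀ > 0, ∃ M > 0, C * a₀ ^ 2 ≤ κ₀ ∧
      ∃ (gr ex : ℝ → ℝ → ℝ → ℝ) (r₀ r₁ r₂ : ℝ → ℝ → ℝ),
        ∀ a : ℝ, a ≠ 0 → |a| < a₀ → ∀ c : ℝ, |c - c₀| ≤ C * |a| →
          |r₀ a c| ≤ M * |a| ^ 3 ∧ |r₁ a c| ≤ M * |a| ∧ |r₂ a c| ≤ M * |a| ∧
          (∀ κ : ℝ, |κ| ≤ κ₀ → Bloch.AreLowestTwo ν T a c κ (gr a c κ) (ex a c κ)) ∧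
          ∀ κ : ℝ, |κ| ≤ C * a ^ 2 →
            |gr a c κ -
              (1 / 2 * d - μ ^ 2 * (c - c₀) ^ 2 / (lam2 c₀ * a ^ 2) + r₁ a c) * κ ^ 2|
                ≤ M * |κ| ^ 3 ∧
            |ex a c κ - (lam2 c₀ * a ^ 2 + r₀ a c +
              (1 / 2 * d + μ ^ 2 * (c - c₀) ^ 2 / (lam2 c₀ * a ^ 2) + r₂ a c) * κ ^ 2)|
                ≤ M * |κ| ^ 3) ∧
    ((∀ κ ∈ Bloch.BZ, κ ≠ 0 → 0 < Bloch.band ν T c₀ 1 κ ∧ 0 < Bloch.band ν T c₀ (-1) κ) →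
      ∃ cm cp : ℝ → ℝ,
        (fun a => cm a - (c₀ - √(lam2 c₀ * d) / (√2 * |μ|) * |a|)) =O[𝓝 0] (fun a => a ^ 2) ∧
        (fun a => cp a - (c₀ + √(lam2 c₀ * d) / (√2 * |μ|) * |a|)) =O[𝓝 0] (fun a => a ^ 2) ∧
        ∀ᶠ a in 𝓝[≠] 0, ∀ c ∈ Ioo (cm a) (cp a), Bloch.IsPositive ν T a c (W a)) :=
  ⟨fun _ hC => Bloch.exists_expansion hs hP h₁ h₂ h₃ hC,
    fun hb => Bloch.exists_positivity_interval hs hP h₁ h₂ h₃ hb⟩
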